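/- **Translation.** Let $G\le S_n$ be given by at most $2n$ generators, and let $\psi\in\mathrm{Hom}(M,S_m)$, where $M\le G$, be given by its values on at most $2n$ generators of $M$. For a finite group $H$ let $\mathrm{Conj}^{\le m}(H)$ be the set of conjugacy classes $[L]_H$ of subgroups $L\le H$ of index at most $m$. Define the following instance $\mathrm{OMS}_\psi$ of Oracle Multi-dimensional Subset Sum with Repetition. * The universe is $\mathcal U=\mathrm{Conj}^{\le m}(M)$ and the index set is $\mathcal V=\mathrm{Conj}^{\le m}(G)$. A class in $\mathcal U$ (in $\mathcal V$) is encoded, non-uniquely, by a word of length $2n$ over the alphabet $M$ (over $G$) whose letters generate a subgroup in the class. * The target is the multiset $[\mathsf K]$ in $\mathcal U$ consisting of the classes $[M_x]_M$ of the point stabilizers $M_x$ of the action $\psi$ on $\{1,\dots,m\}$, with one point $x$ from each orbit. * For $[L]\in\mathcal V$, the member of the family at $[L]$ is the multiset $[\mathsf F_L]=\{\{[\sigma_i^{-1}L\sigma_i\cap M]_M : i=1,\dots,d\}\}$ in $\mathcal U$, where $\sigma_1,\dots,\sigma_d$ represent the double cosets in $L\backslash G/M$. * A solution is a multiset $\mathsf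 L:\mathcal V\to\mathbb N$ with $\sum_{v\in\mathcal V}\mathsf L(v)\,[\mathsf F_v]=[\mathsf K]$. Multisets are represented by listing encodings of the elements of their support, together with their multiplicities. Then, for all $n$, $m$, $G$, $M$ and $\psi$: (a) $\mathrm{OMS}_\psi$ is well defined (every element of $\mathcal U$ and of $\mathcal V$ has an encoding, and $[\mathsf F_L]$ depends neither on the choice of $L$ in its class nor on the choice of the $\sigma_i$) and is computable from $\psi$ in time polynomial in $n$ and $m$. That is, there are algorithms, the same for all instances, that in time $\mathrm{poly}(n,m)$ compute the explicit input (generators of the two alphabets $M$ and $G$, the two word lengths $2n$ in unary, and a representation of $[\mathsf K]$), decide whether two words encode the same element of $\mathcal U$, decide whether two words encode the same element of $\mathcal V$, and compute a representation of $[\mathsf F_v]$ from an encoding of $v\in\mathcal V$. (b) Call two homomorphisms $\varphi_1,\varphi_2:G\to S_m$ that extend $\psi$ equivalent if there is $h\in S_m$ with $\varphi_1(g)=h^{-1}\varphi_2(g)h$ for all $g\in G$. There is a bijection between the set of equivalence classes of extensions $\varphi:G\to S_m$ of $\psi$ and the set of solutions of $\mathrm{OMS}_\psi$. It takes the class of $\varphi$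 to the multiset of the classes $[G_x]_G$ of the point stabilizers $G_x$ of the action $\varphi$, with one point $x$ from each orbit. (c) There is an algorithm, the same for all instances, that in time $\mathrm{poly}(n,m)$ computes from $\psi$ and a representation of a solution of $\mathrm{OMS}_\psi$ the values, on the given generators of $G$, of some extension $\varphi$ in the equivalence class that corresponds to the solution under the bijection in (b). -/

import Mathlib

open scoped Pointwise

namespace HomExt

/-! ### A machine model with an explicit step count

Values are binary trees. Programs are built from projections, pairing, an equality test, composition,
branching and unbounded loops. Every executed instruction is charged one plus the size of the value
that it is applied to (so the size of an output is at most twice the cost of its run). This cost is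
polynomially equivalent to the number of steps of a Turing machine. -/

/-- Finite binary trees, the values on which programs operate. -/
inductive Data : Type where
  | nil : Data
  | cons : Data → Data → Data

namespace Data

/-- The number of nodes and leaves. -/
def size : Data → ℕ
  | nil => 1
  | cons a b => a.size + b.size + 1

def fst : Data → Data
  | nil => nil
  | cons a _ => a

def snd : Data → Data
  | nil => nil
  | cons _ b => b

/-- `nil` stands for `false`, `cons nil nil` for `true`. -/
def ofBool : Bool → Data
  | false => nil
  | true => cons nil nil

/-- Natural numbers in unary. -/
def ofNat : ℕ → Data
  | 0 => nil
  | k + 1 => cons nil (ofNat k)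

def ofList {α : Type*} (f : α → Data) : List α → Data
  | [] => nil
  | a :: l => cons (f a) (ofList f l)

/-- A permutation of `{0, …, n - 1}` is given by the list of its values. -/
def ofPerm {n : ℕ} (g : Equiv.Perm (Fin n)) : Data :=
  ofList (fun i : Fin n => ofNat i) (List.ofFn g)

end Data

/-- Programs; each computes a partial function from trees to trees. -/
inductive Prog : Type where
  /-- the constant `nil` -/
  | nil : Prog
  /-- the identity -/
  | id : Prog
  /-- the left subtree -/
  | fst : Prog
  /-- the right subtree -/
  | snd : Prog
  /-- are the left and the right subtree equal? -/
  | eq : Prog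
  /-- `x ↦ cons (p x) (q x)` -/
  | pair (p q : Prog) : Prog
  /-- `x ↦ q (p x)` -/
  | comp (p q : Prog) : Prog
  /-- if `c x` is not `nil` then `p x` else `q x` -/
  | cond (c p q : Prog) : Prog
  /-- while `c x` is not `nil`, replace `x` by `p x`; then return `x` -/
  | loop (c p : Prog) : Prog

/-- `p.Eval x y t`: the program `p`, started on `x`, halts with the output `y` at total cost `t`. -/
inductive Prog.Eval : Prog → Data → Data → ℕ → Prop where
  | nil (x : Data) : Eval .nil x .nil (x.size + 1)
  | id (x : Data) : Eval .id x x (x.size + 1)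
  | fst (x : Data) : Eval .fst x x.fst (x.size + 1)
  | snd (x : Data) : Eval .snd x x.snd (x.size + 1)
  | eq_true (x : Data) (h : x.fst = x.snd) : Eval .eq x (.ofBool true) (x.size + 1)
  | eq_false (x : Data) (h : x.fst ≠ x.snd) : Eval .eq x (.ofBool false) (x.size + 1)
  | pair {p q : Prog} {x y z : Data} {s t : ℕ} (hp : Eval p x y s) (hq : Eval q x z t) :
      Eval (.pair p q) x (.cons y z) (s + t + x.size + 1)
  | comp {p q : Prog} {x y z : Data} {s t : ℕ} (hp : Eval p x y s) (hq : Eval q y z t) :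
      Eval (.comp p q) x z (s + t + x.size + 1)
  | cond_true {c p q : Prog} {x a b y : Data} {s t : ℕ} (hc : Eval c x (.cons a b) s)
      (hp : Eval p x y t) : Eval (.cond c p q) x y (s + t + x.size + 1)
  | cond_false {c p q : Prog} {x y : Data} {s t : ℕ} (hc : Eval c x .nil s)
      (hq : Eval q x y t) : Eval (.cond c p q) x y (s + t + x.size + 1)
  | loop_done {c p : Prog} {x : Data} {s : ℕ} (hc : Eval c x .nil s) :
      Eval (.loop c p) x x (s + x.size + 1)
  | loop_step {c p : Prog} {x a b y z : Data} {s t r : ℕ} (hc : Eval c x (.cons a b) s)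
      (hp : Eval p x y t) (hl : Eval (.loop c p) y z r) :
      Eval (.loop c p) x z (s + t + r + x.size + 1)

/-- On input `x` the program halts within cost `T`, and its output satisfies `Post`. -/
def Prog.HaltsWithin (p : Prog) (x : Data) (T : ℕ) (Post : Data → Prop) : Prop :=
  ∃ y t, p.Eval x y t ∧ t ≤ T ∧ Post y

/-! ### Oracle multi-dimensional subset sum with repetition -/

/-- An instance of the oracle multi-dimensional subset sum problem with repetition. Elements of the
universe `U` and of the index set `V` are encoded, possibly in several ways, by words of
length `n₁` over `Alph₁`, respectively of length `n₂` over `Alph₂`; `dec₁` and `dec₂` decode words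
(`none` for words that encode nothing). The target is `K`, and the family `F` of multisets is
indexed by `V`. -/
structure OrMultiSSR where
  Alph₁ : Type
  Alph₂ : Type
  n₁ : ℕ
  n₂ : ℕ
  U : Type
  V : Type
  dec₁ : (Fin n₁ → Alph₁) → Option U
  dec₂ : (Fin n₂ → Alph₂) → Option V
  K : Multiset U
  F : V → Multiset U

/-- The solutions: multisets `L` in `V` with `∑ L(v) F v = K`, i.e. the sum of `F v`, where `v` runs
over `L` with multiplicities, is `K`. -/
def OrMultiSSR.SubSum (P : OrMultiSSR) : Set (Multiset P.V) :=
  {L | (L.map P.F).sum = P.K}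

/-- A list of pairs (word, positive multiplicity), with distinct words, represents the multiset `S`
of elements that are encoded by the words. -/
def Represents {W X : Type} (dec : W → Option X) (l : List (W × ℕ)) (S : Multiset X) : Prop :=
  (l.map Prod.fst).Nodup ∧ (∀ p ∈ l, 0 < p.2) ∧
    S.map some = (l.map fun p => Multiset.replicate p.2 (dec p.1)).sum

/-! ### Classes of subgroups, and multisets of point stabilizers -/

section Groups

variable {G : Type} [Group G]

/-- Conjugacy of subgroups of `G` of index at most `m` (for finite `G`). -/
def conjSetoid (G : Type) [Group G] (m : ℕ) : Setoid {L : Subgroup G // L.index ≤ m} :=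
  (MulAction.orbitRel (ConjAct G) (Subgroup G)).comap Subtype.val

/-- The conjugacy classes of subgroups of `G` of index at most `m` (for finite `G`). -/
def ConjLeq (G : Type) [Group G] (m : ℕ) : Type := Quotient (conjSetoid G m)

/-- The conjugacy class of `L`. -/
def ConjLeq.mk {m : ℕ} (L : Subgroup G) (h : L.index ≤ m) : ConjLeq G m :=
  Quotient.mk (conjSetoid G m) ⟨L, h⟩

/-- The stabilizer of the point `x` under the action `ψ`. -/
def pointStab {m : ℕ} (ψ : G →* Equiv.Perm (Fin m)) (x : Fin m) : Subgroup G :=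
  (MulAction.stabilizer (Equiv.Perm (Fin m)) x).comap ψ

theorem index_pointStab_le [Finite G] {m : ℕ} (ψ : G →* Equiv.Perm (Fin m)) (x : Fin m) :
    (pointStab ψ x).index ≤ m := by
  let _ := MulAction.compHom (Fin m) ψ
  have h : pointStab ψ x = MulAction.stabilizer G x := by
    ext g; rfl
  rw [h, MulAction.index_stabilizer]
  calc _ ≤ (Set.univ : Set (Fin m)).ncard := Set.ncard_le_ncard (Set.subset_univ _)
    _ = m := by simp [Set.ncard_univ]

/-- The multiset of conjugacy classes of point stabilizers of the action `ψ`, with one point per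
orbit. The orbits of `ψ` are those of its image. -/
noncomputable def orbitType [Finite G] {m : ℕ} (ψ : G →* Equiv.Perm (Fin m)) :
    Multiset (ConjLeq G m) :=
  letI := Fintype.ofFinite (MulAction.orbitRel.Quotient ψ.range (Fin m))
  (Finset.univ : Finset (MulAction.orbitRel.Quotient ψ.range (Fin m))).val.map fun o =>
    ConjLeq.mk (pointStab ψ (Quotient.out o)) (index_pointStab_le ψ _)

/-- The subgroup `σ⁻¹ L σ ∩ M` of `M`. -/
def conjInter (M L : Subgroup G) (σ : G) : Subgroup M :=
  (MulAut.conj σ⁻¹ • L).subgroupOf M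

theorem index_conjInter_le [Finite G] {m : ℕ} (M L : Subgroup G) (h : L.index ≤ m) (σ : G) :
    (conjInter M L σ).index ≤ m := by
  have h1 : (MulAut.conj σ⁻¹ • L).index = L.index :=
    Subgroup.index_map_equiv L (MulAut.conj σ⁻¹)
  have h2 : (conjInter M L σ).index ≤ (MulAut.conj σ⁻¹ • L).relIndex ⊤ :=
    Subgroup.relIndex_le_of_le_right le_top (by
      rw [Subgroup.relIndex_top_right]; exact Subgroup.index_ne_zero_of_finite)
  rw [Subgroup.relIndex_top_right, h1] at h2
  exact h2.trans h

/-- The multiset `{{ [σ⁻¹ L σ ∩ M] }}`, where `σ` runs over the chosen representatives of the double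
cosets `L σ M` in `G`. -/
noncomputable def fMultiset [Finite G] {m : ℕ} (M L : Subgroup G) (h : L.index ≤ m)
    (σ : DoubleCoset.Quotient (L : Set G) (M : Set G) → G) : Multiset (ConjLeq M m) :=
  letI : Fintype (DoubleCoset.Quotient (L : Set G) (M : Set G)) :=
    @Fintype.ofFinite _ (Quotient.finite _)
  (Finset.univ : Finset (DoubleCoset.Quotient (L : Set G) (M : Set G))).val.map fun d =>
    ConjLeq.mk (conjInter M L (σ d)) (index_conjInter_le M L h (σ d))

end Groups

/-! ### The homomorphism extension problem for `G ≤ S_n` and codomain `S_m` -/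

/-- An instance: generators of `G ≤ S_n`, and a homomorphism `ψ : M → S_m` from a subgroup `M ≤ G`,
given by the list `γ` of pairs `(b, ψ b)`, where `b` runs over generators of `M`. Groups of
degree `n` are given by at most `2 n` generators. -/
structure HomExtSym where
  n : ℕ
  m : ℕ
  gens : List (Equiv.Perm (Fin n))
  gens_length : gens.length ≤ 2 * n
  γ : List (Subgroup.closure {a | a ∈ gens} × Equiv.Perm (Fin m))
  γ_length : γ.length ≤ 2 * n
  ψ : Subgroup.closure {b | b ∈ γ.map Prod.fst} →* Equiv.Perm (Fin m)
  ψ_eq : ∀ (p : _) (hp : p ∈ γ),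
    ψ ⟨p.1, Subgroup.subset_closure (List.mem_map_of_mem hp)⟩ = p.2

namespace HomExtSym

/-- The group `G ≤ S_n`. -/
abbrev G (I : HomExtSym) : Subgroup (Equiv.Perm (Fin I.n)) :=
  Subgroup.closure {a | a ∈ I.gens}

/-- The subgroup `M ≤ G`. -/
abbrev M (I : HomExtSym) : Subgroup I.G :=
  Subgroup.closure {b | b ∈ I.γ.map Prod.fst}

/-- The extensions of `ψ` to homomorphisms `G → S_m`. -/
def Ext (I : HomExtSym) : Type :=
  {φ : I.G →* Equiv.Perm (Fin I.m) // ∀ x : I.M, φ x = I.ψ x}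

/-- Permutation equivalence of extensions. -/
def extSetoid (I : HomExtSym) : Setoid I.Ext where
  r φ₁ φ₂ := ∃ h : Equiv.Perm (Fin I.m), ∀ g, φ₁.1 g = h⁻¹ * φ₂.1 g * h
  iseqv :=
    { refl := fun _ => ⟨1, fun g => by simp⟩
      symm := fun ⟨h, hh⟩ => ⟨h⁻¹, fun g => by rw [hh g]; group⟩
      trans := fun ⟨h, hh⟩ ⟨k, hk⟩ => ⟨k * h, fun g => by rw [hh g, hk g]; group⟩ }

/-- The class encoded by a word: that of the subgroup which the letters generate, if its index is
at most `m`. -/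
noncomputable def decWord {H : Type} [Group H] (m : ℕ) {k : ℕ} (w : Fin k → H) :
    Option (ConjLeq H m) :=
  if h : (Subgroup.closure (Set.range w)).index ≤ m then some (ConjLeq.mk _ h) else none

/-- The instance of the subset sum problem that belongs to `ψ`. -/
noncomputable def oms (I : HomExtSym) : OrMultiSSR where
  Alph₁ := I.M
  Alph₂ := I.G
  n₁ := 2 * I.n
  n₂ := 2 * I.n
  U := ConjLeq I.M I.m
  V := ConjLeq I.G I.m
  dec₁ := decWord I.m
  dec₂ := decWord I.m
  K := orbitType I.ψ
  F := fun v => fMultiset I.M (Quotient.out v).1 (Quotient.out v).2 Quotient.out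

/-! #### Inputs and outputs as trees -/

def codeG (I : HomExtSym) (g : I.G) : Data := Data.ofPerm g.1

def codeM (I : HomExtSym) (g : I.M) : Data := I.codeG g.1

/-- The generators of `M`, in the order in which they are given. -/
def codeGensM (I : HomExtSym) : Data := Data.ofList I.codeG (I.γ.map Prod.fst)

def codeGensG (I : HomExtSym) : Data := Data.ofList Data.ofPerm I.gens

/-- The code of the instance `ψ`: the numbers `n` and `m`, the generators of `G`, and the values
of `ψ` on the generators of `M`. -/
def code (I : HomExtSym) : Data :=
  .cons (.ofNat I.n) (.cons (.ofNat I.m) (.cons I.codeGensG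
    (.ofList (fun p => .cons (I.codeG p.1) (Data.ofPerm p.2)) I.γ)))

/-- Words that encode elements of the universe. -/
def codeWordU (I : HomExtSym) (w : Fin (2 * I.n) → I.M) : Data :=
  .ofList I.codeM (List.ofFn w)

/-- Words that encode elements of the index set. -/
def codeWordV (I : HomExtSym) (w : Fin (2 * I.n) → I.G) : Data :=
  .ofList I.codeG (List.ofFn w)

def codeMultisetU (I : HomExtSym) (l : List ((Fin (2 * I.n) → I.M) × ℕ)) : Data :=
  .ofList (fun p => .cons (I.codeWordU p.1) (.ofNat p.2)) l

def codeMultisetV (I : HomExtSym) (l : List ((Fin (2 * I.n) → I.G) × ℕ)) : Data :=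
  .ofList (fun p => .cons (I.codeWordV p.1) (.ofNat p.2)) l

/-- The explicit part of the subset sum instance: the two alphabets (groups, given by generators),
the word lengths in unary, and the target, represented by `l`. -/
noncomputable def codeExplicit (I : HomExtSym) (l : List ((Fin (2 * I.n) → I.M) × ℕ)) : Data :=
  .cons I.codeGensM (.cons I.codeGensG
    (.cons (.ofNat I.oms.n₁) (.cons (.ofNat I.oms.n₂) (I.codeMultisetU l))))

/-- A homomorphism on `G` is output as the list of pairs `(a, φ a)`, where `a` runs over the given
generators of `G`. -/
def codeExt (I : HomExtSym) (φ : I.Ext) : Data :=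
  .ofList (fun a : {a // a ∈ I.gens} =>
    .cons (Data.ofPerm a.1) (Data.ofPerm (φ.1 ⟨a.1, Subgroup.subset_closure a.2⟩))) I.gens.attach

end HomExtSym

end HomExt

open HomExt

/-!
# Extending permutation representations as a subset sum problem

An action of a finite group `H` on a finite set is determined up to isomorphism by its type `otype`,
the multiset of the conjugacy classes of point stabilizers, one for each orbit. The type of a
disjoint union is the sum of the types, and the action on the cosets of `L` has type `{[L]}`.
Restricting the action of `G` on `G/L` to `M` gives an action whose orbits are the double cosets of
`L` and `M`, and whose type is the member `F [L]` of the family (`fMultiset_toCl`); in particular this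
member does not depend on any choices. Hence the restriction of an action of `G` to `M` has the
type `∑ F v`, where `v` runs over the type of the action (`otype_restrict`). An extension of `ψ`
therefore yields a solution. Conversely, for a solution `S` the disjoint union of the `G/L` with `[L]`
in `S` is isomorphic to `ψ` as a set with an action of `M`, and carrying the action of `G` over to
`{0, …, m - 1}` along such an isomorphism gives an extension. Extensions with the same type are
isomorphic as actions on the same set, that is, equivalent. This is the bijection `extEquiv`.

The algorithms are those of Schreier, Sims, and Furst, Hopcroft and Luks. A strong generating set is
built by sifting (`siftMem_strongGens` gives the membership test), and `reduceGens` selects at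
most `n` of its elements that still generate, by keeping only generators that merge orbits at their
level of the stabilizer chain; so every subgroup has a generating word of length `2 * n`. Subgroups of
polynomial index have computable transversals and Schreier generators. This yields stabilizers and
orbits of an action given on generators (`represents_orbitMultiset`), a conjugacy test
(`conjTest_iff`), and the action on a disjoint union of coset spaces (`cosetAct`). An isomorphism
between two actions is found greedily by matching points with the same stabilizer (`matching_spec`).

For the running times, `Computes Γ y` says that a single program produces `y i` from the input
`Γ.env i` for all `i`, at a cost that is polynomial in `Γ.s i`. This notion is closed under
composition, branching, and folds over lists whose accumulated value has polynomial
size (`Computes.foldl_prefix`). The body of a fold is treated in an arbitrary context `Δ` that comes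
with a map to `Γ` (`Ctx.Hom`), so that the values which are computable outside the loop remain
available inside. Promises on the inputs are part of the index type of the context.
-/

set_option linter.unusedVariables false

/-! ### Polynomial bounds -/

namespace HomExt

/-- `f` is bounded by a polynomial in `s`. -/
def PolyBdd {ι : Type} (s f : ι → ℕ) : Prop := ∃ q : Polynomial ℕ, ∀ i, f i ≤ q.eval (s i)

namespace PolyBdd

variable {ι : Type} {s f g : ι → ℕ}

theorem mono (hg : PolyBdd s g) (h : ∀ i, f i ≤ g i) : PolyBdd s f :=
  hg.imp fun _ hq i => (h i).trans (hq i)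

theorem add (hf : PolyBdd s f) (hg : PolyBdd s g) : PolyBdd s fun i => f i + g i := by
  obtain ⟨p, hp⟩ := hf
  obtain ⟨q, hq⟩ := hg
  exact ⟨p + q, fun i => by rw [Polynomial.eval_add]; exact add_le_add (hp i) (hq i)⟩

theorem mul (hf : PolyBdd s f) (hg : PolyBdd s g) : PolyBdd s fun i => f i * g i := by
  obtain ⟨p, hp⟩ := hf
  obtain ⟨q, hq⟩ := hg
  exact ⟨p * q, fun i => by rw [Polynomial.eval_mul]; exact Nat.mul_le_mul (hp i) (hq i)⟩

theorem const (c : ℕ) : PolyBdd s fun _ => c := ⟨Polynomial.C c, fun i => by simp⟩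

theorem self : PolyBdd s s := ⟨Polynomial.X, fun i => by simp⟩

end PolyBdd

/-! ### Costs of programs -/

theorem Data.one_le_size (x : Data) : 1 ≤ x.size := by
  cases x <;> simp [Data.size]

theorem Data.size_fst_le (x : Data) : x.fst.size ≤ x.size := by
  cases x <;> simp only [Data.fst, Data.size] <;> omega

theorem Data.size_snd_le (x : Data) : x.snd.size ≤ x.size := by
  cases x <;> simp only [Data.snd, Data.size] <;> omega

/-- The cost model charges for the size of every intermediate value, hence bounds the output. -/
theorem Prog.Eval.size_out {p : Prog} {x y : Data} {t : ℕ} (h : p.Eval x y t) :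
    y.size ≤ 2 * t := by
  induction h with
  | nil x => simp only [Data.size]; omega
  | id x => omega
  | fst x => have := x.size_fst_le; omega
  | snd x => have := x.size_snd_le; omega
  | eq_true x _ => have := x.one_le_size; simp only [Data.ofBool, Data.size]; omega
  | eq_false x _ => simp only [Data.ofBool, Data.size]; omega
  | pair _ _ h1 h2 => simp only [Data.size]; omega
  | _ => omega

theorem Prog.Eval.size_in {p : Prog} {x y : Data} {t : ℕ} (h : p.Eval x y t) : x.size ≤ t := by
  induction h <;> omega

/-! ### Uniform polynomial-time computation -/

/-- A family of inputs `env i` for a program, together with a size parameter `s i` in which the cost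
of the program is to be measured. -/
structure Ctx where
  ι : Type
  s : ι → ℕ
  env : ι → Data

/-- One program computes `y i` from the input `env i` for all `i`, at a cost that is polynomial
in `s i`. -/
def Computes (Γ : Ctx) (y : Γ.ι → Data) : Prop :=
  ∃ (p : Prog) (T : Γ.ι → ℕ), PolyBdd Γ.s T ∧ ∀ i, ∃ t ≤ T i, p.Eval (Γ.env i) (y i) t

/-- A reindexing of inputs that makes everything computable over `Γ` computable over `Δ`. The
contexts in which the body of a loop is run, where the values of the loop variables are a part of the
input, come with such a map to the context of the loop. -/
structure Ctx.Hom (Δ Γ : Ctx) where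
  f : Δ.ι → Γ.ι
  s_eq : ∀ k, Δ.s k = Γ.s (f k)
  wk : ∀ {y : Γ.ι → Data}, Computes Γ y → Computes Δ fun k => y (f k)

theorem Ctx.Hom.bdd {Δ Γ : Ctx} (h : Δ.Hom Γ) {f : Γ.ι → ℕ} (hf : PolyBdd Γ.s f) :
    PolyBdd Δ.s fun k => f (h.f k) :=
  hf.imp fun _ hq k => by rw [h.s_eq]; exact hq _

/-- Composition of maps of contexts. -/
def Ctx.Hom.trans {Θ Δ Γ : Ctx} (g : Θ.Hom Δ) (h : Δ.Hom Γ) : Θ.Hom Γ :=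
  ⟨fun k => h.f (g.f k), fun k => (g.s_eq k).trans (h.s_eq _), fun hy => g.wk (h.wk hy)⟩

namespace Computes

variable {Γ : Ctx} {y z : Γ.ι → Data}

theorem congr (hy : Computes Γ y) (h : ∀ i, y i = z i) : Computes Γ z := by
  rwa [← funext h]

theorem bdd (hy : Computes Γ y) : PolyBdd Γ.s fun i => (y i).size := by
  obtain ⟨p, T, hT, h⟩ := hy
  refine ((PolyBdd.const 2).mul hT).mono fun i => ?_
  obtain ⟨t, ht, he⟩ := h i
  exact he.size_out.trans (Nat.mul_le_mul le_rfl ht)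

theorem bdd_env (hy : Computes Γ y) : PolyBdd Γ.s fun i => (Γ.env i).size := by
  obtain ⟨p, T, hT, h⟩ := hy
  refine hT.mono fun i => ?_
  obtain ⟨t, ht, he⟩ := h i
  exact he.size_in.trans ht

theorem env (h : PolyBdd Γ.s fun i => (Γ.env i).size) : Computes Γ Γ.env :=
  ⟨.id, _, h.add (.const 1), fun _ => ⟨_, le_rfl, .id _⟩⟩

theorem nil' (h : PolyBdd Γ.s fun i => (Γ.env i).size) : Computes Γ fun _ => .nil :=
  ⟨.nil, _, h.add (.const 1), fun _ => ⟨_, le_rfl, .nil _⟩⟩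

theorem nil (hy : Computes Γ y) : Computes Γ fun _ => .nil := nil' hy.bdd_env

theorem cons (hy : Computes Γ y) (hz : Computes Γ z) :
    Computes Γ fun i => .cons (y i) (z i) := by
  have hb := hy.bdd_env
  obtain ⟨p, T, hT, h⟩ := hy
  obtain ⟨p', T', hT', h'⟩ := hz
  refine ⟨.pair p p', _, ((hT.add hT').add hb).add (.const 1), fun i => ?_⟩
  obtain ⟨t, ht, he⟩ := h i
  obtain ⟨t', ht', he'⟩ := h' i
  exact ⟨_, by omega, .pair he he'⟩

/-- Composition with a program that computes `z i` from `y i`. -/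
theorem comp (hy : Computes Γ y) (hz : Computes ⟨Γ.ι, Γ.s, y⟩ z) : Computes Γ z := by
  have hb := hy.bdd_env
  obtain ⟨p, T, hT, h⟩ := hy
  obtain ⟨p', T', hT', h'⟩ := hz
  refine ⟨.comp p p', _, ((hT.add hT').add hb).add (.const 1), fun i => ?_⟩
  obtain ⟨t, ht, he⟩ := h i
  obtain ⟨t', ht', he'⟩ := h' i
  exact ⟨_, by omega, .comp he he'⟩

theorem fst (hy : Computes Γ y) : Computes Γ fun i => (y i).fst :=
  hy.comp ⟨.fst, _, hy.bdd.add (.const 1), fun _ => ⟨_, le_rfl, .fst _⟩⟩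

theorem snd (hy : Computes Γ y) : Computes Γ fun i => (y i).snd :=
  hy.comp ⟨.snd, _, hy.bdd.add (.const 1), fun _ => ⟨_, le_rfl, .snd _⟩⟩

open Classical in
theorem eqData (hy : Computes Γ y) (hz : Computes Γ z) :
    Computes Γ fun i => .ofBool (decide (y i = z i)) := by
  refine (hy.cons hz).comp ⟨.eq, _, (hy.cons hz).bdd.add (.const 1), fun i => ⟨_, le_rfl, ?_⟩⟩
  by_cases h : y i = z i
  · simpa only [decide_eq_true h] using Prog.Eval.eq_true (.cons (y i) (z i)) h
  · simpa only [decide_eq_false h] using Prog.Eval.eq_false (.cons (y i) (z i)) h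

/-- Equality of values is decided by comparing their codes. -/
theorem decEq {T : Γ.ι → Type} [∀ i, DecidableEq (T i)] {e : ∀ i, T i → Data}
    (he : ∀ i, Function.Injective (e i)) {a b : ∀ i, T i} (ha : Computes Γ fun i => e i (a i))
    (hb : Computes Γ fun i => e i (b i)) :
    Computes Γ fun i => .ofBool (decide (a i = b i)) :=
  (ha.eqData hb).congr fun i => by congr 1; simp [(he i).eq_iff]

/-- Branching on whether a value is `nil`. -/
theorem condNil (b : Γ.ι → Data) (hb : Computes Γ b) (hy : Computes Γ y) (hz : Computes Γ z) :
    Computes Γ fun i => match b i with | .nil => z i | .cons _ _ => y i := by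
  have hbd := hy.bdd_env
  obtain ⟨p, T, hT, h⟩ := hy
  obtain ⟨p', T', hT', h'⟩ := hz
  obtain ⟨p'', T'', hT'', h''⟩ := hb
  refine ⟨.cond p'' p p', _, (((hT.add hT').add hT'').add hbd).add (.const 1), fun i => ?_⟩
  obtain ⟨t, ht, he⟩ := h i
  obtain ⟨t', ht', he'⟩ := h' i
  obtain ⟨t'', ht'', he''⟩ := h'' i
  rcases hbi : b i with _ | ⟨a, c⟩ <;> rw [hbi] at he''
  · exact ⟨t'' + t' + (Γ.env i).size + 1, by omega,
      by simpa only [hbi] using Prog.Eval.cond_false he'' he'⟩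
  · exact ⟨t'' + t + (Γ.env i).size + 1, by omega,
      by simpa only [hbi] using Prog.Eval.cond_true he'' he⟩

theorem ite {T : Γ.ι → Type} {e : ∀ i, T i → Data} {P : Γ.ι → Prop} [∀ i, Decidable (P i)]
    {u v : ∀ i, T i} (hP : Computes Γ fun i => .ofBool (decide (P i)))
    (hu : Computes Γ fun i => e i (u i)) (hv : Computes Γ fun i => e i (v i)) :
    Computes Γ fun i => e i (if P i then u i else v i) :=
  (condNil _ hP hu hv).congr fun i => by by_cases h : P i <;> simp [h, Data.ofBool]

section Bool

variable {b c : Γ.ι → Bool} {P Q : Γ.ι → Prop} [∀ i, Decidable (P i)] [∀ i, Decidable (Q i)]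

theorem ff (hy : Computes Γ y) : Computes Γ fun _ => .ofBool false := hy.nil

theorem tt (hy : Computes Γ y) : Computes Γ fun _ => .ofBool true := hy.nil.cons hy.nil

theorem ofBool_true (hb : Computes Γ fun i => .ofBool (b i)) :
    Computes Γ fun i => .ofBool (decide (b i = true)) := hb.congr fun i => by simp

theorem bnot (hb : Computes Γ fun i => .ofBool (b i)) : Computes Γ fun i => .ofBool (!b i) :=
  (ite (T := fun _ => Bool) (e := fun _ => Data.ofBool) (u := fun _ => false) (v := fun _ => true)
    hb.ofBool_true hb.ff hb.tt).congr fun i => by cases b i <;> rfl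

theorem band (hb : Computes Γ fun i => .ofBool (b i)) (hc : Computes Γ fun i => .ofBool (c i)) :
    Computes Γ fun i => .ofBool (b i && c i) :=
  (ite (T := fun _ => Bool) (e := fun _ => Data.ofBool) (u := c) (v := fun _ => false)
    hb.ofBool_true hc hb.ff).congr fun i => by cases b i <;> simp

theorem bor (hb : Computes Γ fun i => .ofBool (b i)) (hc : Computes Γ fun i => .ofBool (c i)) :
    Computes Γ fun i => .ofBool (b i || c i) :=
  (ite (T := fun _ => Bool) (e := fun _ => Data.ofBool) (u := fun _ => true) (v := c)
    hb.ofBool_true hb.tt hc).congr fun i => by cases b i <;> simp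

theorem not (hP : Computes Γ fun i => .ofBool (decide (P i))) :
    Computes Γ fun i => .ofBool (decide (¬ P i)) :=
  hP.bnot.congr fun i => by simp

end Bool

end Computes

/-- The context `Γ` with an additional variable, whose possible values at `i` are the elements of
`A i`, coded by `v i`. -/
def Ctx.ext (Γ : Ctx) (A : Γ.ι → Type) (v : ∀ i, A i → Data) : Ctx :=
  ⟨Σ i, A i, fun k => Γ.s k.1, fun k => .cons (Γ.env k.1) (v k.1 k.2)⟩

section Ext

variable {Γ : Ctx} {A : Γ.ι → Type} {v : ∀ i, A i → Data} {B : Γ.ι → ℕ}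

theorem Ctx.ext_bdd_env (hΓ : PolyBdd Γ.s fun i => (Γ.env i).size) (hB : PolyBdd Γ.s B)
    (hv : ∀ i a, (v i a).size ≤ B i) :
    PolyBdd (Γ.ext A v).s fun k => ((Γ.ext A v).env k).size := by
  obtain ⟨q, hq⟩ := (hΓ.add hB).add (.const 1)
  exact ⟨q, fun k => le_trans (Nat.succ_le_succ (Nat.add_le_add_left (hv k.1 k.2) _)) (hq k.1)⟩

/-- The map from the extended context that forgets the additional variable. -/
def Ctx.extHom (hΓ : PolyBdd Γ.s fun i => (Γ.env i).size) (hB : PolyBdd Γ.s B)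
    (hv : ∀ i a, (v i a).size ≤ B i) : (Γ.ext A v).Hom Γ where
  f k := k.1
  s_eq _ := rfl
  wk {y} hy := by
    have h1 := (Computes.env (Ctx.ext_bdd_env hΓ hB hv)).fst
    refine h1.comp ?_
    obtain ⟨p, T, hT, h⟩ := hy
    exact ⟨p, fun k => T k.1, hT.imp fun _ hq k => hq k.1, fun k => h k.1⟩

theorem Computes.var (hΓ : PolyBdd Γ.s fun i => (Γ.env i).size) (hB : PolyBdd Γ.s B)
    (hv : ∀ i a, (v i a).size ≤ B i) : Computes (Γ.ext A v) fun k => v k.1 k.2 :=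
  (Computes.env (Ctx.ext_bdd_env hΓ hB hv)).snd

end Ext

/-! ### Lists -/

section Lists

theorem Data.size_ofList_cons {α : Type} (e : α → Data) (a : α) (l : List α) :
    (Data.ofList e (a :: l)).size = (e a).size + (Data.ofList e l).size + 1 := rfl

theorem Data.size_ofList_append {α : Type} (e : α → Data) (l l' : List α) :
    (Data.ofList e (l ++ l')).size + 1 = (Data.ofList e l).size + (Data.ofList e l').size := by
  induction l with
  | nil => simp [Data.ofList, Data.size]; omega
  | cons a l ih => rw [List.cons_append, size_ofList_cons, size_ofList_cons]; omega

theorem Data.size_le_of_mem {α : Type} (e : α → Data) {a : α} {l : List α} (h : a ∈ l) :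
    (e a).size ≤ (Data.ofList e l).size := by
  induction l with
  | nil => simp at h
  | cons b l ih =>
    rw [size_ofList_cons]
    rcases List.mem_cons.1 h with rfl | h
    · omega
    · have := ih h; omega

theorem Data.length_lt_size {α : Type} (e : α → Data) (l : List α) :
    l.length < (Data.ofList e l).size := by
  induction l with
  | nil => simp [Data.ofList, Data.size]
  | cons b l ih => rw [size_ofList_cons, List.length_cons]; omega

theorem Data.size_ofList_le {α : Type} (e : α → Data) {l : List α} {B C : ℕ}
    (h : ∀ a ∈ l, (e a).size ≤ B) (hC : l.length ≤ C) :
    (Data.ofList e l).size ≤ C * (B + 1) + 1 := by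
  have : (Data.ofList e l).size ≤ l.length * (B + 1) + 1 := by
    clear hC
    induction l with
    | nil => simp [Data.ofList, Data.size]
    | cons b l ih =>
      rw [size_ofList_cons, List.length_cons, Nat.succ_mul]
      have := ih fun a ha => h a (List.mem_cons_of_mem _ ha)
      have := h b (List.mem_cons_self)
      omega
  exact this.trans (by gcongr)

theorem Data.ofList_injective {α : Type} {e : α → Data} (he : Function.Injective e) :
    Function.Injective (Data.ofList e) := by
  intro l
  induction l with
  | nil => intro l' h; cases l' <;> simp_all [Data.ofList]
  | cons a l ih =>
    intro l' h
    cases l' with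
    | nil => simp [Data.ofList] at h
    | cons b l' =>
      simp only [Data.ofList, Data.cons.injEq] at h
      rw [he h.1, ih h.2]

theorem Data.ofList_map {α β : Type} (e : β → Data) (g : α → β) (l : List α) :
    Data.ofList e (l.map g) = Data.ofList (fun a => e (g a)) l := by
  induction l with
  | nil => rfl
  | cons a l ih => simp [Data.ofList, ih]

theorem Data.ofNat_eq (n : ℕ) : Data.ofNat n = Data.ofList (fun _ : Unit => Data.nil)
    (List.replicate n ()) := by
  induction n with
  | zero => rfl
  | succ n ih => rw [List.replicate_succ, Data.ofList, ← ih]; rfl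

theorem Data.size_ofNat (n : ℕ) : (Data.ofNat n).size = 2 * n + 1 := by
  induction n with
  | zero => rfl
  | succ n ih => simp only [Data.ofNat, Data.size, ih]; omega

theorem Data.ofNat_injective : Function.Injective Data.ofNat := by
  intro a b h
  have := congrArg Data.size h
  rw [size_ofNat, size_ofNat] at this
  omega

/-- The body of the loop that folds over a list. Its state consists of the rest of the list, the
surrounding input, and the accumulated value. -/
def foldBody (p : Prog) : Prog :=
  .pair (.comp .fst .snd) (.pair (.comp .snd .fst)
    (.comp (.pair (.comp .snd .fst) (.pair (.comp .snd .snd) (.comp .fst .fst))) p))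

theorem foldBody_eval {p : Prog} {x S a r S' : Data} {t : ℕ}
    (h : p.Eval (.cons x (.cons S a)) S' t) :
    ∃ t' ≤ t + 40 * (x.size + S.size + a.size + r.size + 4),
      (foldBody p).Eval (.cons (.cons a r) (.cons x S)) (.cons r (.cons x S')) t' := by
  refine ⟨_, ?_, .pair (.comp (.fst _) (.snd _)) (.pair (.comp (.snd _) (.fst _))
    (.comp (.pair (.comp (.snd _) (.fst _)) (.pair (.comp (.snd _) (.snd _))
      (.comp (.fst _) (.fst _)))) h))⟩
  simp only [Data.size, Data.fst, Data.snd]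
  omega

/-- The loop over a list: if the body takes the fold over an initial segment to the fold over the
next one at a cost of at most `t`, and no value exceeds the size `B`, then the cost of the loop is at
most the number of rounds times `t` plus the cost of moving data of size `O(B)` around. -/
theorem foldLoop_eval {p : Prog} {x : Data} {α σ : Type} (e : α → Data) (eS : σ → Data)
    (f : σ → α → σ) (z : σ) (l : List α) (B t : ℕ) (hB : (Data.ofList e l).size ≤ B)
    (hS : ∀ pre, pre <+: l → (eS (pre.foldl f z)).size ≤ B)
    (h : ∀ pre a, pre ++ [a] <+: l → ∃ t' ≤ t,
      p.Eval (.cons x (.cons (eS (pre.foldl f z)) (e a))) (eS ((pre ++ [a]).foldl f z)) t')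
    (suf pre : List α) (hl : pre ++ suf = l) :
    ∃ t' ≤ (suf.length + 1) * (t + 100 * (x.size + 4 * B + 10)),
      (Prog.loop .fst (foldBody p)).Eval (.cons (.ofList e suf) (.cons x (eS (pre.foldl f z))))
        (.cons .nil (.cons x (eS (l.foldl f z)))) t' := by
  induction suf generalizing pre with
  | nil =>
    obtain rfl : pre = l := by simpa using hl
    refine ⟨_, ?_, .loop_done (.fst _)⟩
    have := hS pre List.prefix_rfl
    simp only [Data.size, Data.ofList, List.length_nil]
    omega
  | cons a suf ih =>
    have hpre : pre ++ [a] <+: l := ⟨suf, by simpa using hl⟩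
    have hpre' : pre <+: l := ⟨a :: suf, hl⟩
    obtain ⟨t1, ht1, he1⟩ := h pre a hpre
    obtain ⟨t2, ht2, he2⟩ := ih (pre ++ [a]) (by simpa using hl)
    obtain ⟨t3, ht3, he3⟩ := foldBody_eval (r := Data.ofList e suf) he1
    refine ⟨_, ?_, .loop_step (.fst _) he3 he2⟩
    have h1 := hS pre hpre'
    have h2 : (e a).size ≤ B := (Data.size_le_of_mem e (by rw [← hl]; simp)).trans hB
    have h3 : (Data.ofList e suf).size ≤ B := by
      refine le_trans ?_ hB
      have := Data.size_ofList_append e (pre ++ [a]) suf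
      rw [List.append_assoc, List.singleton_append, hl] at this
      have := (Data.ofList e (pre ++ [a])).one_le_size
      omega
    simp only [Data.size, Data.ofList, List.length_cons]
    rw [Nat.succ_mul (suf.length + 1)]
    omega

variable {Γ : Ctx} {T S U : Γ.ι → Type} {e : ∀ i, T i → Data} {eS : ∀ i, S i → Data}
  {eU : ∀ i, U i → Data} {l : ∀ i, List (T i)}

/-- Folding over a list. The size of the accumulated value has to be bounded in advance; the step
may use that the accumulated value is the fold over an initial segment of the list. -/
theorem Computes.foldl_prefix {f : ∀ i, S i → T i → S i} {z : ∀ i, S i} {B : Γ.ι → ℕ}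
    (hl : Computes Γ fun i => .ofList (e i) (l i)) (hz : Computes Γ fun i => eS i (z i))
    (hB : PolyBdd Γ.s B) (hS : ∀ i pre, pre <+: l i → (eS i (pre.foldl (f i) (z i))).size ≤ B i)
    (step : ∀ (Δ : Ctx) (h : Δ.Hom Γ) (pre : ∀ k, List (T (h.f k))) (a : ∀ k, T (h.f k)),
      (∀ k, pre k ++ [a k] <+: l (h.f k)) →
      Computes Δ (fun k => eS _ ((pre k).foldl (f _) (z _))) → Computes Δ (fun k => e _ (a k)) →
      Computes Δ fun k => eS _ (f _ ((pre k).foldl (f _) (z _)) (a k))) :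
    Computes Γ fun i => eS i ((l i).foldl (f i) (z i)) := by
  have hΓ := hl.bdd_env
  let A : Γ.ι → Type := fun i => {p : List (T i) × T i // p.1 ++ [p.2] <+: l i}
  let v : ∀ i, A i → Data := fun i p => .cons (eS i (p.1.1.foldl (f i) (z i))) (e i p.1.2)
  have hb := (hB.add hl.bdd).add (.const 1)
  have hv : ∀ i a, (v i a).size ≤ B i + (Data.ofList (e i) (l i)).size + 1 := by
    intro i a
    have h1 := hS i a.1.1 ((List.prefix_append _ _).trans a.2)
    have h2 := Data.size_le_of_mem (e i) (a := a.1.2) (l := l i) (a.2.subset (by simp))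
    simp only [v, Data.size]
    omega
  have hvar := Computes.var (A := A) (v := v) hΓ hb hv
  have hstep := step (Γ.ext A v) (Ctx.extHom hΓ hb hv) (fun k => k.2.1.1) (fun k => k.2.1.2)
    (fun k => k.2.2) hvar.fst hvar.snd
  have hb' := (hB.add hl.bdd).add hΓ
  obtain ⟨pl, Tl, hTl, hpl⟩ := hl
  obtain ⟨pz, Tz, hTz, hpz⟩ := hz
  obtain ⟨p, Tp, ⟨q, hq⟩, hp⟩ := hstep
  have hq' : PolyBdd Γ.s fun i => q.eval (Γ.s i) := ⟨q, fun _ => le_rfl⟩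
  refine ⟨.comp (.pair pl (.pair .id pz)) (.comp (.loop .fst (foldBody p)) (.comp .snd .snd)), _,
    (((hTl.add hTz).add (hb'.mul (hq'.add ((PolyBdd.const 1000).mul (hb'.add (.const 1)))))).add
      ((PolyBdd.const 1000).mul (hb'.add (.const 1)))), fun i => ?_⟩
  obtain ⟨tl, htl, hel⟩ := hpl i
  obtain ⟨tz, htz, hez⟩ := hpz i
  have hS0 := hS i [] (List.nil_prefix)
  have hS1 := hS i (l i) (List.prefix_rfl)
  obtain ⟨t, ht, he⟩ := foldLoop_eval (x := Γ.env i) (e i) (eS i) (f i) (z i) (l i)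
    (B i + (Data.ofList (e i) (l i)).size) (q.eval (Γ.s i)) (by omega)
    (fun pre hpre => (hS i pre hpre).trans (by omega))
    (fun pre a ha => by
      obtain ⟨t, ht, he⟩ := hp ⟨i, ⟨(pre, a), ha⟩⟩
      refine ⟨t, ht.trans (hq ⟨i, ⟨(pre, a), ha⟩⟩), ?_⟩
      rw [List.foldl_append]
      exact he) (l i) [] rfl
  refine ⟨_, ?_, .comp (.pair hel (.pair (.id _) hez)) (.comp he (.comp (.snd _) (.snd _)))⟩
  have hlen := Data.length_lt_size (e i) (l i)
  have : t ≤ (B i + (Data.ofList (e i) (l i)).size + (Γ.env i).size) *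
      (q.eval (Γ.s i) + 1000 * (B i + (Data.ofList (e i) (l i)).size + (Γ.env i).size + 1)) := by
    refine ht.trans (Nat.mul_le_mul (by omega) (by omega))
  simp only [Data.size, Data.snd]
  simp only [List.foldl_nil] at hS0 ⊢
  omega

/-- Folding over a list, with an invariant that bounds the size of the accumulated value. -/
theorem Computes.foldl {f : ∀ i, S i → T i → S i} {z : ∀ i, S i} {B : Γ.ι → ℕ}
    (hl : Computes Γ fun i => .ofList (e i) (l i)) (hz : Computes Γ fun i => eS i (z i))
    (Inv : ∀ i, S i → Prop) (h0 : ∀ i, Inv i (z i))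
    (h1 : ∀ i s, ∀ a ∈ l i, Inv i s → Inv i (f i s a))
    (hB : PolyBdd Γ.s B) (hS : ∀ i s, Inv i s → (eS i s).size ≤ B i)
    (step : ∀ (Δ : Ctx) (h : Δ.Hom Γ) (s : ∀ k, S (h.f k)) (a : ∀ k, T (h.f k)),
      (∀ k, Inv (h.f k) (s k)) → (∀ k, a k ∈ l (h.f k)) →
      Computes Δ (fun k => eS _ (s k)) → Computes Δ (fun k => e _ (a k)) →
      Computes Δ fun k => eS _ (f _ (s k) (a k))) :
    Computes Γ fun i => eS i ((l i).foldl (f i) (z i)) := by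
  have hI : ∀ i pre, pre <+: l i → Inv i (pre.foldl (f i) (z i)) := by
    intro i pre
    induction pre using List.reverseRecOn with
    | nil => intro _; exact h0 i
    | append_singleton pre a ih =>
      intro hpre
      rw [List.foldl_append]
      exact h1 i _ a (hpre.subset (by simp)) (ih ((List.prefix_append _ _).trans hpre))
  exact Computes.foldl_prefix hl hz hB (fun i pre hpre => hS i _ (hI i pre hpre))
    fun Δ h pre a hpre hs ha => step Δ h _ a
      (fun k => hI _ _ ((List.prefix_append _ _).trans (hpre k)))
      (fun k => (hpre k).subset (by simp)) hs ha

theorem Computes.reverse (hl : Computes Γ fun i => .ofList (e i) (l i)) :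
    Computes Γ fun i => .ofList (e i) (l i).reverse := by
  have := Computes.foldl_prefix (S := fun i => List (T i)) (eS := fun i => .ofList (e i))
    (f := fun i s a => a :: s) (z := fun _ => []) hl hl.nil hl.bdd (fun i pre hpre => by
      obtain ⟨suf, h⟩ := hpre
      have h1 := Data.size_ofList_append (e i) pre suf
      have h2 := (Data.ofList (e i) suf).one_le_size
      have h3 : ∀ l : List (T i),
          (Data.ofList (e i) l.reverse).size = (Data.ofList (e i) l).size := by
        intro l
        induction l with
        | nil => rfl
        | cons a l ih =>
          have := Data.size_ofList_append (e i) l.reverse [a]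
          rw [List.reverse_cons, Data.size_ofList_cons]
          simp only [Data.ofList, Data.size] at this
          omega
      rw [h] at h1
      simp only [List.foldl_flip_cons_eq_append', List.append_nil] at *
      rw [h3]
      omega) (fun Δ h pre a _ hs ha => ha.cons hs)
  exact this.congr fun i => by simp

/-- A bound for the values of a function on the elements of a list, as computed by a program. -/
theorem Computes.bdd_elem {g : ∀ i, T i → U i} (hl : Computes Γ fun i => .ofList (e i) (l i))
    (step : ∀ (Δ : Ctx) (h : Δ.Hom Γ) (a : ∀ k, T (h.f k)), (∀ k, a k ∈ l (h.f k)) →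
      Computes Δ (fun k => e _ (a k)) → Computes Δ fun k => eU _ (g _ (a k))) :
    ∃ B : Γ.ι → ℕ, PolyBdd Γ.s B ∧ ∀ i, ∀ a ∈ l i, (eU i (g i a)).size ≤ B i := by
  let A : Γ.ι → Type := fun i => {a : T i // a ∈ l i}
  let v : ∀ i, A i → Data := fun i p => e i p.1
  have hv : ∀ i a, (v i a).size ≤ (Data.ofList (e i) (l i)).size :=
    fun i a => Data.size_le_of_mem (e i) a.2
  obtain ⟨q, hq⟩ := (step (Γ.ext A v) (Ctx.extHom hl.bdd_env hl.bdd hv) (fun k => k.2.1)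
    (fun k => k.2.2) (Computes.var hl.bdd_env hl.bdd hv)).bdd
  exact ⟨fun i => q.eval (Γ.s i), ⟨q, fun _ => le_rfl⟩, fun i a ha => hq ⟨i, ⟨a, ha⟩⟩⟩

theorem Computes.map {g : ∀ i, T i → U i} (hl : Computes Γ fun i => .ofList (e i) (l i))
    (step : ∀ (Δ : Ctx) (h : Δ.Hom Γ) (a : ∀ k, T (h.f k)), (∀ k, a k ∈ l (h.f k)) →
      Computes Δ (fun k => e _ (a k)) → Computes Δ fun k => eU _ (g _ (a k))) :
    Computes Γ fun i => .ofList (eU i) ((l i).map (g i)) := by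
  obtain ⟨B, hB, hs⟩ := hl.bdd_elem step
  have hf : ∀ i (s : List (T i)), s.foldl (fun s a => g i a :: s) [] = (s.map (g i)).reverse := by
    intro i s
    induction s using List.reverseRecOn with
    | nil => rfl
    | append_singleton s a ih => simp [ih]
  have := Computes.foldl_prefix (S := fun i => List (U i)) (eS := fun i => .ofList (eU i))
    (f := fun i s a => g i a :: s) (z := fun _ => []) hl hl.nil
    ((hl.bdd.mul (hB.add (.const 1))).add (.const 1)) (fun i pre hpre => by
      rw [hf]
      refine Data.size_ofList_le _ (fun u hu => ?_) ?_
      · obtain ⟨a, ha, rfl⟩ := List.mem_map.1 (List.mem_reverse.1 hu)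
        exact hs i a (hpre.subset ha)
      · rw [List.length_reverse, List.length_map]
        exact hpre.length_le.trans (Data.length_lt_size (e i) _).le)
    (fun Δ h pre a hpre hs ha => (step Δ h a (fun k => (hpre k).subset (by simp)) ha).cons hs)
  exact this.reverse.congr fun i => by rw [hf, List.reverse_reverse]

theorem Computes.append {l' : ∀ i, List (T i)} (hl : Computes Γ fun i => .ofList (e i) (l i))
    (hl' : Computes Γ fun i => .ofList (e i) (l' i)) :
    Computes Γ fun i => .ofList (e i) (l i ++ l' i) := by
  have := Computes.foldl_prefix (S := fun i => List (T i)) (eS := fun i => .ofList (e i))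
    (f := fun i s a => a :: s) (z := l') hl.reverse hl'
    ((hl.bdd.mul ((hl.bdd.add hl'.bdd).add (.const 1))).add hl'.bdd) (fun i pre hpre => by
      have h1 : (Data.ofList (e i) (pre.foldl (fun s a => a :: s) (l' i))).size + 1 =
          (Data.ofList (e i) pre.reverse).size + (Data.ofList (e i) (l' i)).size := by
        rw [List.foldl_flip_cons_eq_append', Data.size_ofList_append]
      have h2 := Data.size_ofList_le (e i) (l := pre.reverse)
        (B := (Data.ofList (e i) (l i)).size + (Data.ofList (e i) (l' i)).size)
        (C := (Data.ofList (e i) (l i)).size)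
        (fun a ha => (Data.size_le_of_mem (e i) (l := l i)
          (List.mem_reverse.1 (hpre.subset (List.mem_reverse.1 ha)))).trans (by omega))
        (by
          rw [List.length_reverse]
          exact (by simpa using hpre.length_le : pre.length ≤ (l i).length).trans
            (Data.length_lt_size (e i) _).le)
      omega) (fun Δ h pre a _ hs ha => ha.cons hs)
  exact this.congr fun i => by simp

theorem Computes.flatten {L : ∀ i, List (List (T i))}
    (hL : Computes Γ fun i => .ofList (Data.ofList (e i)) (L i)) :
    Computes Γ fun i => .ofList (e i) (L i).flatten := by
  have hf : ∀ i (s : List (List (T i))), s.foldl (fun s a => s ++ a) [] = s.flatten := by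
    intro i s
    induction s using List.reverseRecOn with
    | nil => rfl
    | append_singleton s a ih => simp [ih]
  have hsz : ∀ i (s : List (List (T i))),
      (Data.ofList (e i) s.flatten).size ≤ (Data.ofList (Data.ofList (e i)) s).size := by
    intro i s
    induction s with
    | nil => simp [Data.ofList]
    | cons a s ih =>
      have := Data.size_ofList_append (e i) a s.flatten
      rw [List.flatten_cons, Data.size_ofList_cons]
      omega
  have := Computes.foldl_prefix (S := fun i => List (T i)) (eS := fun i => .ofList (e i))
    (f := fun i s a => s ++ a) (z := fun _ => []) hL hL.nil hL.bdd (fun i pre hpre => by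
      obtain ⟨suf, h⟩ := hpre
      have h1 := Data.size_ofList_append (Data.ofList (e i)) pre suf
      have h2 := (Data.ofList (Data.ofList (e i)) suf).one_le_size
      have := hsz i pre
      rw [h] at h1
      rw [hf]
      omega) (fun Δ h pre a _ hs ha => hs.append ha)
  exact this.congr fun i => by rw [hf]

theorem Computes.flatMap {g : ∀ i, T i → List (U i)}
    (hl : Computes Γ fun i => .ofList (e i) (l i))
    (step : ∀ (Δ : Ctx) (h : Δ.Hom Γ) (a : ∀ k, T (h.f k)), (∀ k, a k ∈ l (h.f k)) →
      Computes Δ (fun k => e _ (a k)) → Computes Δ fun k => .ofList (eU _) (g _ (a k))) :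
    Computes Γ fun i => .ofList (eU i) ((l i).flatMap (g i)) :=
  (Computes.map (U := fun i => List (U i)) (eU := fun i => .ofList (eU i)) hl step).flatten

theorem Computes.filter {p : ∀ i, T i → Bool} (hl : Computes Γ fun i => .ofList (e i) (l i))
    (step : ∀ (Δ : Ctx) (h : Δ.Hom Γ) (a : ∀ k, T (h.f k)), (∀ k, a k ∈ l (h.f k)) →
      Computes Δ (fun k => e _ (a k)) → Computes Δ fun k => .ofBool (p _ (a k))) :
    Computes Γ fun i => .ofList (e i) ((l i).filter (p i)) := by
  refine (Computes.flatMap (U := T) (eU := e) (g := fun i a => if p i a = true then [a] else []) hl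
    fun Δ h a hm ha => ?_).congr fun i => ?_
  · exact Computes.ite (T := fun k => List (T (h.f k))) (e := fun k => .ofList (e _))
      (step Δ h a hm ha).ofBool_true (ha.cons ha.nil) ha.nil
  · congr 1
    induction l i with
    | nil => rfl
    | cons a l ih => by_cases h : p i a = true <;> simp [h, ih]

theorem Computes.any {p : ∀ i, T i → Bool} (hl : Computes Γ fun i => .ofList (e i) (l i))
    (step : ∀ (Δ : Ctx) (h : Δ.Hom Γ) (a : ∀ k, T (h.f k)), (∀ k, a k ∈ l (h.f k)) →
      Computes Δ (fun k => e _ (a k)) → Computes Δ fun k => .ofBool (p _ (a k))) :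
    Computes Γ fun i => .ofBool ((l i).any (p i)) := by
  refine (Computes.foldl (S := fun _ => Bool) (eS := fun _ => .ofBool) (z := fun _ => false)
    (f := fun i s a => s || p i a) hl hl.nil (fun _ _ => True) (fun _ => trivial)
    (fun _ _ _ _ _ => trivial) (PolyBdd.const 3)
    (fun i s _ => by cases s <;> simp [Data.ofBool, Data.size])
    fun Δ h s a _ hm hs ha => hs.bor (step Δ h a hm ha)).congr fun i => ?_
  have : ∀ (s : List (T i)) b, s.foldl (fun s a => s || p i a) b = (b || s.any (p i)) := by
    intro s
    induction s with
    | nil => simp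
    | cons a s ih => intro b; simp [ih, Bool.or_assoc]
  rw [this, Bool.false_or]

theorem Computes.all {p : ∀ i, T i → Bool} (hl : Computes Γ fun i => .ofList (e i) (l i))
    (step : ∀ (Δ : Ctx) (h : Δ.Hom Γ) (a : ∀ k, T (h.f k)), (∀ k, a k ∈ l (h.f k)) →
      Computes Δ (fun k => e _ (a k)) → Computes Δ fun k => .ofBool (p _ (a k))) :
    Computes Γ fun i => .ofBool ((l i).all (p i)) := by
  refine (Computes.any (p := fun i a => !p i a) hl
    fun Δ h a hm ha => (step Δ h a hm ha).bnot).bnot.congr fun i => ?_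
  rw [← List.not_all_eq_any_not, Bool.not_not]

theorem Computes.zero {y} (hy : Computes Γ y) : Computes Γ fun _ => .ofNat 0 := hy.nil

theorem Computes.succ {n : Γ.ι → ℕ} (hn : Computes Γ fun i => .ofNat (n i)) :
    Computes Γ fun i => .ofNat (n i + 1) := hn.nil.cons hn

theorem Computes.bdd_nat {n : Γ.ι → ℕ} (hn : Computes Γ fun i => .ofNat (n i)) :
    PolyBdd Γ.s n := hn.bdd.mono fun i => by rw [Data.size_ofNat]; omega

/-- The state of the fold records whether an element has been found, and the position so far. -/
theorem Computes.findIdx {p : ∀ i, T i → Bool} (hl : Computes Γ fun i => .ofList (e i) (l i))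
    (step : ∀ (Δ : Ctx) (h : Δ.Hom Γ) (a : ∀ k, T (h.f k)), (∀ k, a k ∈ l (h.f k)) →
      Computes Δ (fun k => e _ (a k)) → Computes Δ fun k => .ofBool (p _ (a k))) :
    Computes Γ fun i => .ofNat ((l i).findIdx (p i)) := by
  have hf : ∀ i (s : List (T i)), s.foldl (fun (s : Bool × ℕ) a =>
      if s.1 = true then s else if p i a = true then (true, s.2) else (false, s.2 + 1)) (false, 0) =
      (s.any (p i), s.findIdx (p i)) := by
    intro i s
    induction s using List.reverseRecOn with
    | nil => rfl
    | append_singleton s a ih =>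
      rw [List.foldl_append, ih, List.findIdx_append]
      by_cases h : ∃ x ∈ s, p i x = true
      · have := h
        rw [← List.any_eq_true] at this
        have h2 := List.findIdx_lt_length.2 h
        simp [this, h2]
      · have : s.any (p i) = false := by
          rw [← Bool.not_eq_true, List.any_eq_true]; exact h
        have h2 : s.findIdx (p i) = s.length := by
          rw [List.findIdx_eq_length]; push Not at h; intro x hx; simpa using h x hx
        by_cases ha : p i a = true <;> simp [this, h2, ha, List.findIdx_cons, Nat.add_comm]
  have := Computes.foldl_prefix (S := fun _ => Bool × ℕ)
    (eS := fun _ s => .cons (.ofBool s.1) (.ofNat s.2)) (z := fun _ => (false, 0))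
    (f := fun i s a => if s.1 = true then s else if p i a = true then (true, s.2) else
      (false, s.2 + 1)) hl (hl.nil.cons hl.nil) (((PolyBdd.const 2).mul hl.bdd).add (.const 6))
    (fun i pre hpre => by
      have h1 := (List.findIdx_le_length (xs := pre) (p := p i)).trans hpre.length_le
      have h2 := Data.length_lt_size (e i) (l i)
      have h3 : (Data.ofBool (pre.any (p i))).size ≤ 3 := by
        cases pre.any (p i) <;> simp [Data.ofBool, Data.size]
      simp only [hf, Data.size, Data.size_ofNat]
      omega)
    (fun Δ h pre a hpre hs ha => Computes.ite (T := fun _ => Bool × ℕ)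
      (e := fun _ s => .cons (.ofBool s.1) (.ofNat s.2))
      (Computes.ofBool_true hs.fst) hs (Computes.ite (T := fun _ => Bool × ℕ)
      (e := fun _ s => .cons (.ofBool s.1) (.ofNat s.2))
        (step Δ h a (fun k => (hpre k).subset (by simp)) ha).ofBool_true
        (ha.tt.cons hs.snd) (ha.ff.cons (Computes.succ hs.snd))))
  exact this.snd.congr fun i => by rw [hf]; rfl

theorem Computes.length (hl : Computes Γ fun i => .ofList (e i) (l i)) :
    Computes Γ fun i => .ofNat (l i).length :=
  (Computes.findIdx (p := fun _ _ => false) hl fun _ _ _ _ ha => ha.ff).congr fun i => by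
    congr 1; simp [List.findIdx_eq_length]

theorem Computes.replicate {n : Γ.ι → ℕ} {a : ∀ i, T i} (hn : Computes Γ fun i => .ofNat (n i))
    (ha : Computes Γ fun i => e i (a i)) :
    Computes Γ fun i => .ofList (e i) (List.replicate (n i) (a i)) :=
  (Computes.map (T := fun _ => Unit) (e := fun _ _ => .nil) (l := fun i => List.replicate (n i) ())
    (g := fun i _ => a i) (hn.congr fun i => Data.ofNat_eq _) fun Δ h _ _ _ => h.wk ha).congr
    fun i => by rw [List.map_replicate]

/-- Iteration, with an invariant that bounds the size of the values. -/
theorem Computes.iterate {f : ∀ i, S i → S i} {z : ∀ i, S i} {n B : Γ.ι → ℕ}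
    (hn : Computes Γ fun i => .ofNat (n i)) (hz : Computes Γ fun i => eS i (z i))
    (Inv : ∀ i, S i → Prop) (h0 : ∀ i, Inv i (z i)) (h1 : ∀ i s, Inv i s → Inv i (f i s))
    (hB : PolyBdd Γ.s B) (hS : ∀ i s, Inv i s → (eS i s).size ≤ B i)
    (step : ∀ (Δ : Ctx) (h : Δ.Hom Γ) (s : ∀ k, S (h.f k)), (∀ k, Inv (h.f k) (s k)) →
      Computes Δ (fun k => eS _ (s k)) → Computes Δ fun k => eS _ (f _ (s k))) :
    Computes Γ fun i => eS i ((f i)^[n i] (z i)) := by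
  refine (Computes.foldl (T := fun _ => Unit) (e := fun _ _ => .nil)
    (l := fun i => List.replicate (n i) ()) (f := fun i s _ => f i s)
    (hn.congr fun i => Data.ofNat_eq _) hz Inv h0 (fun i s _ _ hs => h1 i s hs) hB hS
    fun Δ h s _ hs _ hsc _ => step Δ h s hs hsc).congr fun i => ?_
  congr 1
  induction n i with
  | zero => rfl
  | succ n ih =>
    rw [List.replicate_succ', List.foldl_append, ih, Function.iterate_succ_apply']; rfl

theorem Computes.range {n : Γ.ι → ℕ} (hn : Computes Γ fun i => .ofNat (n i)) :
    Computes Γ fun i => .ofList Data.ofNat (List.range (n i)) := by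
  have hf : ∀ s : List Unit, s.foldl (fun (s : List ℕ) _ => s.length :: s) [] =
      (List.range s.length).reverse := by
    intro s
    induction s using List.reverseRecOn with
    | nil => rfl
    | append_singleton s a ih => simp [ih, List.range_succ]
  have := Computes.foldl_prefix (T := fun _ => Unit) (e := fun _ _ => .nil)
    (l := fun i => List.replicate (n i) ()) (S := fun _ => List ℕ) (eS := fun _ => .ofList Data.ofNat)
    (f := fun _ s _ => s.length :: s) (z := fun _ => [])
    (hn.congr fun i => Data.ofNat_eq _) hn.nil
    ((hn.bdd_nat.mul (((PolyBdd.const 2).mul hn.bdd_nat).add (.const 2))).add (.const 1))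
    (fun i pre hpre => by
      rw [hf]
      have h1 : pre.length ≤ n i := by simpa using hpre.length_le
      refine Data.size_ofList_le _ (B := 2 * n i + 1) (fun u hu => ?_) (by simpa using h1)
      rw [List.mem_reverse, List.mem_range] at hu
      rw [Data.size_ofNat]
      omega)
    (fun Δ h pre a hpre hs ha => (Computes.length (T := fun _ => ℕ) hs).cons hs)
  exact this.reverse.congr fun i => by rw [hf]; simp

theorem Computes.drop {n : Γ.ι → ℕ} (hl : Computes Γ fun i => .ofList (e i) (l i))
    (hn : Computes Γ fun i => .ofNat (n i)) :
    Computes Γ fun i => .ofList (e i) ((l i).drop (n i)) := by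
  refine (Computes.iterate (S := fun i => List (T i)) (eS := fun i => .ofList (e i))
    (f := fun i s => s.tail) (z := l) hn hl (fun i s => s <:+ l i) (fun i => List.suffix_rfl)
    (fun i s hs => (List.tail_suffix s).trans hs) hl.bdd (fun i s hs => ?_)
    fun Δ h s _ hs => hs.snd.congr fun k => by cases s k <;> rfl).congr fun i => ?_
  · obtain ⟨pre, h⟩ := hs
    have h1 := Data.size_ofList_append (e i) pre s
    have h2 := (Data.ofList (e i) pre).one_le_size
    rw [h] at h1
    omega
  · congr 1
    induction n i with
    | zero => rfl
    | succ n ih => rw [Function.iterate_succ_apply', ih, List.tail_drop]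

theorem Computes.headD {d : ∀ i, T i} (hl : Computes Γ fun i => .ofList (e i) (l i))
    (hd : Computes Γ fun i => e i (d i)) : Computes Γ fun i => e i ((l i).headD (d i)) :=
  (condNil _ hl hl.fst hd).congr fun i => by cases l i <;> rfl

theorem Computes.getD {n : Γ.ι → ℕ} {d : ∀ i, T i} (hl : Computes Γ fun i => .ofList (e i) (l i))
    (hn : Computes Γ fun i => .ofNat (n i)) (hd : Computes Γ fun i => e i (d i)) :
    Computes Γ fun i => e i ((l i).getD (n i) (d i)) :=
  ((hl.drop hn).headD hd).congr fun i => by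
    congr 1; simp [List.headD_eq_head?_getD, List.getD_eq_getElem?_getD, List.head?_drop]

theorem Computes.mul {a b : Γ.ι → ℕ} (ha : Computes Γ fun i => .ofNat (a i))
    (hb : Computes Γ fun i => .ofNat (b i)) : Computes Γ fun i => .ofNat (a i * b i) := by
  refine (Computes.length (T := fun _ => Unit) (e := fun _ _ => .nil)
    (l := fun i => (List.replicate (a i) ()).flatMap fun _ => List.replicate (b i) ())
    (Computes.flatMap (T := fun _ => Unit) (e := fun _ _ => .nil)
      (ha.congr fun i => Data.ofNat_eq _)
      fun Δ h _ _ _ => h.wk (hb.congr fun i => Data.ofNat_eq _))).congr fun i => ?_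
  simp

end Lists


/-! ### Closing a list under an insertion procedure -/

section Saturate

variable {α : Type} {ins : List α → α → List α} {cands : List α → List α} {N : ℕ} {T : List α}

/-- Insert all candidates that are obtained from the current list, and repeat this `N` times. -/
def saturate (ins : List α → α → List α) (cands : List α → List α) (N : ℕ) (T : List α) : List α :=
  (fun T => (cands T).foldl ins T)^[N] T

theorem foldl_invariant {σ : Type} {f : σ → α → σ} {Inv : σ → Prop} {l : List α} {z : σ}
    (h0 : Inv z) (h : ∀ s, ∀ a ∈ l, Inv s → Inv (f s a)) : Inv (l.foldl f z) := by
  induction l generalizing z with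
  | nil => exact h0
  | cons a l ih =>
    exact ih (h z a (by simp) h0) fun s b hb => h s b (List.mem_cons_of_mem _ hb)

theorem saturate_invariant {Inv : List α → Prop} (h0 : Inv T)
    (h : ∀ T₀ T g, Inv T₀ → g ∈ cands T₀ → Inv T → Inv (ins T g)) :
    Inv (saturate ins cands N T) := by
  unfold saturate
  induction N with
  | zero => exact h0
  | succ N ih =>
    rw [Function.iterate_succ_apply']
    exact foldl_invariant ih fun s a ha hs => h _ s a ih ha hs

theorem foldl_ins_suffix (hins : ∀ T g, ins T g = T ∨ ∃ r, ins T g = r :: T) (l : List α) :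
    T <:+ l.foldl ins T := by
  refine foldl_invariant (Inv := fun s => T <:+ s) List.suffix_rfl fun s a _ hs => ?_
  obtain h | ⟨r, h⟩ := hins s a <;> rw [h]
  · exact hs
  · exact hs.trans (List.suffix_cons _ _)

theorem subset_saturate (hins : ∀ T g, ins T g = T ∨ ∃ r, ins T g = r :: T) :
    T ⊆ saturate ins cands N T := by
  unfold saturate
  induction N with
  | zero => exact List.Subset.refl _
  | succ N ih =>
    rw [Function.iterate_succ_apply']
    exact fun x hx => (foldl_ins_suffix hins _).subset (ih hx)

/-- A round that does not make the list longer has inserted nothing. -/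
theorem foldl_ins_eq_self (hins : ∀ T g, ins T g = T ∨ ∃ r, ins T g = r :: T) {l : List α}
    (h : (l.foldl ins T).length ≤ T.length) : ∀ c ∈ l, ins T c = T := by
  induction l with
  | nil => simp
  | cons a l ih =>
    have h1 : ins T a = T := by
      obtain h1 | ⟨r, h1⟩ := hins T a
      · exact h1
      · have := (foldl_ins_suffix hins (T := ins T a) l).length_le
        rw [List.foldl_cons] at h
        rw [h1, List.length_cons] at this
        rw [h1] at h
        omega
    rw [List.foldl_cons, h1] at h
    intro c hc
    rcases List.mem_cons.1 hc with rfl | hc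
    · exact h1
    · exact ih h c hc

theorem foldl_ins_of_eq_self {l : List α} (h : ∀ c ∈ l, ins T c = T) : l.foldl ins T = T := by
  induction l with
  | nil => rfl
  | cons a l ih =>
    rw [List.foldl_cons, h a (by simp)]
    exact ih fun c hc => h c (List.mem_cons_of_mem _ hc)

/-- After sufficiently many rounds no insertion changes the list, because every round that changes
it makes it longer. -/
theorem saturate_fixed {Inv : List α → Prop} (h0 : Inv T)
    (h : ∀ T₀ T g, Inv T₀ → g ∈ cands T₀ → Inv T → Inv (ins T g))
    (hins : ∀ T g, ins T g = T ∨ ∃ r, ins T g = r :: T) (hN : ∀ T, Inv T → T.length ≤ N) :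
    ∀ c ∈ cands (saturate ins cands N T), ins (saturate ins cands N T) c =
      saturate ins cands N T := by
  have key : ∀ k, (∀ c ∈ cands (saturate ins cands k T), ins (saturate ins cands k T) c =
      saturate ins cands k T) ∨ k ≤ (saturate ins cands k T).length := by
    intro k
    induction k with
    | zero => right; exact Nat.zero_le _
    | succ k ih =>
      have hs : saturate ins cands (k + 1) T =
          (cands (saturate ins cands k T)).foldl ins (saturate ins cands k T) := by
        unfold saturate; rw [Function.iterate_succ_apply']
      by_cases hk : ∀ c ∈ cands (saturate ins cands k T), ins (saturate ins cands k T) c =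
          saturate ins cands k T
      · left
        rw [hs, foldl_ins_of_eq_self hk]
        exact hk
      · right
        have h1 := ih.resolve_left hk
        have h2 := mt (foldl_ins_eq_self hins) hk
        rw [hs]
        omega
  obtain h1 | h1 := key N
  · exact h1
  · refine foldl_ins_eq_self hins ?_
    refine (hN _ ?_).trans h1
    have hi := saturate_invariant (N := N) h0 h
    exact foldl_invariant hi fun s a ha hs => h _ s a hi ha hs

end Saturate

/-- In a finite group no inverses of generators are needed. -/
theorem closure_induction_left_of_finite {α : Type} [Group α] [Finite α] {S : Set α}
    {P : α → Prop} (h1 : P 1) (h : ∀ s ∈ S, ∀ g, P g → P (s * g)) :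
    ∀ g ∈ Subgroup.closure S, P g := by
  intro g hg
  rw [← Subgroup.mem_toSubmonoid, Subgroup.closure_toSubmonoid_of_finite] at hg
  induction hg using Submonoid.closure_induction_left with
  | one => exact h1
  | mul_left x hx y _ ih => exact h x hx y ih

/-! ### Transversals and Schreier generators -/

section Transversal

variable {α : Type} [Group α] {gens : List α} {mem : α → Bool} {N : ℕ} {K : Subgroup α}

/-- Representatives of the left cosets modulo the subgroup with membership test `mem` of the group
that is generated by `gens`, if there are at most `N` of them. -/
def transversal (gens : List α) (mem : α → Bool) (N : ℕ) : List α :=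
  saturate (fun R g => if R.any (fun v => mem (v⁻¹ * g)) = true then R else g :: R)
    (fun R => R.flatMap fun u => gens.map fun a => a * u) N [1]

/-- Schreier generators for a transversal `R`. All products `v⁻¹ a u` are formed, and those outside
the subgroup are discarded, instead of searching for the representative `v` of the coset of `a u`. -/
def schreier (gens R : List α) (mem : α → Bool) : List α :=
  (R.flatMap fun u => gens.flatMap fun a => R.map fun v => v⁻¹ * (a * u)).filter mem

theorem transversal_ins_invariant (hmem : ∀ g, mem g = true ↔ g ∈ K) {R₀ R : List α} {g : α}
    (h0 : ∀ u ∈ R₀, u ∈ Subgroup.closure {a | a ∈ gens})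
    (hg : g ∈ R₀.flatMap fun u => gens.map fun a => a * u)
    (hR : (∀ u ∈ R, u ∈ Subgroup.closure {a | a ∈ gens}) ∧ R.Pairwise fun u v => v⁻¹ * u ∉ K) :
    let R' := if R.any (fun v => mem (v⁻¹ * g)) = true then R else g :: R
    (∀ u ∈ R', u ∈ Subgroup.closure {a | a ∈ gens}) ∧ R'.Pairwise fun u v => v⁻¹ * u ∉ K := by
  intro R'
  simp only [R']
  split_ifs with hif
  · exact hR
  · refine ⟨?_, ?_⟩
    · intro u hu
      rcases List.mem_cons.1 hu with rfl | hu
      · obtain ⟨v, hv, hg⟩ := List.mem_flatMap.1 hg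
        obtain ⟨a, ha, rfl⟩ := List.mem_map.1 hg
        exact mul_mem (Subgroup.subset_closure ha) (h0 v hv)
      · exact hR.1 u hu
    · rw [List.pairwise_cons]
      refine ⟨fun v hv hK => hif ?_, hR.2⟩
      rw [List.any_eq_true]
      exact ⟨v, hv, (hmem _).2 hK⟩

/-- The elements of the transversal lie in the group generated by `gens` and in different cosets. -/
theorem transversal_invariant (hmem : ∀ g, mem g = true ↔ g ∈ K) :
    (∀ u ∈ transversal gens mem N, u ∈ Subgroup.closure {a | a ∈ gens}) ∧
      (transversal gens mem N).Pairwise fun u v => v⁻¹ * u ∉ K :=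
  saturate_invariant (Inv := fun R => (∀ u ∈ R, u ∈ Subgroup.closure {a | a ∈ gens}) ∧
    R.Pairwise fun u v => v⁻¹ * u ∉ K) ⟨by simp, by simp⟩
    fun _ _ _ h0 hg hR => transversal_ins_invariant hmem h0.1 hg hR

theorem one_mem_transversal : 1 ∈ transversal gens mem N :=
  subset_saturate (fun R g => by split_ifs <;> simp) (by simp)

section

variable [Finite α]

theorem length_le_relIndex {H : Subgroup α} {R : List α} (hR : ∀ u ∈ R, u ∈ H)
    (hp : R.Pairwise fun u v => v⁻¹ * u ∉ K) : R.length ≤ K.relIndex H := by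
  have : Finite (H ⧸ K.subgroupOf H) := Subgroup.finite_quotient_of_finiteIndex
  let f : Fin R.length → H ⧸ K.subgroupOf H := fun i => ((⟨R[i], hR _ (by simp)⟩ : H) : H ⧸ _)
  have hf : Function.Injective f := by
    have aux : ∀ i j : Fin R.length, i < j → f i ≠ f j := by
      intro i j hij he
      have h1 := List.pairwise_iff_getElem.1 hp i j i.2 j.2 hij
      rw [eq_comm, QuotientGroup.eq] at he
      exact h1 he
    intro i j he
    rcases lt_trichotomy i j with h | h | h
    · exact (aux i j h he).elim
    · exact h
    · exact (aux j i h he.symm).elim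
  have := Nat.card_le_card_of_injective f hf
  rwa [Nat.card_fin] at this

/-- The set of represented cosets is closed under multiplication by the generators, because the list
is saturated. -/
theorem transversal_step (hmem : ∀ g, mem g = true ↔ g ∈ K)
    (hN : K.relIndex (Subgroup.closure {a | a ∈ gens}) ≤ N) {u a : α}
    (hu : u ∈ transversal gens mem N) (ha : a ∈ gens) :
    ∃ v ∈ transversal gens mem N, v⁻¹ * (a * u) ∈ K := by
  have h := saturate_fixed (T := [1]) (N := N)
    (ins := fun R g => if R.any (fun v => mem (v⁻¹ * g)) = true then R else g :: R)
    (cands := fun R => R.flatMap fun u => gens.map fun a => a * u)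
    (Inv := fun R => (∀ u ∈ R, u ∈ Subgroup.closure {a | a ∈ gens}) ∧
      R.Pairwise fun u v => v⁻¹ * u ∉ K) ⟨by simp, by simp⟩
    (fun _ _ _ h0 hg hR => transversal_ins_invariant hmem h0.1 hg hR)
    (fun R g => by split_ifs <;> simp)
    (fun R hR => (length_le_relIndex hR.1 hR.2).trans hN) (a * u)
    (List.mem_flatMap.2 ⟨u, hu, List.mem_map.2 ⟨a, ha, rfl⟩⟩)
  by_contra hcon
  push Not at hcon
  rw [if_neg] at h
  · exact absurd (congrArg List.length h) (by simp)
  · rw [List.any_eq_true]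
    rintro ⟨v, hv, hK⟩
    exact hcon v hv ((hmem _).1 hK)

theorem transversal_cover (hmem : ∀ g, mem g = true ↔ g ∈ K)
    (hN : K.relIndex (Subgroup.closure {a | a ∈ gens}) ≤ N) :
    ∀ g ∈ Subgroup.closure {a | a ∈ gens}, ∃ v ∈ transversal gens mem N, v⁻¹ * g ∈ K := by
  refine closure_induction_left_of_finite ⟨1, one_mem_transversal, by simp⟩ ?_
  rintro a ha g ⟨u, hu, hg⟩
  obtain ⟨v, hv, hK⟩ := transversal_step hmem hN hu ha
  exact ⟨v, hv, by simpa [mul_assoc] using mul_mem hK hg⟩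

/-- Schreier's lemma, for a transversal that contains the identity. -/
theorem closure_schreier (hmem : ∀ g, mem g = true ↔ g ∈ K)
    (hN : K.relIndex (Subgroup.closure {a | a ∈ gens}) ≤ N) :
    Subgroup.closure {s | s ∈ schreier gens (transversal gens mem N) mem} =
      Subgroup.closure {a | a ∈ gens} ⊓ K := by
  have h1 := one_mem_transversal (gens := gens) (mem := mem) (N := N)
  obtain ⟨h2, h3⟩ := transversal_invariant (gens := gens) (N := N) hmem
  set R := transversal gens mem N with hR
  apply le_antisymm
  · rw [Subgroup.closure_le]
    intro s hs
    simp only [schreier, Set.mem_ofPred_eq, List.mem_filter, List.mem_flatMap, List.mem_map] at hs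
    obtain ⟨⟨u, hu, a, ha, v, hv, rfl⟩, hs⟩ := hs
    exact Subgroup.mem_inf.2 ⟨mul_mem (inv_mem (h2 v hv))
      (mul_mem (Subgroup.subset_closure ha) (h2 u hu)), (hmem _).1 hs⟩
  · have key : ∀ g ∈ Subgroup.closure {a | a ∈ gens}, ∃ u ∈ R,
        u⁻¹ * g ∈ Subgroup.closure {s | s ∈ schreier gens R mem} := by
      refine closure_induction_left_of_finite ⟨1, h1, by simp⟩ ?_
      rintro a ha g ⟨u, hu, hg⟩
      obtain ⟨v, hv, hK⟩ := transversal_step hmem hN hu ha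
      refine ⟨v, hv, ?_⟩
      have : v⁻¹ * (a * u) ∈ Subgroup.closure {s | s ∈ schreier gens R mem} := by
        apply Subgroup.subset_closure
        simp only [schreier, Set.mem_ofPred_eq, List.mem_filter, List.mem_flatMap, List.mem_map]
        exact ⟨⟨u, hu, a, ha, v, hv, rfl⟩, (hmem _).2 hK⟩
      simpa [mul_assoc] using mul_mem this hg
    rintro g ⟨hg, hK⟩
    obtain ⟨u, hu, hug⟩ := key g hg
    have hle : Subgroup.closure {s | s ∈ schreier gens R mem} ≤ K := by
      rw [Subgroup.closure_le]
      intro s hs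
      simp only [schreier, Set.mem_ofPred_eq, List.mem_filter] at hs
      exact (hmem _).1 hs.2
    have huK : u ∈ K := by
      have := mul_mem hK (Subgroup.inv_mem _ (hle hug))
      simpa using this
    -- the only element of the transversal that lies in `K` is the identity
    have hu1 : u = 1 := by
      by_contra hne
      have hsymm : Std.Symm fun u v : α => v⁻¹ * u ∉ K :=
        ⟨fun u v h h' => h (by simpa using inv_mem h')⟩
      exact h3.forall hu h1 hne (by simpa using huK)
    simpa [hu1] using hug

end

end Transversal


/-! ### Membership in permutation groups by sifting -/

section Sift

variable {n : ℕ}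

/-- The least point that is moved by `g`; it is `n` for the identity. -/
def lead (g : Equiv.Perm (Fin n)) : ℕ := (List.finRange n).findIdx fun i => decide (g i ≠ i)

/-- The least point that is moved by `g`, and its image. The second component is `0` for the
identity. -/
def key (g : Equiv.Perm (Fin n)) : ℕ × ℕ :=
  (lead g, (List.ofFn fun i => (g i : ℕ)).getD (lead g) 0)

theorem lead_le (g : Equiv.Perm (Fin n)) : lead g ≤ n := by
  simpa [lead] using List.findIdx_le_length (xs := List.finRange n) (p := fun i => decide (g i ≠ i))

theorem apply_of_lt_lead {g : Equiv.Perm (Fin n)} {i : Fin n} (h : (i : ℕ) < lead g) : g i = i := by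
  have := List.not_of_lt_findIdx h
  simpa using this

theorem apply_lead_ne {g : Equiv.Perm (Fin n)} (h : lead g < n) : g ⟨lead g, h⟩ ≠ ⟨lead g, h⟩ := by
  have := List.findIdx_getElem (xs := List.finRange n) (p := fun i => decide (g i ≠ i))
    (w := by simpa [lead] using h)
  simpa [lead] using this

theorem le_lead_iff {g : Equiv.Perm (Fin n)} {j : ℕ} (hj : j ≤ n) :
    j ≤ lead g ↔ ∀ i : Fin n, (i : ℕ) < j → g i = i := by
  refine ⟨fun h i hi => apply_of_lt_lead (hi.trans_le h), fun h => ?_⟩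
  by_contra hlt
  push Not at hlt
  exact apply_lead_ne (hlt.trans_le hj) (h _ hlt)

theorem lead_lt_iff {g : Equiv.Perm (Fin n)} : lead g < n ↔ g ≠ 1 := by
  rw [← not_iff_not, not_lt, not_not, le_lead_iff le_rfl]
  exact ⟨fun h => Equiv.ext fun i => h i i.2, fun h i _ => by simp [h]⟩

theorem lead_one : lead (1 : Equiv.Perm (Fin n)) = n :=
  le_antisymm (lead_le _) ((le_lead_iff le_rfl).2 fun _ _ => rfl)

theorem le_lead_mul {g h : Equiv.Perm (Fin n)} {j : ℕ} (hg : j ≤ lead g) (hh : j ≤ lead h) :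
    j ≤ lead (g * h) := by
  have hj := hg.trans (lead_le g)
  rw [le_lead_iff hj] at *
  intro i hi
  rw [Equiv.Perm.mul_apply, hh i hi, hg i hi]

theorem le_lead_inv {g : Equiv.Perm (Fin n)} {j : ℕ} (hg : j ≤ lead g) : j ≤ lead g⁻¹ := by
  have hj := hg.trans (lead_le g)
  rw [le_lead_iff hj] at *
  intro i hi
  rw [Equiv.Perm.inv_eq_iff_eq, hg i hi]

theorem key_eq_iff {s t : Equiv.Perm (Fin n)} (ht : lead t < n) :
    key s = key t ↔ lead s = lead t ∧ s ⟨lead t, ht⟩ = t ⟨lead t, ht⟩ := by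
  simp only [key, Prod.mk.injEq]
  refine and_congr_right fun h => ?_
  rw [h, List.getD_eq_getElem _ _ (by simpa using ht), List.getD_eq_getElem _ _ (by simpa using ht)]
  simp [Fin.ext_iff]

theorem lead_mul {t h : Equiv.Perm (Fin n)} (hl : lead t < lead h) : lead (t * h) = lead t := by
  have ht : lead t < n := hl.trans_le (lead_le h)
  refine le_antisymm ?_ (le_lead_mul le_rfl hl.le)
  by_contra hlt
  push Not at hlt
  have h1 := apply_of_lt_lead (i := ⟨lead t, ht⟩) hlt
  rw [Equiv.Perm.mul_apply, apply_of_lt_lead (g := h) (by exact hl)] at h1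
  exact apply_lead_ne ht h1

theorem key_mul {t h : Equiv.Perm (Fin n)} (hl : lead t < lead h) : key (t * h) = key t := by
  have ht : lead t < n := hl.trans_le (lead_le h)
  rw [key_eq_iff ht]
  exact ⟨lead_mul hl, by rw [Equiv.Perm.mul_apply, apply_of_lt_lead (g := h) (by exact hl)]⟩

theorem lead_lt_of_key_eq {t g : Equiv.Perm (Fin n)} (ht : lead t < n) (h : key t = key g) :
    lead g < lead (t⁻¹ * g) := by
  have hg : lead g < n := by
    have := congrArg Prod.fst h
    simp only [key] at this
    omega
  have h2 := ((key_eq_iff hg).1 h)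
  rw [Nat.lt_iff_add_one_le, le_lead_iff hg]
  intro i hi
  rcases Nat.lt_succ_iff_lt_or_eq.1 hi with hi | hi
  · rw [Equiv.Perm.mul_apply, apply_of_lt_lead hi, Equiv.Perm.inv_eq_iff_eq,
      apply_of_lt_lead (by rw [h2.1]; exact hi)]
  · obtain rfl : i = ⟨lead g, hg⟩ := Fin.ext hi
    rw [Equiv.Perm.mul_apply, Equiv.Perm.inv_eq_iff_eq, h2.2]

/-- One step of sifting: if `g` moves the same first point as `t`, to the same image, then the
quotient `t⁻¹ * g` fixes this point as well. -/
def siftStep (g t : Equiv.Perm (Fin n)) : Equiv.Perm (Fin n) :=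
  if key t = key g then t⁻¹ * g else g

/-- Reduce `g` by the elements of `T` as long as possible. Every pass over `T` that changes the
element increases its first moved point, so `n` passes suffice. -/
def sift (T : List (Equiv.Perm (Fin n))) (g : Equiv.Perm (Fin n)) : Equiv.Perm (Fin n) :=
  (fun g => T.foldl siftStep g)^[n] g

/-- Products `t₁ t₂ ⋯` of elements of `T`, whose first moved points are increasing. -/
inductive Sifts (T : List (Equiv.Perm (Fin n))) : Equiv.Perm (Fin n) → Prop
  | one : Sifts T 1
  | mul {t h : Equiv.Perm (Fin n)} (ht : t ∈ T) (hl : lead t < lead h) (hh : Sifts T h) :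
      Sifts T (t * h)

variable {T : List (Equiv.Perm (Fin n))}

theorem sift_invariant {P : Equiv.Perm (Fin n) → Prop} {g : Equiv.Perm (Fin n)} (h0 : P g)
    (h : ∀ g, ∀ t ∈ T, P g → key t = key g → P (t⁻¹ * g)) : P (sift T g) := by
  unfold sift
  suffices H : ∀ N, P ((fun g => T.foldl siftStep g)^[N] g) from H n
  intro N
  induction N with
  | zero => exact h0
  | succ N ih =>
    rw [Function.iterate_succ_apply']
    refine foldl_invariant ih fun s t ht hs => ?_
    unfold siftStep
    split_ifs with hif
    · exact h s t ht hs hif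
    · exact hs

/-- The result of sifting cannot be reduced further. -/
theorem key_ne_key_sift (hT : ∀ t ∈ T, lead t < n) (g : Equiv.Perm (Fin n)) :
    ∀ t ∈ T, key t ≠ key (sift T g) := by
  have hmono : ∀ (L : List (Equiv.Perm (Fin n))) (_ : ∀ t ∈ L, lead t < n) g,
      lead g ≤ lead (L.foldl siftStep g) ∧ ((∃ t ∈ L, key t = key g) →
        lead g < lead (L.foldl siftStep g)) ∧
        ((∀ t ∈ L, key t ≠ key g) → L.foldl siftStep g = g) := by
    intro L
    induction L with
    | nil => simp
    | cons a L ih =>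
      intro hL g
      rw [List.foldl_cons]
      obtain ⟨h1, h2, h3⟩ := ih (fun t ht => hL t (List.mem_cons_of_mem _ ht)) (siftStep g a)
      unfold siftStep at *
      by_cases hk : key a = key g
      · rw [if_pos hk] at *
        have := (lead_lt_of_key_eq (hL a (by simp)) hk).trans_le h1
        exact ⟨this.le, fun _ => this, fun h => absurd hk (h a (by simp))⟩
      · rw [if_neg hk] at *
        refine ⟨h1, ?_, fun h => h3 fun t ht => h t (List.mem_cons_of_mem _ ht)⟩
        rintro ⟨t, ht, htk⟩
        rcases List.mem_cons.1 ht with rfl | ht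
        · exact absurd htk hk
        · exact h2 ⟨t, ht, htk⟩
  have key' : ∀ N, (∀ t ∈ T, key t ≠ key ((fun g => T.foldl siftStep g)^[N] g)) ∨
      N ≤ lead ((fun g => T.foldl siftStep g)^[N] g) := by
    intro N
    induction N with
    | zero => right; exact Nat.zero_le _
    | succ N ih =>
      rw [Function.iterate_succ_apply']
      by_cases h : ∀ t ∈ T, key t ≠ key ((fun g => T.foldl siftStep g)^[N] g)
      · left
        rw [(hmono T hT _).2.2 h]
        exact h
      · right
        have h1 := ih.resolve_left h
        push Not at h
        have h2 := (hmono T hT _).2.1 h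
        omega
  obtain h | h := key' n
  · exact h
  · intro t ht he
    have h1 := hT t ht
    have h2 := congrArg Prod.fst he
    simp only [key, sift] at h2
    omega

theorem mul_inv_sift_mem (g : Equiv.Perm (Fin n)) :
    g * (sift T g)⁻¹ ∈ Subgroup.closure {t | t ∈ T} := by
  refine sift_invariant (P := fun r => g * r⁻¹ ∈ Subgroup.closure {t | t ∈ T}) (by simp) ?_
  intro r t ht hr _
  have h1 : t ∈ Subgroup.closure {t | t ∈ T} := Subgroup.subset_closure ht
  simpa [mul_assoc] using mul_mem hr h1

/-- All factors fix the points below the first moved point of the product. -/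
theorem Sifts.mem {g : Equiv.Perm (Fin n)} (hg : Sifts T g) {j : ℕ} (hj : j ≤ lead g) :
    g ∈ Subgroup.closure {t | t ∈ T ∧ j ≤ lead t} := by
  induction hg with
  | one => exact one_mem _
  | mul ht hl _ ih =>
    rw [lead_mul hl] at hj
    exact mul_mem (Subgroup.subset_closure ⟨ht, hj⟩) (ih (hj.trans hl.le))

theorem sifts_of_sift_eq_one (hT : ∀ t ∈ T, lead t < n) {g : Equiv.Perm (Fin n)}
    (h : sift T g = 1) : Sifts T g := by
  refine sift_invariant (P := fun r => Sifts T r → Sifts T g) (T := T) (g := g) id ?_ (h ▸ .one)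
  intro r t ht hr hk hs
  refine hr ?_
  have h1 := lead_lt_of_key_eq (hT t ht) hk
  have h2 : lead t = lead r := congrArg Prod.fst hk
  simpa using Sifts.mul ht (h2 ▸ h1) hs

/-- Sifting recovers the factors one by one, because the key of a product is the key of its first
factor, and no other element of `T` has this key. -/
theorem Sifts.sift_eq_one (hT : ∀ t ∈ T, lead t < n)
    (hk : ∀ s ∈ T, ∀ t ∈ T, key s = key t → s = t) {g : Equiv.Perm (Fin n)} (hg : Sifts T g) :
    sift T g = 1 := by
  have hs : Sifts T (sift T g) := by
    refine sift_invariant hg fun r t ht hr hkey => ?_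
    cases hr with
    | one =>
      have h1 := hT t ht
      have h2 := congrArg Prod.fst hkey
      simp only [key, lead_one] at h2
      omega
    | mul ht' hl hh =>
      rw [key_mul hl] at hkey
      rw [hk _ ht _ ht' hkey]
      simpa using hh
  have hne := key_ne_key_sift hT g
  generalize sift T g = r at *
  cases hs with
  | one => rfl
  | mul ht' hl hh => exact absurd (key_mul hl).symm (hne _ ht')

theorem le_lead_of_mem_closure {j : ℕ} (hj : j ≤ n) {g : Equiv.Perm (Fin n)}
    (hg : g ∈ Subgroup.closure {t | t ∈ T ∧ j ≤ lead t}) : j ≤ lead g := by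
  induction hg using Subgroup.closure_induction with
  | mem t ht => exact ht.2
  | one => rwa [lead_one]
  | mul _ _ _ _ h1 h2 => exact le_lead_mul h1 h2
  | inv _ _ h => exact le_lead_inv h

/-- If all products of two elements of `T` sift to the identity then so do all elements of the
generated group. By downward induction on `j` this is shown for the group that is generated by those
elements of `T` which fix the first `j` points. -/
theorem sifts_of_mem_closure (hT : ∀ t ∈ T, lead t < n)
    (hc : ∀ s ∈ T, ∀ t ∈ T, Sifts T (s * t)) {g : Equiv.Perm (Fin n)}
    (hg : g ∈ Subgroup.closure {t | t ∈ T}) : Sifts T g := by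
  have key' : ∀ j ≤ n, ∀ g ∈ Subgroup.closure {t | t ∈ T ∧ j ≤ lead t}, Sifts T g := by
    -- It suffices that the set of products of increasing elements which fix the first `j` points is
    -- closed under multiplication by an element `s` of `T` from the left. The critical case is that
    -- `s` and the first factor `t` both move the point `j`; then `s * t` is replaced by its own
    -- factorization.
    intro j hj
    induction hj using Nat.decreasingInduction with
    | self =>
      intro g hg
      have h1 := le_lead_of_mem_closure le_rfl hg
      obtain rfl : g = 1 := by
        by_contra hne
        exact absurd (lead_lt_iff.2 hne) (not_lt.2 h1)
      exact .one
    | of_succ j hj ih =>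
      have hle : ∀ {g}, g ∈ Subgroup.closure {t | t ∈ T ∧ j + 1 ≤ lead t} → j < lead g :=
        fun hg => le_lead_of_mem_closure hj hg
      suffices H : ∀ g ∈ Subgroup.closure {t | t ∈ T ∧ j ≤ lead t}, Sifts T g ∧ j ≤ lead g from
        fun g hg => (H g hg).1
      refine closure_induction_left_of_finite ⟨.one, by rw [lead_one]; omega⟩ ?_
      rintro s ⟨hs, hsj⟩ g ⟨hg, hgj⟩
      refine ⟨?_, le_lead_mul hsj hgj⟩
      cases hg with
      | one => exact Sifts.mul hs (by rw [lead_one]; exact hT s hs) .one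
      | @mul t h ht hl hh =>
        rw [lead_mul hl] at hgj
        have hhm := hh.mem (hgj.trans_lt hl)
        rcases hgj.lt_or_eq with htj | rfl
        · have hgm := mul_mem (Subgroup.subset_closure
            (show t ∈ {t | t ∈ T ∧ j + 1 ≤ lead t} from ⟨ht, htj⟩)) hhm
          rcases hsj.lt_or_eq with hsj | rfl
          · exact ih _ (mul_mem (Subgroup.subset_closure ⟨hs, hsj⟩) hgm)
          · exact .mul hs (hle hgm) (ih _ hgm)
        · have hst := hc s hs t ht
          have hst' := le_lead_mul hsj (le_refl (lead t))
          rw [← mul_assoc]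
          generalize s * t = r at *
          cases hst with
          | one => simpa using hh
          | @mul t' h' ht' hl' hh' =>
            rw [lead_mul hl'] at hst'
            have hm := mul_mem (hh'.mem (hst'.trans_lt hl')) hhm
            rw [mul_assoc]
            rcases hst'.lt_or_eq with htj | htj
            · exact ih _ (mul_mem (Subgroup.subset_closure ⟨ht', htj⟩) hm)
            · exact .mul ht' (htj ▸ hle hm) (ih _ hm)
  refine key' 0 (Nat.zero_le _) g ?_
  simpa using hg

/-- Insert the result of sifting `g`, unless it is the identity. -/
def siftIns (T : List (Equiv.Perm (Fin n))) (g : Equiv.Perm (Fin n)) :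
    List (Equiv.Perm (Fin n)) :=
  if sift T g = 1 then T else sift T g :: T

/-- A strong generating set of the group generated by `gens` (Furst, Hopcroft and Luks): it contains
at most one element with a given key, and all elements of the group sift to the identity. -/
def strongGens (gens : List (Equiv.Perm (Fin n))) : List (Equiv.Perm (Fin n)) :=
  saturate siftIns (fun T => T.flatMap fun s => T.map fun t => s * t) (n * n)
    (gens.foldl siftIns [])

/-- The invariant of `siftIns`: no element is the identity, and the keys are distinct. -/
def IsSiftTable (T : List (Equiv.Perm (Fin n))) : Prop :=
  (∀ t ∈ T, lead t < n) ∧ (T.map key).Nodup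

theorem siftIns_eq (T : List (Equiv.Perm (Fin n))) (g : Equiv.Perm (Fin n)) :
    siftIns T g = T ∨ ∃ r, siftIns T g = r :: T := by
  unfold siftIns; split_ifs <;> simp

theorem IsSiftTable.siftIns (hT : IsSiftTable T) (g : Equiv.Perm (Fin n)) :
    IsSiftTable (siftIns T g) := by
  unfold HomExt.siftIns
  split_ifs with h
  · exact hT
  · refine ⟨fun t ht => ?_, ?_⟩
    · rcases List.mem_cons.1 ht with rfl | ht
      · exact lead_lt_iff.2 h
      · exact hT.1 t ht
    · rw [List.map_cons, List.nodup_cons]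
      refine ⟨fun hm => ?_, hT.2⟩
      obtain ⟨t, ht, he⟩ := List.mem_map.1 hm
      exact key_ne_key_sift hT.1 g t ht he

/-- There are at most `n * n` keys. -/
theorem IsSiftTable.length_le (hT : IsSiftTable T) : T.length ≤ n * n := by
  have h1 := List.toFinset_card_of_nodup hT.2
  rw [List.length_map] at h1
  rw [← h1]
  refine (Finset.card_le_card (t := Finset.range n ×ˢ Finset.range n) fun p hp => ?_).trans
    (by simp)
  obtain ⟨t, ht, rfl⟩ := List.mem_map.1 (List.mem_toFinset.1 hp)
  have h2 := hT.1 t ht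
  simp only [key, Finset.mem_product, Finset.mem_range]
  refine ⟨h2, ?_⟩
  rw [List.getD_eq_getElem _ _ (by simpa using h2)]
  simp

theorem closure_siftIns (T : List (Equiv.Perm (Fin n))) (g : Equiv.Perm (Fin n)) :
    Subgroup.closure {t | t ∈ siftIns T g} = Subgroup.closure {t | t = g ∨ t ∈ T} := by
  have h := mul_inv_sift_mem (T := T) g
  apply le_antisymm
  · rw [Subgroup.closure_le]
    intro t ht
    have hle : Subgroup.closure {t | t ∈ T} ≤ Subgroup.closure {t | t = g ∨ t ∈ T} :=
      Subgroup.closure_mono fun t ht => Or.inr ht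
    have hg : g ∈ Subgroup.closure {t | t = g ∨ t ∈ T} := Subgroup.subset_closure (Or.inl rfl)
    have hr : sift T g ∈ Subgroup.closure {t | t = g ∨ t ∈ T} := by
      have := mul_mem (inv_mem (hle h)) hg
      simpa using this
    change t ∈ siftIns T g at ht
    unfold siftIns at ht
    split_ifs at ht
    · exact Subgroup.subset_closure (Or.inr ht)
    · rcases List.mem_cons.1 ht with rfl | ht
      · exact hr
      · exact Subgroup.subset_closure (Or.inr ht)
  · rw [Subgroup.closure_le]
    have hle : Subgroup.closure {t | t ∈ T} ≤ Subgroup.closure {t | t ∈ siftIns T g} :=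
      Subgroup.closure_mono fun t ht => by
        change t ∈ siftIns T g
        change t ∈ T at ht
        unfold siftIns; split_ifs <;> simp [ht]
    rintro t (rfl | ht)
    · have hr : sift T t ∈ Subgroup.closure {s | s ∈ siftIns T t} := by
        by_cases h1 : sift T t = 1
        · rw [h1]; exact one_mem _
        · exact Subgroup.subset_closure (by
            change _ ∈ siftIns T t
            unfold siftIns
            simp [h1])
      have := mul_mem (hle h) hr
      simpa using this
    · exact hle (Subgroup.subset_closure ht)

variable {gens : List (Equiv.Perm (Fin n))}

theorem isSiftTable_nil : IsSiftTable ([] : List (Equiv.Perm (Fin n))) := ⟨by simp, by simp⟩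

theorem isSiftTable_foldl : IsSiftTable (gens.foldl siftIns []) :=
  foldl_invariant (Inv := IsSiftTable) isSiftTable_nil fun _ g _ hs => hs.siftIns g

theorem isSiftTable_strongGens (gens : List (Equiv.Perm (Fin n))) :
    IsSiftTable (strongGens gens) :=
  saturate_invariant isSiftTable_foldl fun _ _ g _ _ hT => hT.siftIns g

theorem closure_foldl_siftIns (T : List (Equiv.Perm (Fin n))) :
    Subgroup.closure {t | t ∈ gens.foldl siftIns T} = Subgroup.closure {t | t ∈ gens ∨ t ∈ T} := by
  induction gens generalizing T with
  | nil => simp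
  | cons g gens ih =>
    rw [List.foldl_cons, ih]
    have h1 : {t | t ∈ gens ∨ t ∈ siftIns T g} = {t | t ∈ gens} ∪ {t | t ∈ siftIns T g} := rfl
    have h2 : {t | t ∈ g :: gens ∨ t ∈ T} = {t | t ∈ gens} ∪ {t | t = g ∨ t ∈ T} := by
      ext t; simp; tauto
    rw [h1, h2, Subgroup.closure_union, Subgroup.closure_union, closure_siftIns]

theorem closure_strongGens (gens : List (Equiv.Perm (Fin n))) :
    Subgroup.closure {t | t ∈ strongGens gens} = Subgroup.closure {t | t ∈ gens} := by
  refine saturate_invariant (Inv := fun T => Subgroup.closure {t | t ∈ T} =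
    Subgroup.closure {t | t ∈ gens}) (by simp [closure_foldl_siftIns]) ?_
  intro T₀ T g h0 hg hT
  rw [closure_siftIns, ← hT]
  apply le_antisymm
  · rw [Subgroup.closure_le]
    rintro t (rfl | ht)
    · obtain ⟨s, hs, hg⟩ := List.mem_flatMap.1 hg
      obtain ⟨t, ht, rfl⟩ := List.mem_map.1 hg
      rw [hT, ← h0]
      exact mul_mem (Subgroup.subset_closure hs) (Subgroup.subset_closure ht)
    · exact Subgroup.subset_closure ht
  · exact Subgroup.closure_mono fun t ht => Or.inr ht

theorem sifts_strongGens {g : Equiv.Perm (Fin n)} (hg : g ∈ Subgroup.closure {t | t ∈ gens}) :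
    Sifts (strongGens gens) g := by
  have hI := isSiftTable_strongGens gens
  rw [← closure_strongGens] at hg
  refine sifts_of_mem_closure hI.1 (fun s hs t ht => sifts_of_sift_eq_one hI.1 ?_) hg
  have h := saturate_fixed (N := n * n) (ins := siftIns)
    (cands := fun T => T.flatMap fun s => T.map fun t => s * t)
    (isSiftTable_foldl (gens := gens)) (fun _ _ g _ _ hT => hT.siftIns g) siftIns_eq
    (fun T hT => hT.length_le) (s * t)
    (List.mem_flatMap.2 ⟨s, hs, List.mem_map.2 ⟨t, ht, rfl⟩⟩)
  change siftIns (strongGens gens) (s * t) = strongGens gens at h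
  unfold siftIns at h
  by_contra hne
  rw [if_neg hne] at h
  exact absurd (congrArg List.length h) (by simp)

/-- Membership in the group with the strong generating set `T`. -/
def siftMem (T : List (Equiv.Perm (Fin n))) (g : Equiv.Perm (Fin n)) : Bool :=
  decide (sift T g = 1)

theorem siftMem_strongGens {g : Equiv.Perm (Fin n)} :
    siftMem (strongGens gens) g = true ↔ g ∈ Subgroup.closure {t | t ∈ gens} := by
  have hI := isSiftTable_strongGens gens
  rw [siftMem, decide_eq_true_iff]
  constructor
  · intro h
    have h1 := mul_inv_sift_mem (T := strongGens gens) g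
    rwa [h, inv_one, mul_one, closure_strongGens] at h1
  · intro h
    exact (sifts_strongGens h).sift_eq_one hI.1 (List.inj_on_of_nodup_map hI.2)

end Sift


/-! ### Reduction to at most `n` generators -/

section Reduce

variable {n : ℕ} {T : List (Equiv.Perm (Fin n))}

/-- The elements of `T`, those that fix more initial points first. -/
def levelSort (T : List (Equiv.Perm (Fin n))) : List (Equiv.Perm (Fin n)) :=
  (List.range n).reverse.flatMap fun i => T.filter fun t => decide (lead t = i)

/-- The state consists of labels of the points and of the generators kept so far. Points with the
same label lie in the same orbit of the generators that are kept. A generator is kept if it connects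
two points with different labels, which are then merged. -/
def reduceStep (s : List ℕ × List (Equiv.Perm (Fin n))) (t : Equiv.Perm (Fin n)) :
    List ℕ × List (Equiv.Perm (Fin n)) :=
  if s.1.getD (key t).1 0 = s.1.getD (key t).2 0 then s else
    (s.1.map fun v => if v = s.1.getD (key t).2 0 then s.1.getD (key t).1 0 else v, t :: s.2)

/-- At most `n` elements of a strong generating set that suffice to generate the group. -/
def reduceGens (T : List (Equiv.Perm (Fin n))) : List (Equiv.Perm (Fin n)) :=
  ((levelSort T).foldl reduceStep (List.range n, [])).2

/-- A word of length `2 * n` whose letters generate the group with the strong generating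
set `T`. -/
def reduceWord (T : List (Equiv.Perm (Fin n))) (j : Fin (2 * n)) : Equiv.Perm (Fin n) :=
  (reduceGens T).getD j 1

theorem mem_levelSort (hT : ∀ t ∈ T, lead t < n) {t : Equiv.Perm (Fin n)} :
    t ∈ levelSort T ↔ t ∈ T := by
  simp only [levelSort, List.mem_flatMap, List.mem_reverse, List.mem_range, List.mem_filter,
    decide_eq_true_eq]
  exact ⟨fun ⟨i, _, h, _⟩ => h, fun h => ⟨lead t, hT t h, h, rfl⟩⟩

theorem pairwise_levelSort : (levelSort T).Pairwise fun s t => lead t ≤ lead s := by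
  rw [levelSort, List.pairwise_flatMap]
  constructor
  · intro i _
    refine List.pairwise_of_forall_mem_list fun s hs t ht => ?_
    simp only [List.mem_filter, decide_eq_true_eq] at hs ht
    rw [hs.2, ht.2]
  · rw [List.pairwise_reverse]
    refine List.pairwise_lt_range.imp fun {i j} hij s hs t ht => ?_
    simp only [List.mem_filter, decide_eq_true_eq] at hs ht
    rw [hs.2, ht.2]
    exact hij.le

theorem key_snd {t : Equiv.Perm (Fin n)} (ht : lead t < n) : (key t).2 = t ⟨lead t, ht⟩ := by
  simp only [key]
  rw [List.getD_eq_getElem _ _ (by simpa using ht)]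
  simp

/-- After the elements that fix the points below `j` have been processed, the generators kept
generate the same group as these elements. If `t` is not kept then `t` takes the point `lead t` to a
point in the same orbit of the group generated so far; the quotient of `t` by an element of this
group that does the same fixes one more point, and hence lies in the group as well. The number of
labels decreases whenever a generator is kept. -/
theorem reduce_invariant (hT : ∀ t ∈ T, lead t < n)
    (hsift : ∀ g ∈ Subgroup.closure {t | t ∈ T}, Sifts T g) (pre : List (Equiv.Perm (Fin n)))
    (hpre : pre <+: levelSort T) :
    let s := pre.foldl reduceStep (List.range n, [])
    s.1.length = n ∧ s.2.length + s.1.toFinset.card ≤ n ∧ (∀ t ∈ s.2, t ∈ pre) ∧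
      (∀ t ∈ pre, t ∈ Subgroup.closure {t | t ∈ s.2}) ∧
      ∀ x y : Fin n, s.1.getD x 0 = s.1.getD y 0 →
        ∃ k ∈ Subgroup.closure {t | t ∈ s.2}, k x = y := by
  induction pre using List.reverseRecOn with
  | nil =>
    refine ⟨by simp, by simpa using List.toFinset_card_le (List.range n), by simp, by simp,
      fun x y h => ⟨1, one_mem _, ?_⟩⟩
    simpa [Fin.ext_iff] using h
  | append_singleton pre t ih =>
    obtain ⟨h1, h2, h3, h4, h5⟩ := ih ((List.prefix_append _ _).trans hpre)
    rw [List.foldl_append, List.foldl_cons, List.foldl_nil]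
    generalize pre.foldl reduceStep (List.range n, []) = s at *
    obtain ⟨c, kept⟩ := s
    dsimp only at h1 h2 h3 h4 h5
    have htT : t ∈ T := (mem_levelSort hT).1 (hpre.subset (by simp))
    have htn := hT t htT
    -- the elements before `t` in the list
    have hpT : ∀ s ∈ pre, s ∈ T ∧ lead t ≤ lead s := by
      intro s hs
      refine ⟨(mem_levelSort hT).1 (hpre.subset (by simp [hs])), ?_⟩
      have := pairwise_levelSort.sublist hpre.sublist
      rw [List.pairwise_append] at this
      exact this.2.2 s hs t (by simp)
    have hTp : ∀ s ∈ T, lead t + 1 ≤ lead s → s ∈ pre := by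
      intro s hs hlt
      have hsm := (mem_levelSort hT).2 hs
      have hpw := pairwise_levelSort (T := T)
      obtain ⟨suf, hsuf⟩ := hpre
      rw [← hsuf] at hsm hpw
      rw [List.append_assoc, List.singleton_append] at hsm hpw
      rcases List.mem_append.1 hsm with h | h
      · exact h
      · exfalso
        rcases List.mem_cons.1 h with rfl | h
        · omega
        · have := (List.pairwise_cons.1 (List.pairwise_append.1 hpw).2.1).1 s h
          omega
    unfold reduceStep
    rw [key_snd htn, show (key t).1 = lead t from rfl]
    dsimp only
    split_ifs with hif
    · refine ⟨h1, h2, fun s hs => by simp [h3 s hs], fun s hs => ?_, h5⟩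
      rcases List.mem_append.1 hs with hs | hs
      · exact h4 s hs
      · obtain rfl := List.mem_singleton.1 hs
        obtain ⟨k, hk, hkt⟩ := h5 ⟨lead s, htn⟩ _ hif
        have hk' : k ∈ Subgroup.closure {t | t ∈ T ∧ lead s ≤ lead t} :=
          Subgroup.closure_mono (fun t ht => hpT t (h3 t ht)) hk
        have hkm : k⁻¹ * s ∈ Subgroup.closure {t | t ∈ T ∧ lead s ≤ lead t} :=
          mul_mem (inv_mem hk') (Subgroup.subset_closure ⟨htT, le_rfl⟩)
        have hlead : lead s + 1 ≤ lead (k⁻¹ * s) := by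
          rw [le_lead_iff htn]
          have h6 := (le_lead_iff htn.le).1 (le_lead_of_mem_closure htn.le hkm)
          intro i hi
          rcases Nat.lt_succ_iff_lt_or_eq.1 hi with hi | hi
          · exact h6 i hi
          · obtain rfl : i = ⟨lead s, htn⟩ := Fin.ext hi
            rw [Equiv.Perm.mul_apply, Equiv.Perm.inv_eq_iff_eq, hkt]
        have h7 := (hsift (k⁻¹ * s) (Subgroup.closure_mono (fun t ht => ht.1) hkm)).mem hlead
        have h8 : k⁻¹ * s ∈ Subgroup.closure {t | t ∈ kept} := by
          refine (Subgroup.closure_le _).2 ?_ h7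
          exact fun t ht => h4 t (hTp t ht.1 ht.2)
        simpa using mul_mem hk h8
    · have hmono : Subgroup.closure {t | t ∈ kept} ≤ Subgroup.closure {s | s ∈ t :: kept} :=
        Subgroup.closure_mono fun s hs => List.mem_cons_of_mem _ hs
      have ht : t ∈ Subgroup.closure {s | s ∈ t :: kept} :=
        Subgroup.subset_closure (List.mem_cons_self)
      set a := c.getD (lead t) 0 with ha
      set b := c.getD (t ⟨lead t, htn⟩ : ℕ) 0 with hb
      have hlab : ∀ x : Fin n, (c.map fun v => if v = b then a else v).getD x 0 =
          if c.getD x 0 = b then a else c.getD x 0 := by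
        intro x
        rw [List.getD_eq_getElem _ _ (by simp [h1]), List.getD_eq_getElem _ _ (by simp [h1])]
        simp
      have hmem : ∀ x : Fin n, c.getD x 0 ∈ c := by
        intro x
        rw [List.getD_eq_getElem _ _ (by simp [h1])]
        simp
      refine ⟨by simp [h1], ?_, ?_, ?_, ?_⟩
      · have hsub : (c.map fun v => if v = b then a else v).toFinset ⊆ c.toFinset.erase b := by
          intro v hv
          simp only [List.mem_toFinset, List.mem_map, Finset.mem_erase] at hv ⊢
          obtain ⟨w, hw, rfl⟩ := hv
          split_ifs with hwb
          · exact ⟨hif, hmem ⟨lead t, htn⟩⟩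
          · exact ⟨hwb, hw⟩
        have h6 := Finset.card_le_card hsub
        have hbm : b ∈ c.toFinset := List.mem_toFinset.2 (hmem _)
        have h7 := Finset.card_erase_add_one hbm
        dsimp only
        rw [List.length_cons]
        omega
      · intro s hs
        rcases List.mem_cons.1 hs with rfl | hs
        · simp
        · simp [h3 s hs]
      · intro s hs
        rcases List.mem_append.1 hs with hs | hs
        · exact hmono (h4 s hs)
        · rw [List.mem_singleton.1 hs]; exact ht
      · -- both points with label `b` are moved to the point `lead t` first
        have key' : ∀ x : Fin n, ∃ k ∈ Subgroup.closure {s | s ∈ t :: kept}, c.getD (k x : ℕ) 0 =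
            if c.getD x 0 = b then a else c.getD x 0 := by
          intro x
          split_ifs with hx
          · obtain ⟨k, hk, hkx⟩ := h5 x (t ⟨lead t, htn⟩) hx
            refine ⟨t⁻¹ * k, mul_mem (inv_mem ht) (hmono hk), ?_⟩
            rw [Equiv.Perm.mul_apply, hkx, ← Equiv.Perm.mul_apply, inv_mul_cancel,
              Equiv.Perm.one_apply]
          · exact ⟨1, one_mem _, rfl⟩
        intro x y hxy
        dsimp only at hxy ⊢
        rw [hlab, hlab] at hxy
        obtain ⟨k, hk, hkx⟩ := key' x
        obtain ⟨l, hl, hly⟩ := key' y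
        obtain ⟨m, hm, hmk⟩ := h5 (k x) (l y) (by rw [hkx, hly, hxy])
        refine ⟨l⁻¹ * (m * k), mul_mem (inv_mem hl) (mul_mem (hmono hm) hk), ?_⟩
        rw [Equiv.Perm.mul_apply, Equiv.Perm.mul_apply, hmk, ← Equiv.Perm.mul_apply, inv_mul_cancel,
          Equiv.Perm.one_apply]

variable {gens : List (Equiv.Perm (Fin n))}

theorem length_reduceGens_le : (reduceGens (strongGens gens)).length ≤ n := by
  have h := (reduce_invariant (isSiftTable_strongGens gens).1
    (fun g hg => sifts_strongGens (closure_strongGens gens ▸ hg)) _ List.prefix_rfl).2.1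
  rw [reduceGens]
  omega

theorem closure_reduceGens : Subgroup.closure {t | t ∈ reduceGens (strongGens gens)} =
    Subgroup.closure {t | t ∈ gens} := by
  have hT := (isSiftTable_strongGens gens).1
  obtain ⟨-, -, h3, h4, -⟩ := reduce_invariant hT
    (fun g hg => sifts_strongGens (closure_strongGens gens ▸ hg)) _ List.prefix_rfl
  rw [← closure_strongGens gens]
  apply le_antisymm
  · exact Subgroup.closure_mono fun t ht => (mem_levelSort hT).1 (h3 t ht)
  · rw [Subgroup.closure_le]
    exact fun t ht => h4 t ((mem_levelSort hT).2 ht)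

theorem closure_reduceWord : Subgroup.closure (Set.range (reduceWord (strongGens gens))) =
    Subgroup.closure {t | t ∈ gens} := by
  rw [← closure_reduceGens]
  have hlen := length_reduceGens_le (gens := gens)
  apply le_antisymm
  · rw [Subgroup.closure_le]
    rintro _ ⟨j, rfl⟩
    unfold reduceWord
    rw [List.getD_eq_getElem?_getD]
    by_cases hj : (j : ℕ) < (reduceGens (strongGens gens)).length
    · rw [List.getElem?_eq_getElem hj]
      exact Subgroup.subset_closure (List.getElem_mem hj)
    · rw [List.getElem?_eq_none (by omega)]
      exact one_mem _
  · rw [Subgroup.closure_le]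
    intro t ht
    obtain ⟨j, hj, rfl⟩ := List.getElem_of_mem ht
    refine Subgroup.subset_closure ⟨⟨j, by omega⟩, ?_⟩
    simp [reduceWord, hj]

end Reduce


/-! ### Permutation group algorithms run in polynomial time -/

section Perm

theorem Data.ofPerm_eq {n : ℕ} (g : Equiv.Perm (Fin n)) :
    Data.ofPerm g = Data.ofList Data.ofNat (List.ofFn fun i => (g i : ℕ)) := by
  rw [Data.ofPerm, show (List.ofFn fun i => (g i : ℕ)) = (List.ofFn g).map Fin.val by
    rw [List.map_ofFn]; rfl, Data.ofList_map]

/-- A bound for the size of the codes of permutations of `n` points. -/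
def permSize (n : ℕ) : ℕ := n * (2 * n + 1 + 1) + 1

theorem Data.size_ofPerm_le {n : ℕ} (g : Equiv.Perm (Fin n)) :
    (Data.ofPerm g).size ≤ permSize n := by
  refine Data.size_ofList_le _ (fun a _ => ?_) (by simp)
  rw [Data.size_ofNat]
  omega

theorem Data.ofPerm_injective {n : ℕ} : Function.Injective (Data.ofPerm (n := n)) := by
  intro g h hgh
  have := Data.ofList_injective (e := fun i : Fin n => Data.ofNat i)
    (fun i j hij => Fin.ext (Data.ofNat_injective hij)) hgh
  exact Equiv.ext (congrFun (List.ofFn_injective this))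

variable {Γ : Ctx} {n : Γ.ι → ℕ} {a b : ∀ i, Equiv.Perm (Fin (n i))}

theorem PolyBdd.permSize (h : PolyBdd Γ.s n) : PolyBdd Γ.s fun i => permSize (n i) :=
  ((h.mul ((((PolyBdd.const 2).mul h).add (.const 1)).add (.const 1)))).add (.const 1)

theorem Computes.list_of_perm (ha : Computes Γ fun i => .ofPerm (a i)) :
    Computes Γ fun i => .ofList Data.ofNat (List.ofFn fun j => (a i j : ℕ)) :=
  ha.congr fun _ => Data.ofPerm_eq _

theorem Computes.degree (ha : Computes Γ fun i => .ofPerm (a i)) :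
    Computes Γ fun i => .ofNat (n i) :=
  (Computes.length (T := fun _ => ℕ) ha.list_of_perm).congr fun i => by rw [List.length_ofFn]

theorem Computes.apply {x : ∀ i, Fin (n i)} (ha : Computes Γ fun i => .ofPerm (a i))
    (hx : Computes Γ fun i => .ofNat (x i)) : Computes Γ fun i => .ofNat (a i (x i)) :=
  (Computes.getD (T := fun _ => ℕ) (d := fun _ => 0) ha.list_of_perm hx hx.zero).congr
    fun i => by
      congr 1
      rw [List.getD_eq_getElem _ _ (by simp)]
      simp

theorem Computes.permMul (ha : Computes Γ fun i => .ofPerm (a i))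
    (hb : Computes Γ fun i => .ofPerm (b i)) : Computes Γ fun i => .ofPerm (a i * b i) := by
  refine (Computes.map (T := fun _ => ℕ) (U := fun _ => ℕ) (e := fun _ => Data.ofNat)
    (eU := fun _ => Data.ofNat)
    (g := fun i v => (List.ofFn fun j => (a i j : ℕ)).getD v 0) hb.list_of_perm
    fun Δ h v _ hv => Computes.getD (T := fun _ => ℕ) (h.wk ha.list_of_perm) hv hv.zero).congr
    fun i => ?_
  rw [Data.ofPerm_eq, List.map_ofFn]
  congr 2
  funext j
  rw [Function.comp_apply, List.getD_eq_getElem _ _ (by simp)]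
  simp

theorem Computes.permInv (ha : Computes Γ fun i => .ofPerm (a i)) :
    Computes Γ fun i => .ofPerm (a i)⁻¹ := by
  refine (Computes.map (T := fun _ => ℕ) (U := fun _ => ℕ) (e := fun _ => Data.ofNat)
    (eU := fun _ => Data.ofNat)
    (g := fun i v => (List.ofFn fun j => (a i j : ℕ)).findIdx fun w => decide (w = v))
    ha.degree.range fun Δ h v _ hv => Computes.findIdx (T := fun _ => ℕ) (h.wk ha.list_of_perm)
      fun Θ h' w _ hw => Computes.decEq (T := fun _ => ℕ) (fun _ => Data.ofNat_injective) hw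
        (h'.wk hv)).congr fun i => ?_
  rw [Data.ofPerm_eq, ← List.map_coe_finRange_eq_range, List.map_map, List.ofFn_eq_map,
    List.ofFn_eq_map]
  congr 1
  refine List.map_congr_left fun j _ => ?_
  rw [Function.comp_apply, List.findIdx_eq (by simp)]
  refine ⟨by simp, fun k hk => ?_⟩
  simp only [List.getElem_map, List.getElem_finRange, Fin.val_inj, decide_eq_false_iff_not]
  intro he
  have h2 : ((a i)⁻¹ j : ℕ) = k := by
    rw [← he, ← Equiv.Perm.mul_apply, inv_mul_cancel]; simp
  omega

theorem Computes.permOne (hn : Computes Γ fun i => .ofNat (n i)) :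
    Computes Γ fun i => .ofPerm (1 : Equiv.Perm (Fin (n i))) :=
  hn.range.congr fun i => by
    rw [Data.ofPerm_eq, List.ofFn_eq_map, ← List.map_coe_finRange_eq_range]
    rfl

theorem Computes.permEq (ha : Computes Γ fun i => .ofPerm (a i))
    (hb : Computes Γ fun i => .ofPerm (b i)) :
    Computes Γ fun i => .ofBool (decide (a i = b i)) :=
  Computes.decEq (fun _ => Data.ofPerm_injective) ha hb

theorem Computes.natEq {a b : Γ.ι → ℕ} (ha : Computes Γ fun i => .ofNat (a i))
    (hb : Computes Γ fun i => .ofNat (b i)) :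
    Computes Γ fun i => .ofBool (decide (a i = b i)) :=
  Computes.decEq (T := fun _ => ℕ) (fun _ => Data.ofNat_injective) ha hb

theorem Computes.lead (ha : Computes Γ fun i => .ofPerm (a i)) :
    Computes Γ fun i => .ofNat (lead (a i)) := by
  refine (Computes.findIdx (T := fun _ => ℕ) (e := fun _ => Data.ofNat)
    (p := fun i v => decide (¬ (List.ofFn fun j => (a i j : ℕ)).getD v 0 = v))
    ha.degree.range fun Δ h v _ hv => (Computes.natEq
      (Computes.getD (T := fun _ => ℕ) (h.wk ha.list_of_perm) hv hv.zero) hv).not).congr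
    fun i => ?_
  rw [← List.map_coe_finRange_eq_range, List.findIdx_map, HomExt.lead]
  congr 2
  funext j
  rw [Function.comp_apply, List.getD_eq_getElem _ _ (by simp)]
  simp [Fin.ext_iff]

theorem Computes.key (ha : Computes Γ fun i => .ofPerm (a i)) :
    Computes Γ fun i => .cons (.ofNat (key (a i)).1) (.ofNat (key (a i)).2) :=
  ha.lead.cons (Computes.getD (T := fun _ => ℕ) ha.list_of_perm ha.lead ha.lead.zero)

theorem Computes.siftStep (ha : Computes Γ fun i => .ofPerm (a i))
    (hb : Computes Γ fun i => .ofPerm (b i)) :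
    Computes Γ fun i => .ofPerm (siftStep (a i) (b i)) := by
  unfold HomExt.siftStep
  refine Computes.ite (T := fun i => Equiv.Perm (Fin (n i))) (e := fun _ => Data.ofPerm) ?_
    (hb.permInv.permMul ha) ha
  refine Computes.decEq (T := fun _ => ℕ × ℕ) (e := fun _ p => .cons (.ofNat p.1) (.ofNat p.2))
    (fun _ p q h => ?_) hb.key ha.key
  simp only [Data.cons.injEq] at h
  exact Prod.ext (Data.ofNat_injective h.1) (Data.ofNat_injective h.2)

variable {T : ∀ i, List (Equiv.Perm (Fin (n i)))}

theorem Computes.sift (hT : Computes Γ fun i => .ofList Data.ofPerm (T i))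
    (ha : Computes Γ fun i => .ofPerm (a i)) :
    Computes Γ fun i => .ofPerm (sift (T i) (a i)) := by
  have hn := ha.degree.bdd_nat.permSize
  exact Computes.iterate (S := fun i => Equiv.Perm (Fin (n i))) (eS := fun _ => Data.ofPerm)
    ha.degree ha (fun _ _ => True) (fun _ => trivial) (fun _ _ _ => trivial) hn
    (fun _ g _ => Data.size_ofPerm_le g) fun Δ h g _ hg =>
    Computes.foldl (T := fun k => Equiv.Perm (Fin (n (h.f k)))) (e := fun _ => Data.ofPerm)
      (S := fun k => Equiv.Perm (Fin (n (h.f k)))) (eS := fun _ => Data.ofPerm)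
      (h.wk hT) hg (fun _ _ => True) (fun _ => trivial) (fun _ _ _ _ _ => trivial) (h.bdd hn)
      (fun _ g _ => Data.size_ofPerm_le g) fun Θ h' s t _ _ hs ht => hs.siftStep ht

theorem Computes.siftMem (hT : Computes Γ fun i => .ofList Data.ofPerm (T i))
    (ha : Computes Γ fun i => .ofPerm (a i)) :
    Computes Γ fun i => .ofBool (siftMem (T i) (a i)) :=
  (hT.sift ha).permEq ha.degree.permOne

theorem Computes.siftIns (hT : Computes Γ fun i => .ofList Data.ofPerm (T i))
    (ha : Computes Γ fun i => .ofPerm (a i)) :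
    Computes Γ fun i => .ofList Data.ofPerm (siftIns (T i) (a i)) := by
  unfold HomExt.siftIns
  exact Computes.ite (T := fun i => List (Equiv.Perm (Fin (n i)))) (hT.siftMem ha) hT
    ((hT.sift ha).cons hT)

end Perm

section Saturate

variable {Γ : Ctx} {α : Γ.ι → Type} {e : ∀ i, α i → Data}

/-- The invariant bounds the number of elements of the list throughout the computation. -/
theorem Computes.saturate {ins : ∀ i, List (α i) → α i → List (α i)}
    {cands : ∀ i, List (α i) → List (α i)} {N B C : Γ.ι → ℕ} {T : ∀ i, List (α i)}
    (hN : Computes Γ fun i => .ofNat (N i)) (hT : Computes Γ fun i => .ofList (e i) (T i))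
    (Inv : ∀ i, List (α i) → Prop) (h0 : ∀ i, Inv i (T i))
    (h1 : ∀ i T₀ T g, Inv i T₀ → g ∈ cands i T₀ → Inv i T → Inv i (ins i T g))
    (hB : PolyBdd Γ.s B) (he : ∀ i a, (e i a).size ≤ B i)
    (hC : PolyBdd Γ.s C) (hlen : ∀ i T, Inv i T → T.length ≤ C i)
    (hcands : ∀ (Δ : Ctx) (h : Δ.Hom Γ) (T : ∀ k, List (α (h.f k))),
      Computes Δ (fun k => .ofList (e _) (T k)) → Computes Δ fun k => .ofList (e _) (cands _ (T k)))
    (hins : ∀ (Δ : Ctx) (h : Δ.Hom Γ) (T : ∀ k, List (α (h.f k))) (g : ∀ k, α (h.f k)),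
      Computes Δ (fun k => .ofList (e _) (T k)) → Computes Δ (fun k => e _ (g k)) →
        Computes Δ fun k => .ofList (e _) (ins _ (T k) (g k))) :
    Computes Γ fun i => .ofList (e i) (saturate (ins i) (cands i) (N i) (T i)) := by
  have hD := (hC.mul (hB.add (.const 1))).add (.const 1)
  have hs : ∀ i s, Inv i s → (Data.ofList (e i) s).size ≤ C i * (B i + 1) + 1 :=
    fun i s hs => Data.size_ofList_le _ (fun a _ => he i a) (hlen i s hs)
  exact Computes.iterate (S := fun i => List (α i)) (eS := fun i => .ofList (e i)) hN hT Inv h0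
    (fun i s hs => foldl_invariant (Inv := Inv i) hs fun t a ha ht => h1 i s t a hs ha ht) hD hs
    fun Δ h s hs' hsc => Computes.foldl (S := fun k => List (α (h.f k)))
      (eS := fun k => .ofList (e _)) (hcands Δ h s hsc) hsc (fun k => Inv (h.f k)) hs'
      (fun k t a ha ht => h1 _ _ t a (hs' k) ha ht) (h.bdd hD) (fun k => hs (h.f k))
      fun Θ h' t a _ _ ht ha => hins Θ (h'.trans h) t a ht ha

end Saturate

section StrongGens

variable {Γ : Ctx} {n : Γ.ι → ℕ} {gens T : ∀ i, List (Equiv.Perm (Fin (n i)))}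

theorem Computes.strongGens (hn : Computes Γ fun i => .ofNat (n i))
    (hg : Computes Γ fun i => .ofList Data.ofPerm (gens i)) :
    Computes Γ fun i => .ofList Data.ofPerm (strongGens (gens i)) := by
  have hB := hn.bdd_nat.permSize
  have hC := hn.bdd_nat.mul hn.bdd_nat
  refine Computes.saturate (α := fun i => Equiv.Perm (Fin (n i))) (e := fun _ => Data.ofPerm)
    (hn.mul hn) ?_ (fun _ => IsSiftTable) (fun _ => isSiftTable_foldl)
    (fun _ _ _ g _ _ hT => hT.siftIns g) hB (fun _ => Data.size_ofPerm_le) hC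
    (fun _ T hT => hT.length_le) ?_ ?_
  · refine Computes.foldl (T := fun i => Equiv.Perm (Fin (n i))) (e := fun _ => Data.ofPerm)
      (S := fun i => List (Equiv.Perm (Fin (n i)))) (eS := fun _ => .ofList Data.ofPerm)
      hg hg.nil (fun _ => IsSiftTable) (fun _ => isSiftTable_nil) (fun _ s g _ hT => hT.siftIns g)
      ((hC.mul (hB.add (.const 1))).add (.const 1))
      (fun i s hs => Data.size_ofList_le _ (fun a _ => Data.size_ofPerm_le a) hs.length_le)
      fun Δ h s a _ _ hs ha => hs.siftIns ha
  · intro Δ h T hT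
    exact Computes.flatMap (T := fun k => Equiv.Perm (Fin (n (h.f k)))) (e := fun _ => Data.ofPerm)
      (U := fun k => Equiv.Perm (Fin (n (h.f k)))) (eU := fun _ => Data.ofPerm) hT
      fun Θ h' s _ hs => Computes.map (T := fun k => Equiv.Perm (Fin (n (h.f (h'.f k)))))
        (e := fun _ => Data.ofPerm) (U := fun k => Equiv.Perm (Fin (n (h.f (h'.f k)))))
        (eU := fun _ => Data.ofPerm) (h'.wk hT)
        fun Ξ h'' t _ ht => (h''.wk hs).permMul ht
  · intro Δ h T g hT hg
    exact hT.siftIns hg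

theorem Computes.levelSort (hn : Computes Γ fun i => .ofNat (n i))
    (hT : Computes Γ fun i => .ofList Data.ofPerm (T i)) :
    Computes Γ fun i => .ofList Data.ofPerm (levelSort (T i)) :=
  Computes.flatMap (T := fun _ => ℕ) (U := fun i => Equiv.Perm (Fin (n i)))
    (eU := fun _ => Data.ofPerm) (Computes.reverse (T := fun _ => ℕ) hn.range)
    fun Δ h j _ hj => Computes.filter (T := fun k => Equiv.Perm (Fin (n (h.f k))))
      (h.wk hT) fun Θ h' t _ ht => ht.lead.natEq (h'.wk hj)

/-- The bounds for the state that hold for every list of permutations. -/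
theorem reduce_size {n : ℕ} (pre : List (Equiv.Perm (Fin n))) :
    let s := pre.foldl reduceStep (List.range n, [])
    s.1.length = n ∧ (∀ v ∈ s.1, v ≤ n) ∧ s.2.length ≤ pre.length := by
  induction pre using List.reverseRecOn with
  | nil => exact ⟨by simp, by simp; omega, by simp⟩
  | append_singleton pre t ih =>
    rw [List.foldl_append, List.foldl_cons, List.foldl_nil]
    generalize pre.foldl reduceStep (List.range n, []) = s at *
    obtain ⟨h1, h2, h3⟩ := ih
    unfold reduceStep
    split_ifs
    · exact ⟨h1, h2, h3.trans (by simp)⟩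
    · refine ⟨by simp [h1], fun v hv => ?_, by simpa using h3⟩
      have hd : ∀ x, s.1.getD x 0 ≤ n := by
        intro x
        rw [List.getD_eq_getElem?_getD]
        rcases h : s.1[x]? with _ | w
        · simp
        · exact h2 _ (List.mem_of_getElem? h)
      obtain ⟨w, hw, rfl⟩ := List.mem_map.1 hv
      split_ifs
      · exact hd _
      · exact h2 _ hw

theorem Computes.reduceGens (hn : Computes Γ fun i => .ofNat (n i))
    (hT : Computes Γ fun i => .ofList Data.ofPerm (T i)) :
    Computes Γ fun i => .ofList Data.ofPerm (reduceGens (T i)) := by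
  have hs := hn.levelSort hT
  have hB := hn.bdd_nat.permSize
  refine (Computes.foldl_prefix (T := fun i => Equiv.Perm (Fin (n i))) (e := fun _ => Data.ofPerm)
    (S := fun i => List ℕ × List (Equiv.Perm (Fin (n i))))
    (eS := fun _ s => .cons (.ofList Data.ofNat s.1) (.ofList Data.ofPerm s.2))
    (f := fun i => reduceStep) (z := fun i => (List.range (n i), []))
    hs (hn.range.cons hn.nil)
    ((((hn.bdd_nat.mul ((((PolyBdd.const 2).mul hn.bdd_nat).add (.const 1)).add (.const 1))).add
      (.const 1)).add ((hs.bdd.mul (hB.add (.const 1))).add (.const 1))).add (.const 1))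
    (fun i pre hpre => ?_) ?_).snd
  · obtain ⟨h1, h2, h3⟩ := reduce_size pre
    refine Nat.succ_le_succ (add_le_add ?_ ?_)
    · refine Data.size_ofList_le _ (fun v hv => ?_) h1.le
      rw [Data.size_ofNat]
      have := h2 v hv
      omega
    · exact Data.size_ofList_le _ (fun v hv => Data.size_ofPerm_le v)
        (h3.trans (hpre.length_le.trans (Data.length_lt_size _ _).le))
  · intro Δ h pre t _ hs ht
    unfold reduceStep
    have ha := Computes.getD (T := fun _ => ℕ) (d := fun _ => 0) hs.fst ht.key.fst ht.zero
    have hb := Computes.getD (T := fun _ => ℕ) (d := fun _ => 0) hs.fst ht.key.snd ht.zero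
    refine Computes.ite (T := fun k => List ℕ × List (Equiv.Perm (Fin (n (h.f k)))))
      (e := fun _ s => .cons (.ofList Data.ofNat s.1) (.ofList Data.ofPerm s.2)) (ha.natEq hb) hs ?_
    refine Computes.cons ?_ (ht.cons hs.snd)
    exact Computes.map (T := fun _ => ℕ) (U := fun _ => ℕ) (eU := fun _ => Data.ofNat) hs.fst
      fun Θ h' v _ hv => Computes.ite (T := fun _ => ℕ) (e := fun _ => Data.ofNat)
        (hv.natEq (h'.wk hb)) (h'.wk ha) hv

theorem Computes.two_mul {a : Γ.ι → ℕ} (ha : Computes Γ fun i => .ofNat (a i)) :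
    Computes Γ fun i => .ofNat (2 * a i) :=
  Computes.mul (a := fun _ => 2) ha.zero.succ.succ ha

theorem Computes.reduceWord (hn : Computes Γ fun i => .ofNat (n i))
    (hT : Computes Γ fun i => .ofList Data.ofPerm (T i)) :
    Computes Γ fun i => .ofList Data.ofPerm (List.ofFn (HomExt.reduceWord (T i))) :=
  (Computes.map (T := fun _ => ℕ) (U := fun i => Equiv.Perm (Fin (n i)))
    (eU := fun _ => Data.ofPerm) (g := fun i j => (HomExt.reduceGens (T i)).getD j 1) hn.two_mul.range
    fun Δ h j _ hj => Computes.getD (T := fun k => Equiv.Perm (Fin (n (h.f k))))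
      (h.wk (hn.reduceGens hT)) hj (h.wk hn.permOne)).congr fun i => by
    rw [← List.map_coe_finRange_eq_range, List.map_map, List.ofFn_eq_map]
    rfl

end StrongGens

/-- Products and inverses in the groups `α i`, whose elements are coded by `e i`, are computable from
the factors. The clause on sizes refers to all elements. -/
structure ComputableGroup (Γ : Ctx) (α : Γ.ι → Type) [∀ i, Group (α i)] (e : ∀ i, α i → Data) :
    Prop where
  size : ∃ B : Γ.ι → ℕ, PolyBdd Γ.s B ∧ ∀ i a, (e i a).size ≤ B i
  mul : ∀ (Δ : Ctx) (h : Δ.Hom Γ) (a b : ∀ k, α (h.f k)), Computes Δ (fun k => e _ (a k)) →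
    Computes Δ (fun k => e _ (b k)) → Computes Δ fun k => e _ (a k * b k)
  inv : ∀ (Δ : Ctx) (h : Δ.Hom Γ) (a : ∀ k, α (h.f k)), Computes Δ (fun k => e _ (a k)) →
    Computes Δ fun k => e _ (a k)⁻¹

section Transversal

variable {Γ : Ctx} {n m : Γ.ι → ℕ}

theorem computableGroup_perm (hn : PolyBdd Γ.s n) :
    ComputableGroup Γ (fun i => Equiv.Perm (Fin (n i))) fun _ => Data.ofPerm :=
  ⟨⟨_, hn.permSize, fun _ => Data.size_ofPerm_le⟩, fun _ _ _ _ ha hb => ha.permMul hb,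
    fun _ _ _ ha => ha.permInv⟩

/-- The code of a pair of permutations. -/
def codePair {n m : ℕ} (p : Equiv.Perm (Fin n) × Equiv.Perm (Fin m)) : Data :=
  .cons (.ofPerm p.1) (.ofPerm p.2)

theorem computableGroup_pair (hn : PolyBdd Γ.s n) (hm : PolyBdd Γ.s m) :
    ComputableGroup Γ (fun i => Equiv.Perm (Fin (n i)) × Equiv.Perm (Fin (m i)))
      fun _ => codePair :=
  ⟨⟨_, (hn.permSize.add hm.permSize).add (.const 1), fun _ p => Nat.succ_le_succ
    (add_le_add (Data.size_ofPerm_le p.1) (Data.size_ofPerm_le p.2))⟩,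
    fun _ _ _ _ ha hb => (ha.fst.permMul hb.fst).cons (ha.snd.permMul hb.snd),
    fun _ _ _ ha => ha.fst.permInv.cons ha.snd.permInv⟩

variable {α : Γ.ι → Type} [∀ i, Group (α i)] {e : ∀ i, α i → Data} {gens R : ∀ i, List (α i)}
  {mem : ∀ i, α i → Bool} {N : Γ.ι → ℕ}

theorem Computes.transversal [∀ i, Finite (α i)] (hα : ComputableGroup Γ α e)
    {K : ∀ i, Subgroup (α i)} (hK : ∀ i g, mem i g = true ↔ g ∈ K i)
    (hKN : ∀ i, (K i).relIndex (Subgroup.closure {a | a ∈ gens i}) ≤ N i)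
    (hN : Computes Γ fun i => .ofNat (N i)) (h1 : Computes Γ fun i => e i 1)
    (hg : Computes Γ fun i => .ofList (e i) (gens i))
    (hmem : ∀ (Δ : Ctx) (h : Δ.Hom Γ) (a : ∀ k, α (h.f k)), Computes Δ (fun k => e _ (a k)) →
      Computes Δ fun k => .ofBool (mem _ (a k))) :
    Computes Γ fun i => .ofList (e i) (transversal (gens i) (mem i) (N i)) := by
  obtain ⟨B, hB, he⟩ := hα.size
  refine Computes.saturate hN (h1.cons h1.nil) (fun i R =>
      (∀ u ∈ R, u ∈ Subgroup.closure {a | a ∈ gens i}) ∧ R.Pairwise fun u v => v⁻¹ * u ∉ K i)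
    (fun i => ⟨by simp, by simp⟩) ?_ hB he hN.bdd_nat
    (fun i R hR => (length_le_relIndex hR.1 hR.2).trans (hKN i)) ?_ ?_
  · intro i R₀ R g h0 hg hR
    exact transversal_ins_invariant (hK i) h0.1 hg hR
  · intro Δ h R hR
    exact Computes.flatMap (T := fun k => α (h.f k)) (U := fun k => α (h.f k)) (eU := fun k => e _)
      hR fun Θ h' u _ hu => Computes.map (T := fun k => α (h.f (h'.f k)))
        (U := fun k => α (h.f (h'.f k))) (eU := fun k => e _) ((h'.trans h).wk hg)
        fun Ξ h'' a _ ha => hα.mul Ξ (h''.trans (h'.trans h)) _ _ ha (h''.wk hu)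
  · intro Δ h R g hR hg
    refine Computes.ite (T := fun k => List (α (h.f k))) (e := fun k => .ofList (e _))
      (Computes.ofBool_true ?_) hR (hg.cons hR)
    exact Computes.any (T := fun k => α (h.f k)) hR fun Θ h' v _ hv => hmem Θ (h'.trans h) _
      (hα.mul Θ (h'.trans h) _ _ (hα.inv Θ (h'.trans h) _ hv) (h'.wk hg))

theorem Computes.schreier (hα : ComputableGroup Γ α e)
    (hg : Computes Γ fun i => .ofList (e i) (gens i)) (hR : Computes Γ fun i => .ofList (e i) (R i))
    (hmem : ∀ (Δ : Ctx) (h : Δ.Hom Γ) (a : ∀ k, α (h.f k)), Computes Δ (fun k => e _ (a k)) →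
      Computes Δ fun k => .ofBool (mem _ (a k))) :
    Computes Γ fun i => .ofList (e i) (schreier (gens i) (R i) (mem i)) :=
  Computes.filter (Computes.flatMap hR fun Δ h u _ hu =>
    Computes.flatMap (T := fun k => α (h.f k)) (h.wk hg) fun Θ h' a _ ha =>
      Computes.map (T := fun k => α (h.f (h'.f k))) ((h'.trans h).wk hR) fun Ξ h'' v _ hv =>
        hα.mul Ξ (h''.trans (h'.trans h)) _ _ (hα.inv Ξ (h''.trans (h'.trans h)) _ hv)
          (hα.mul Ξ (h''.trans (h'.trans h)) _ _ (h''.wk ha) (h''.wk (h'.wk hu))))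
    fun Δ h a _ ha => hmem Δ h a ha

end Transversal


/-! ### Permutation actions and conjugacy classes of point stabilizers -/

section Actions

variable {H : Type} [Group H]

/-- The conjugacy classes of subgroups of `H`. -/
abbrev ConjCl (H : Type) [Group H] : Type := MulAction.orbitRel.Quotient (ConjAct H) (Subgroup H)

/-- The conjugacy class of `L`. -/
def cls (L : Subgroup H) : ConjCl H := Quotient.mk'' L

theorem cls_eq_iff {L L' : Subgroup H} :
    cls L = cls L' ↔ ∃ g : H, ∀ x, x ∈ L ↔ g⁻¹ * x * g ∈ L' := by
  rw [cls, cls, Quotient.eq'', MulAction.orbitRel_apply]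
  constructor
  · rintro ⟨g, rfl⟩
    refine ⟨ConjAct.ofConjAct g, fun x => ?_⟩
    rw [Subgroup.mem_pointwise_smul_iff_inv_smul_mem, ConjAct.smul_def]
    simp
  · rintro ⟨g, hg⟩
    refine ⟨ConjAct.toConjAct g, Subgroup.ext fun x => ?_⟩
    rw [Subgroup.mem_pointwise_smul_iff_inv_smul_mem, ConjAct.smul_def, hg]
    simp

/-- The class of `L`, without the bound for the index. -/
def ConjLeq.toCl {m : ℕ} : ConjLeq H m → ConjCl H :=
  Quotient.map' (s₂ := MulAction.orbitRel (ConjAct H) (Subgroup H)) Subtype.val fun _ _ h => h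

theorem ConjLeq.toCl_mk {m : ℕ} (L : Subgroup H) (h : L.index ≤ m) :
    (ConjLeq.mk L h).toCl = cls L := rfl

theorem ConjLeq.toCl_injective {m : ℕ} : Function.Injective (ConjLeq.toCl (H := H) (m := m)) := by
  intro a b
  induction a using Quotient.inductionOn with | h L =>
  induction b using Quotient.inductionOn with | h L' =>
  intro h
  exact Quotient.sound (Quotient.exact' (s₁ := MulAction.orbitRel (ConjAct H) (Subgroup H)) h)

variable {X Y : Type}

/-- The stabilizer of the point `x` under the action `θ`. -/
def stab (θ : H →* Equiv.Perm X) (x : X) : Subgroup H :=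
  (MulAction.stabilizer (Equiv.Perm X) x).comap θ

theorem mem_stab {θ : H →* Equiv.Perm X} {x : X} {g : H} : g ∈ stab θ x ↔ θ g x = x := Iff.rfl

theorem cls_stab_apply (θ : H →* Equiv.Perm X) (g : H) (x : X) :
    cls (stab θ (θ g x)) = cls (stab θ x) := by
  rw [cls_eq_iff]
  refine ⟨g, fun a => ?_⟩
  rw [mem_stab, mem_stab, map_mul, map_mul, map_inv, Equiv.Perm.mul_apply, Equiv.Perm.mul_apply,
    Equiv.Perm.inv_eq_iff_eq]

/-- The orbit equivalence relation of the action `θ`. -/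
def orbSetoid (θ : H →* Equiv.Perm X) : Setoid X where
  r x y := ∃ g, θ g x = y
  iseqv :=
    { refl := fun x => ⟨1, by simp⟩
      symm := fun {x y} ⟨g, h⟩ => ⟨g⁻¹, by rw [map_inv, Equiv.Perm.inv_eq_iff_eq, h]⟩
      trans := fun {x y z} ⟨g, h⟩ ⟨k, hk⟩ => ⟨k * g, by
        rw [map_mul, Equiv.Perm.mul_apply, h, hk]⟩ }

theorem exists_apply_out (θ : H →* Equiv.Perm X) (x : X) :
    ∃ g, θ g (Quotient.mk (orbSetoid θ) x).out = x :=
  Quotient.exact (Quotient.out_eq (Quotient.mk (orbSetoid θ) x))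

variable [Finite X] [Finite Y]

open Classical in
/-- The multiset of the conjugacy classes of the point stabilizers of the action `θ`, with one point
per orbit. -/
noncomputable def otype (θ : H →* Equiv.Perm X) : Multiset (ConjCl H) :=
  letI := Fintype.ofFinite (Quotient (orbSetoid θ))
  (Finset.univ : Finset (Quotient (orbSetoid θ))).val.map fun o => cls (stab θ o.out)

theorem univ_map_equiv {α β γ : Type} [Fintype α] [Fintype β] (e : α ≃ β) (f : β → γ) :
    (Finset.univ : Finset α).val.map (fun a => f (e a)) = (Finset.univ : Finset β).val.map f := by
  rw [← Multiset.map_univ_val_equiv e, Multiset.map_map]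
  rfl

/-- The multiset of stabilizer classes may be computed from any choice of orbit representatives. -/
theorem otype_eq_of_section (θ : H →* Equiv.Perm X) {J : Type} [Fintype J] (f : J → X)
    (hf : ∀ x, ∃! j, ∃ g, θ g (f j) = x) :
    otype θ = (Finset.univ : Finset J).val.map fun j => cls (stab θ (f j)) := by
  let _ := Fintype.ofFinite (Quotient (orbSetoid θ))
  have hbij : Function.Bijective fun j => (Quotient.mk (orbSetoid θ) (f j)) := by
    constructor
    · intro j j' h
      obtain ⟨g, hg⟩ : ∃ g, θ g (f j) = f j' := Quotient.exact h
      obtain ⟨k, -, hk⟩ := hf (f j')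
      rw [hk j ⟨g, hg⟩, hk j' ⟨1, by simp⟩]
    · intro o
      induction o using Quotient.inductionOn with
      | h x =>
        obtain ⟨j, ⟨g, hg⟩, -⟩ := hf x
        exact ⟨j, Quotient.sound ⟨g, hg⟩⟩
  have h1 := univ_map_equiv (Equiv.ofBijective _ hbij)
    fun o : Quotient (orbSetoid θ) => cls (stab θ o.out)
  rw [otype, ← h1]
  refine Multiset.map_congr rfl fun j _ => ?_
  obtain ⟨g, hg⟩ : ∃ g, θ g (f j) = (Quotient.mk (orbSetoid θ) (f j)).out :=
    Quotient.exact (Quotient.out_eq (Quotient.mk (orbSetoid θ) (f j))).symm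
  have := cls_stab_apply θ g (f j)
  rw [hg] at this
  exact this

theorem otype_congr {θ : H →* Equiv.Perm X} {η : H →* Equiv.Perm Y} (e : X ≃ Y)
    (he : ∀ g x, e (θ g x) = η g (e x)) : otype θ = otype η := by
  let _ := Fintype.ofFinite (Quotient (orbSetoid θ))
  rw [otype_eq_of_section η (fun o : Quotient (orbSetoid θ) => e o.out), otype]
  · refine Multiset.map_congr rfl fun o _ => congrArg cls (Subgroup.ext fun g => ?_)
    rw [mem_stab, mem_stab, ← he, e.apply_eq_iff_eq]
  · intro y
    refine ⟨Quotient.mk _ (e.symm y), ?_, ?_⟩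
    · obtain ⟨g, hg⟩ := exists_apply_out θ (e.symm y)
      exact ⟨g, by rw [← he, hg, e.apply_symm_apply]⟩
    · rintro o ⟨g, hg⟩
      rw [← he] at hg
      rw [← Quotient.out_eq o]
      exact Quotient.sound ⟨g, by rw [← hg, e.symm_apply_apply]⟩

/-- Families with the same multiset of values differ by a reindexing. -/
theorem exists_equiv_of_map_eq {α β γ : Type} [Fintype α] [Fintype β] {f : α → γ} {g : β → γ}
    (h : (Finset.univ : Finset α).val.map f = (Finset.univ : Finset β).val.map g) :
    ∃ e : α ≃ β, ∀ a, g (e a) = f a := by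
  classical
  have h1 : ∀ c, Nonempty ({a // f a = c} ≃ {b // g b = c}) := by
    intro c
    refine ⟨Fintype.equivOfCardEq ?_⟩
    have := congrArg (Multiset.count c) h
    rw [Multiset.count_map, Multiset.count_map] at this
    rw [Fintype.card_subtype, Fintype.card_subtype]
    simpa [Finset.card, Finset.filter, eq_comm] using this
  have k := fun c => Classical.choice (h1 c)
  refine ⟨(Equiv.sigmaFiberEquiv f).symm.trans
    ((Equiv.sigmaCongrRight k).trans (Equiv.sigmaFiberEquiv g)), fun a => ?_⟩
  exact (k (f a) ⟨a, rfl⟩).2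

/-- Actions with the same multiset of stabilizer classes are isomorphic. -/
theorem exists_equiv_of_otype_eq {θ : H →* Equiv.Perm X} {η : H →* Equiv.Perm Y}
    (h : otype θ = otype η) : ∃ e : X ≃ Y, ∀ g x, e (θ g x) = η g (e x) := by
  let _ := Fintype.ofFinite (Quotient (orbSetoid θ))
  let _ := Fintype.ofFinite (Quotient (orbSetoid η))
  obtain ⟨b, hb⟩ := exists_equiv_of_map_eq h
  -- in the orbit that corresponds to `o`, a point with the same stabilizer as the point `o.out`
  have h1 : ∀ o : Quotient (orbSetoid θ), ∃ y : Y, Quotient.mk (orbSetoid η) y = b o ∧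
      ∀ g, η g y = y ↔ θ g o.out = o.out := by
    intro o
    obtain ⟨k, hk⟩ := cls_eq_iff.1 (hb o).symm
    refine ⟨η k (b o).out, ?_, fun g => ?_⟩
    · rw [← Quotient.out_eq (b o)]
      exact Quotient.sound ((orbSetoid η).symm ⟨k, by rw [Quotient.out_eq]⟩)
    · have := hk g
      rw [mem_stab, mem_stab, map_mul, map_mul, map_inv, Equiv.Perm.mul_apply,
        Equiv.Perm.mul_apply, Equiv.Perm.inv_eq_iff_eq] at this
      exact this.symm
  choose y hy hst using h1
  choose γ hγ using exists_apply_out θ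
  let E : X → Y := fun x => η (γ x) (y (Quotient.mk _ x))
  have hE : ∀ g o, E (θ g o.out) = η g (y o) := by
    intro g o
    have ho : Quotient.mk (orbSetoid θ) (θ g o.out) = o := by
      rw [← Quotient.out_eq o]
      exact Quotient.sound ((orbSetoid θ).symm ⟨g, by rw [Quotient.out_eq]⟩)
    have h3 := hγ (θ g o.out)
    simp only [E]
    rw [ho] at h3 ⊢
    have h4 : θ (g⁻¹ * γ (θ g o.out)) o.out = o.out := by
      rw [map_mul, Equiv.Perm.mul_apply, h3, map_inv, Equiv.Perm.inv_eq_iff_eq]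
    rw [← hst, map_mul, Equiv.Perm.mul_apply, map_inv, Equiv.Perm.inv_eq_iff_eq] at h4
    exact h4
  have heq : ∀ g x, E (θ g x) = η g (E x) := by
    intro g x
    rw [← hγ x, ← Equiv.Perm.mul_apply, ← map_mul, hE, hE, map_mul, Equiv.Perm.mul_apply]
  have hinj : Function.Injective E := by
    intro x x' hxx
    have ho : Quotient.mk (orbSetoid θ) x = Quotient.mk (orbSetoid θ) x' := by
      apply b.injective
      rw [← hy, ← hy]
      have h3 : (orbSetoid η).r (y (Quotient.mk _ x)) (E x) := ⟨γ x, rfl⟩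
      have h4 : (orbSetoid η).r (y (Quotient.mk _ x')) (E x') := ⟨γ x', rfl⟩
      rw [← hxx] at h4
      exact Quotient.sound ((orbSetoid η).trans h3 ((orbSetoid η).symm h4))
    have h3 := hγ x
    have h4 := hγ x'
    simp only [E] at hxx
    rw [← ho] at h4 hxx
    rw [← h3, ← h4]
    have h5 : η ((γ x')⁻¹ * γ x) (y (Quotient.mk _ x)) = y (Quotient.mk _ x) := by
      rw [map_mul, Equiv.Perm.mul_apply, hxx, map_inv, Equiv.Perm.inv_eq_iff_eq]
    rw [hst, map_mul, Equiv.Perm.mul_apply, map_inv, Equiv.Perm.inv_eq_iff_eq] at h5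
    exact h5
  have hsurj : Function.Surjective E := by
    intro z
    obtain ⟨g, hg⟩ : ∃ g, η g (y (b.symm (Quotient.mk _ z))) = z :=
      Quotient.exact ((hy _).trans (b.apply_symm_apply _))
    exact ⟨θ g (b.symm (Quotient.mk _ z)).out, by rw [hE, hg]⟩
  exact ⟨Equiv.ofBijective E ⟨hinj, hsurj⟩, heq⟩

/-- The action on the disjoint union of the sets `Z j`. -/
def sigmaHom {J : Type} {Z : J → Type} (θ : ∀ j, H →* Equiv.Perm (Z j)) :
    H →* Equiv.Perm (Σ j, Z j) :=
  (Equiv.Perm.sigmaCongrRightHom Z).comp (MonoidHom.pi θ)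

theorem sigmaHom_apply {J : Type} {Z : J → Type} (θ : ∀ j, H →* Equiv.Perm (Z j)) (g : H)
    (p : Σ j, Z j) : sigmaHom θ g p = ⟨p.1, θ p.1 g p.2⟩ := rfl

theorem otype_sigmaHom {J : Type} [Fintype J] {Z : J → Type} [∀ j, Finite (Z j)]
    (θ : ∀ j, H →* Equiv.Perm (Z j)) : otype (sigmaHom θ) = ∑ j, otype (θ j) := by
  let _ := fun j => Fintype.ofFinite (Quotient (orbSetoid (θ j)))
  rw [otype_eq_of_section (sigmaHom θ)
    (fun p : Σ j, Quotient (orbSetoid (θ j)) => (⟨p.1, p.2.out⟩ : Σ j, Z j))]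
  · rw [← Finset.univ_sigma_univ]
    change Multiset.map _ (Multiset.sigma _ _) = _
    rw [Multiset.sigma, Multiset.map_bind, Multiset.bind, Multiset.join]
    refine congrArg Multiset.sum (Multiset.map_congr rfl fun j _ => ?_)
    rw [Multiset.map_map, otype]
    refine Multiset.map_congr rfl fun o _ => congrArg cls (Subgroup.ext fun g => ?_)
    rw [mem_stab, mem_stab]
    simp only [sigmaHom_apply]
    exact ⟨fun h => eq_of_heq (Sigma.mk.inj h).2, fun h => by rw [h]⟩
  · rintro ⟨j, x⟩
    refine ⟨⟨j, Quotient.mk _ x⟩, ?_, ?_⟩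
    · obtain ⟨g, hg⟩ := exists_apply_out (θ j) x
      exact ⟨g, by rw [sigmaHom_apply]; dsimp only; rw [hg]⟩
    · rintro ⟨j', o⟩ ⟨g, hg⟩
      rw [sigmaHom_apply] at hg
      dsimp only at hg
      obtain rfl : j' = j := congrArg Sigma.fst hg
      have := eq_of_heq (Sigma.mk.inj hg).2
      rw [← Quotient.out_eq o]
      congr 1
      exact Quotient.sound ⟨g, this⟩

/-- The action on the left cosets of `L`. -/
def cosetHom (L : Subgroup H) : H →* Equiv.Perm (H ⧸ L) := MulAction.toPermHom H (H ⧸ L)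

theorem cosetHom_mk (L : Subgroup H) (g a : H) :
    cosetHom L g (a : H ⧸ L) = ((g * a : H) : H ⧸ L) := rfl

variable [Finite H]

/-- The stabilizer of the coset of the identity is `L` itself. -/
theorem otype_cosetHom (L : Subgroup H) : otype (cosetHom L) = {cls L} := by
  rw [otype_eq_of_section (cosetHom L) (fun _ : Unit => ((1 : H) : H ⧸ L))]
  · have : stab (cosetHom L) ((1 : H) : H ⧸ L) = L := by
      ext g
      rw [mem_stab, cosetHom_mk, eq_comm, QuotientGroup.eq]
      simp
    rw [this]
    rfl
  · intro x
    induction x using QuotientGroup.induction_on with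
    | H a => exact ⟨(), ⟨a, by rw [cosetHom_mk, mul_one]⟩, fun _ _ => rfl⟩

/-- The restriction to `M` of the transitive action with stabilizers in the class `c`. -/
noncomputable def restrictCl (M : Subgroup H) (c : ConjCl H) : Multiset (ConjCl M) :=
  otype ((cosetHom c.out).comp M.subtype)

theorem restrictCl_cls (M L : Subgroup H) :
    restrictCl M (cls L) = otype ((cosetHom L).comp M.subtype) := by
  have h1 : cls (cls L).out = cls L := Quotient.out_eq' (cls L)
  obtain ⟨e, he⟩ := exists_equiv_of_otype_eq (θ := cosetHom (cls L).out) (η := cosetHom L)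
    (by rw [otype_cosetHom, otype_cosetHom, h1])
  exact otype_congr e fun g x => he g x

theorem otype_sigma_restrict {J : Type} [Fintype J] (M : Subgroup H) (L : J → Subgroup H) :
    otype ((sigmaHom fun j => cosetHom (L j)).comp M.subtype) = ∑ j, restrictCl M (cls (L j)) := by
  have : (sigmaHom fun j => cosetHom (L j)).comp M.subtype =
    sigmaHom fun j => (cosetHom (L j)).comp M.subtype := rfl
  rw [this, otype_sigmaHom]
  exact Finset.sum_congr rfl fun j _ => (restrictCl_cls M (L j)).symm

/-- The type of the restriction of an action to a subgroup is determined by the type of the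
action, orbit by orbit. -/
theorem otype_restrict (θ : H →* Equiv.Perm X) (M : Subgroup H) :
    otype (θ.comp M.subtype) = ((otype θ).map (restrictCl M)).sum := by
  let _ := Fintype.ofFinite (Quotient (orbSetoid θ))
  obtain ⟨e, he⟩ := exists_equiv_of_otype_eq (θ := θ)
    (η := sigmaHom fun o : Quotient (orbSetoid θ) => cosetHom (stab θ o.out))
    (by
      rw [otype_sigmaHom, Finset.sum_congr rfl fun o _ => otype_cosetHom (stab θ o.out)]
      rw [← Multiset.sum_map_singleton (otype θ), otype, Multiset.map_map]
      rfl)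
  rw [otype_congr e (η := (sigmaHom fun o : Quotient (orbSetoid θ) =>
    cosetHom (stab θ o.out)).comp M.subtype) fun g x => he g x, otype_sigma_restrict, otype,
    Multiset.map_map]
  rfl

/-- The multisets of classes with and without a bound for the index agree. Two notions of orbit are
reconciled: those of the image and those of the action itself. -/
theorem orbitType_toCl {m : ℕ} (ψ : H →* Equiv.Perm (Fin m)) :
    (orbitType ψ).map ConjLeq.toCl = otype ψ := by
  let _ := Fintype.ofFinite (MulAction.orbitRel.Quotient ψ.range (Fin m))
  rw [orbitType, Multiset.map_map, otype_eq_of_section ψ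
    (fun o : MulAction.orbitRel.Quotient ψ.range (Fin m) => Quotient.out o)]
  · rfl
  · intro x
    refine ⟨Quotient.mk'' x, ?_, ?_⟩
    · have h := Quotient.exact (Quotient.out_eq' (Quotient.mk'' x :
        MulAction.orbitRel.Quotient ψ.range (Fin m)))
      obtain ⟨⟨_, g, rfl⟩, hg⟩ := MulAction.orbitRel_apply.1
        ((MulAction.orbitRel ψ.range (Fin m)).symm h)
      exact ⟨g, hg⟩
    · rintro o ⟨g, hg⟩
      rw [← Quotient.out_eq' o]
      refine Quotient.sound' (MulAction.orbitRel_apply.2 ⟨⟨_, g⁻¹, rfl⟩, ?_⟩)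
      change ψ g⁻¹ x = _
      rw [map_inv, Equiv.Perm.inv_eq_iff_eq]
      exact hg.symm

/-- Double cosets `L σ M` correspond to the orbits of `M` on the left cosets of `L`, by the map that
takes `σ` to the coset of `σ⁻¹`, whose stabilizer in `M` is `σ⁻¹ L σ ∩ M`. -/
theorem fMultiset_toCl {m : ℕ} (M L : Subgroup H) (h : L.index ≤ m)
    (σ : DoubleCoset.Quotient (L : Set H) (M : Set H) → H)
    (hσ : ∀ d, DoubleCoset.mk L M (σ d) = d) :
    (fMultiset M L h σ).map ConjLeq.toCl = restrictCl M (cls L) := by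
  let _ : Fintype (DoubleCoset.Quotient (L : Set H) (M : Set H)) :=
    @Fintype.ofFinite _ (Quotient.finite _)
  rw [restrictCl_cls, fMultiset, Multiset.map_map, otype_eq_of_section _
    (fun d : DoubleCoset.Quotient (L : Set H) (M : Set H) => (((σ d)⁻¹ : H) : H ⧸ L))]
  · refine Multiset.map_congr rfl fun d _ => ?_
    rw [Function.comp_apply, ConjLeq.toCl_mk]
    refine congrArg cls (Subgroup.ext fun g => ?_)
    rw [mem_stab, MonoidHom.comp_apply, Subgroup.coe_subtype, cosetHom_mk, eq_comm,
      QuotientGroup.eq, conjInter, Subgroup.mem_subgroupOf,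
      Subgroup.mem_pointwise_smul_iff_inv_smul_mem, ← map_inv, inv_inv, MulAut.smul_def,
      MulAut.conj_apply, mul_assoc]
  · intro x
    induction x using QuotientGroup.induction_on with
    | H a =>
      refine ⟨DoubleCoset.mk L M a⁻¹, ?_, ?_⟩
      · obtain ⟨l, hl, k, hk, he⟩ := (DoubleCoset.eq L M _ _).1 (hσ (DoubleCoset.mk L M a⁻¹))
        refine ⟨⟨k⁻¹, inv_mem hk⟩, ?_⟩
        rw [MonoidHom.comp_apply, Subgroup.coe_subtype, cosetHom_mk, QuotientGroup.eq]
        generalize σ (DoubleCoset.mk L M a⁻¹) = s at *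
        have : (k⁻¹ * s⁻¹)⁻¹ * a = l⁻¹ := by
          rw [← inv_inj, mul_inv_rev, he]; group
        rw [this]
        exact inv_mem hl
      · rintro d ⟨g, hg⟩
        rw [MonoidHom.comp_apply, Subgroup.coe_subtype, cosetHom_mk, QuotientGroup.eq] at hg
        rw [← hσ d, DoubleCoset.eq]
        refine ⟨_, inv_mem hg, (g : H)⁻¹, inv_mem g.2, ?_⟩
        group

end Actions


/-! ### Extensions up to equivalence correspond to solutions -/

section Transport

variable {H X Y : Type} [Group H]

/-- The action that is carried along a bijection. -/
def transport (e : X ≃ Y) (θ : H →* Equiv.Perm X) : H →* Equiv.Perm Y :=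
  e.permCongrHom.toMonoidHom.comp θ

theorem transport_apply (e : X ≃ Y) (θ : H →* Equiv.Perm X) (g : H) (y : Y) :
    transport e θ g y = e (θ g (e.symm y)) := rfl

theorem otype_transport [Finite X] [Finite Y] (e : X ≃ Y) (θ : H →* Equiv.Perm X) :
    otype (transport e θ) = otype θ :=
  (otype_congr e fun g x => by rw [transport_apply, e.symm_apply_apply]).symm

end Transport

namespace HomExtSym

variable (I : HomExtSym)

theorem toCl_out {H : Type} [Group H] {m : ℕ} (v : ConjLeq H m) :
    cls (Quotient.out v).1 = v.toCl := by
  conv_rhs => rw [← Quotient.out_eq v]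
  rfl

/-- The family of multisets of the subset sum instance. -/
noncomputable def family (v : ConjLeq I.G I.m) : Multiset (ConjLeq I.M I.m) := I.oms.F v

theorem F_toCl (v : ConjLeq I.G I.m) :
    (I.family v).map ConjLeq.toCl = restrictCl I.M v.toCl := by
  rw [← toCl_out]
  exact fMultiset_toCl _ _ (Quotient.out v).2 _ fun d => Quotient.out_eq d

theorem F_mk (L : Subgroup I.G) (hL : L.index ≤ I.m)
    (σ : DoubleCoset.Quotient (L : Set I.G) (I.M : Set I.G) → I.G)
    (hσ : ∀ d, DoubleCoset.mk L I.M (σ d) = d) :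
    I.family (ConjLeq.mk L hL) = fMultiset I.M L hL σ := by
  apply Multiset.map_injective ConjLeq.toCl_injective
  rw [F_toCl, fMultiset_toCl _ _ _ _ hσ]
  rfl

theorem sum_F_toCl (S : Multiset (ConjLeq I.G I.m)) :
    (S.map I.family).sum.map ConjLeq.toCl = ((S.map ConjLeq.toCl).map (restrictCl I.M)).sum := by
  induction S using Multiset.induction_on with
  | empty => rfl
  | cons v S ih =>
    rw [Multiset.map_cons, Multiset.sum_cons, Multiset.map_add, ih, F_toCl, Multiset.map_cons,
      Multiset.map_cons, Multiset.sum_cons]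

theorem K_toCl : Multiset.map ConjLeq.toCl (α := ConjLeq I.M I.m) I.oms.K = otype I.ψ :=
  orbitType_toCl I.ψ

/-- The equation of the subset sum problem says that restricting the prescribed orbits to `M` gives
the orbits of `ψ`. -/
theorem mem_SubSum_iff (S : Multiset (ConjLeq I.G I.m)) : S ∈ I.oms.SubSum ↔
    ((S.map ConjLeq.toCl).map (restrictCl I.M)).sum = otype I.ψ := by
  rw [← sum_F_toCl, ← K_toCl]
  exact (Multiset.map_injective ConjLeq.toCl_injective).eq_iff.symm

theorem comp_subtype (φ : I.Ext) : φ.1.comp I.M.subtype = I.ψ := MonoidHom.ext φ.2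

theorem orbitType_mem (φ : I.Ext) : orbitType φ.1 ∈ I.oms.SubSum := by
  rw [mem_SubSum_iff, orbitType_toCl, ← otype_restrict, comp_subtype]

/-- Extensions are equivalent if and only if they have the same stabilizer classes, because an
isomorphism between two actions on the same set is a permutation that conjugates one into the other. -/
theorem orbitType_eq_iff (φ₁ φ₂ : I.Ext) :
    orbitType φ₁.1 = orbitType φ₂.1 ↔ I.extSetoid φ₁ φ₂ := by
  rw [← (Multiset.map_injective ConjLeq.toCl_injective).eq_iff, orbitType_toCl, orbitType_toCl]
  constructor
  · intro h
    obtain ⟨e, he⟩ := exists_equiv_of_otype_eq h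
    exact ⟨e, fun g => Equiv.ext fun x => by
      rw [Equiv.Perm.mul_apply, Equiv.Perm.mul_apply, ← he, ← Equiv.Perm.mul_apply, inv_mul_cancel,
        Equiv.Perm.one_apply]⟩
  · rintro ⟨h, hh⟩
    refine otype_congr h fun g x => ?_
    rw [hh, ← Equiv.Perm.mul_apply, ← mul_assoc, mul_inv_cancel_left, Equiv.Perm.mul_apply]

/-- A solution prescribes a disjoint union of coset spaces on which `M` acts as it does by `ψ`. -/
theorem otype_restrict_sigma {J : Type} [Fintype J] {S : Multiset (ConjLeq I.G I.m)}
    (hS : S ∈ I.oms.SubSum) (L : J → Subgroup I.G)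
    (hL : S.map ConjLeq.toCl = Finset.univ.val.map fun j => cls (L j)) :
    otype ((sigmaHom fun j => cosetHom (L j)).comp I.M.subtype) = otype I.ψ := by
  rw [otype_sigma_restrict, ← (I.mem_SubSum_iff S).1 hS, hL, Multiset.map_map]
  rfl

/-- The action on the disjoint union of the coset spaces modulo the subgroups `L j`, carried to
`{0, …, m - 1}` along a bijection that is compatible with the actions of `M`. -/
def extOfEquiv {J : Type} (L : J → Subgroup I.G) (e : (Σ j, I.G ⧸ L j) ≃ Fin I.m)
    (he : ∀ (g : I.M) x, e (sigmaHom (fun j => cosetHom (L j)) g x) = I.ψ g (e x)) : I.Ext :=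
  ⟨transport e (sigmaHom fun j => cosetHom (L j)), fun g => Equiv.ext fun x => by
    rw [transport_apply, he, e.apply_symm_apply]⟩

theorem orbitType_extOfEquiv {J : Type} [Fintype J] {S : Multiset (ConjLeq I.G I.m)}
    (L : J → Subgroup I.G) (hL : S.map ConjLeq.toCl = Finset.univ.val.map fun j => cls (L j))
    (e : (Σ j, I.G ⧸ L j) ≃ Fin I.m)
    (he : ∀ (g : I.M) x, e (sigmaHom (fun j => cosetHom (L j)) g x) = I.ψ g (e x)) :
    orbitType (I.extOfEquiv L e he).1 = S := by
  apply Multiset.map_injective ConjLeq.toCl_injective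
  rw [orbitType_toCl, hL, extOfEquiv, otype_transport, otype_sigmaHom,
    Finset.sum_congr rfl fun j _ => otype_cosetHom (L j)]
  rw [← Multiset.sum_map_singleton (Multiset.map _ _), Multiset.map_map]
  rfl

theorem exists_ext {S : Multiset (ConjLeq I.G I.m)} (hS : S ∈ I.oms.SubSum) :
    ∃ φ : I.Ext, orbitType φ.1 = S := by
  induction S using Quotient.inductionOn with
  | h l =>
    let L : Fin l.length → Subgroup I.G := fun j => (Quotient.out (l.get j)).1
    have hL : (l : Multiset (ConjLeq I.G I.m)).map ConjLeq.toCl =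
        Finset.univ.val.map fun j => cls (L j) := by
      rw [Fin.univ_val_map]
      simp only [L, toCl_out]
      rw [Multiset.map_coe, Multiset.coe_eq_coe]
      have : (List.ofFn fun j => (l.get j).toCl) = l.map ConjLeq.toCl := by
        conv_rhs => rw [← List.ofFn_get l, List.map_ofFn]
        rfl
      rw [this]
    obtain ⟨e, he⟩ := exists_equiv_of_otype_eq (I.otype_restrict_sigma hS L hL)
    exact ⟨_, I.orbitType_extOfEquiv L hL e he⟩

/-- The bijection between classes of equivalent extensions and solutions. -/
noncomputable def extEquiv : Quotient I.extSetoid ≃ I.oms.SubSum :=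
  Equiv.ofBijective
    (Quotient.lift (fun φ : I.Ext => (⟨orbitType φ.1, I.orbitType_mem φ⟩ : I.oms.SubSum))
      fun φ₁ φ₂ h => Subtype.ext ((I.orbitType_eq_iff φ₁ φ₂).2 h))
    (by
      constructor
      · intro a b
        induction a using Quotient.inductionOn with | h φ₁ =>
        induction b using Quotient.inductionOn with | h φ₂ =>
        intro h
        exact Quotient.sound ((I.orbitType_eq_iff φ₁ φ₂).1 (congrArg Subtype.val h))
      · rintro ⟨S, hS⟩
        obtain ⟨φ, hφ⟩ := I.exists_ext hS
        exact ⟨Quotient.mk _ φ, Subtype.ext hφ⟩)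

theorem extEquiv_mk (φ : I.Ext) : (I.extEquiv (Quotient.mk _ φ)).1 = orbitType φ.1 := rfl

end HomExtSym


/-! ### Subgroups of permutation groups -/

section PermGroup

variable {n : ℕ} {H : Type} [Group H] (ι : H →* Equiv.Perm (Fin n)) {k : ℕ}

/-- Membership of `h` in the group generated by `w`, where `H` is a permutation group by the
embedding `ι`. -/
def groupMem (w : List H) (h : H) : Bool := siftMem (strongGens (w.map ι)) (ι h)

open Classical in
/-- A word of length `2 * n` whose letters generate the same group as `gens`. -/
noncomputable def groupWord (gens : List H) (j : Fin (2 * n)) : H :=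
  if h : ∃ a, ι a = reduceWord (strongGens (gens.map ι)) j then h.choose else 1

theorem closure_map_list (w : List H) :
    Subgroup.closure {t | t ∈ w.map ι} = (Subgroup.closure {a | a ∈ w}).map ι := by
  rw [MonoidHom.map_closure]
  congr 1
  ext t
  change t ∈ w.map ι ↔ ∃ a, a ∈ w ∧ ι a = t
  simp

variable {ι}

theorem groupMem_iff (hι : Function.Injective ι) {w : List H} {h : H} :
    groupMem ι w h = true ↔ h ∈ Subgroup.closure {a | a ∈ w} := by
  rw [groupMem, siftMem_strongGens, closure_map_list]
  exact Subgroup.mem_map_iff_mem hι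

/-- The letters of the reduced word lie in the image of `ι`, so the definition of `groupWord` does
not fall back on the identity. -/
theorem map_groupWord (gens : List H) (j : Fin (2 * n)) :
    ι (groupWord ι gens j) = reduceWord (strongGens (gens.map ι)) j := by
  have h : ∃ a, ι a = reduceWord (strongGens (gens.map ι)) j := by
    have h1 : reduceWord (strongGens (gens.map ι)) j ∈ Subgroup.closure {t | t ∈ gens.map ι} := by
      rw [← closure_reduceWord]
      exact Subgroup.subset_closure ⟨j, rfl⟩
    rw [closure_map_list] at h1
    obtain ⟨a, -, ha⟩ := h1
    exact ⟨a, ha⟩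
  rw [groupWord, dif_pos h]
  exact h.choose_spec

theorem closure_groupWord (hι : Function.Injective ι) (gens : List H) :
    Subgroup.closure (Set.range (groupWord ι gens)) = Subgroup.closure {a | a ∈ gens} := by
  apply Subgroup.map_injective hι
  rw [← closure_map_list, ← closure_reduceWord, MonoidHom.map_closure, ← Set.range_comp]
  congr 2
  funext j
  exact map_groupWord gens j

/-! ### The orbits of an action that is given by generators -/

variable (θ : H →* Equiv.Perm (Fin k)) (gens : List H)

/-- Does `h` fix the point `x`? -/
def fixes (x : Fin k) (h : H) : Bool := decide (θ h x = x)

/-- Representatives of the cosets of the stabilizer of `x`. -/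
def stabTransversal (x : Fin k) : List H := transversal gens (fixes θ x) k

/-- The orbit of `x`. -/
def orbitList (x : Fin k) : List (Fin k) := (stabTransversal θ gens x).map fun u => θ u x

/-- Is `x` the least point of its orbit? -/
def isOrbitMin (x : Fin k) : Bool :=
  (List.range x).all fun v => (orbitList θ gens x).all fun y => decide (¬ (y : ℕ) = v)

/-- The least points of the orbits. -/
def orbitReps : List (Fin k) := (List.finRange k).filter (isOrbitMin θ gens)

/-- A word whose letters generate the stabilizer of `x`. -/
noncomputable def stabWord (ι : H →* Equiv.Perm (Fin n)) (x : Fin k) : Fin (2 * n) → H :=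
  groupWord ι (schreier gens (stabTransversal θ gens x) (fixes θ x))

/-- The elements of a list, without repetitions. -/
def distinct {α : Type} [DecidableEq α] (l : List α) : List α :=
  l.foldl (fun s a => if s.any (fun b => decide (b = a)) = true then s else a :: s) []

/-- The elements of a list with their multiplicities. -/
def collate {α : Type} [DecidableEq α] (l : List α) : List (α × ℕ) :=
  (distinct l).map fun a => (a, (l.filter fun b => decide (b = a)).length)

open Classical in
/-- A representation of the multiset of the classes of point stabilizers. -/
noncomputable def orbitMultiset (ι : H →* Equiv.Perm (Fin n)) : List ((Fin (2 * n) → H) × ℕ) :=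
  collate ((orbitReps θ gens).map (stabWord θ gens ι))

section Collate

variable {α β : Type} [DecidableEq α] (l : List α)

theorem distinct_spec : (distinct l).Nodup ∧ ∀ a, a ∈ distinct l ↔ a ∈ l := by
  induction l using List.reverseRecOn with
  | nil => simp [distinct]
  | append_singleton l a ih =>
    obtain ⟨h1, h2⟩ := ih
    have : distinct (l ++ [a]) = if (distinct l).any (fun b => decide (b = a)) = true then
        distinct l else a :: distinct l := by
      rw [distinct, List.foldl_append]; rfl
    rw [this]
    split_ifs with h
    · refine ⟨h1, fun b => ?_⟩
      have : a ∈ l := by simpa [h2] using h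
      rw [h2, List.mem_append, List.mem_singleton]
      exact ⟨Or.inl, fun h => h.elim id fun h => h ▸ this⟩
    · have : a ∉ l := by simpa [h2] using h
      exact ⟨List.nodup_cons.2 ⟨by rwa [h2], h1⟩, fun b => by simp [h2, or_comm]⟩

theorem nodup_collate : ((collate l).map Prod.fst).Nodup := by
  rw [collate, List.map_map]
  simpa [Function.comp_def] using (distinct_spec l).1

theorem collate_pos : ∀ p ∈ collate l, 0 < p.2 := by
  intro p hp
  obtain ⟨a, ha, rfl⟩ := List.mem_map.1 hp
  rw [(distinct_spec l).2] at ha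
  exact List.length_pos_of_mem (List.mem_filter.2 ⟨ha, by simp⟩)

theorem sum_collate (f : α → β) :
    ((collate l).map fun p => Multiset.replicate p.2 (f p.1)).sum = (l : Multiset α).map f := by
  have h1 : ((collate l).map fun p => Multiset.replicate p.2 p.1).sum = (l : Multiset α) := by
    have h2 : (distinct l).toFinset = (l : Multiset α).toFinset := by
      ext a; simp [(distinct_spec l).2]
    rw [← Multiset.toFinset_sum_count_nsmul_eq (l : Multiset α), ← h2,
      List.sum_toFinset _ (distinct_spec l).1, collate, List.map_map]
    congr 1
    refine List.map_congr_left fun a _ => ?_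
    rw [Function.comp_apply, Multiset.nsmul_singleton, Multiset.coe_count, List.count_eq_length_filter]
    rfl
  conv_rhs => rw [← h1]
  generalize collate l = c
  induction c with
  | nil => rfl
  | cons p c ih => simp [ih]

end Collate

variable {θ gens}

theorem fixes_iff {x : Fin k} (h : H) : fixes θ x h = true ↔ h ∈ stab θ x := by
  rw [fixes, decide_eq_true_iff, mem_stab]

variable [Finite H] (hg : Subgroup.closure {a | a ∈ gens} = ⊤)

theorem relIndex_stab_le (x : Fin k) (L : Subgroup H) : (stab θ x).relIndex L ≤ k := by
  refine (Subgroup.relIndex_le_of_le_right le_top ?_).trans ?_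
  · rw [Subgroup.relIndex_top_right]; exact Subgroup.index_ne_zero_of_finite
  · rw [Subgroup.relIndex_top_right]; exact index_pointStab_le θ x

include hg

theorem mem_orbitList {x y : Fin k} : y ∈ orbitList θ gens x ↔ ∃ h, θ h x = y := by
  rw [orbitList, List.mem_map]
  refine ⟨fun ⟨u, _, hu⟩ => ⟨u, hu⟩, fun ⟨h, hh⟩ => ?_⟩
  obtain ⟨u, hu, hK⟩ := transversal_cover fixes_iff (relIndex_stab_le (θ := θ) x _) h
    (hg ▸ Subgroup.mem_top h)
  refine ⟨u, hu, ?_⟩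
  rw [mem_stab, map_mul, Equiv.Perm.mul_apply, map_inv, Equiv.Perm.inv_eq_iff_eq] at hK
  rw [← hK, hh]

theorem closure_stabWord (hι : Function.Injective ι) (x : Fin k) :
    Subgroup.closure (Set.range (stabWord θ gens ι x)) = stab θ x := by
  rw [stabWord, closure_groupWord hι, stabTransversal,
    closure_schreier fixes_iff (relIndex_stab_le (θ := θ) x _), hg, top_inf_eq]

theorem isOrbitMin_iff {x : Fin k} : isOrbitMin θ gens x = true ↔ ∀ h, x ≤ θ h x := by
  simp only [isOrbitMin, List.all_eq_true, List.mem_range, decide_eq_true_eq]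
  constructor
  · intro h g
    by_contra hlt
    push Not at hlt
    exact h (θ g x) hlt (θ g x) ((mem_orbitList hg).2 ⟨g, rfl⟩) rfl
  · rintro h v hv y hy rfl
    obtain ⟨g, rfl⟩ := (mem_orbitList hg).1 hy
    exact absurd (h g) (not_le.2 hv)

theorem otype_eq_orbitReps :
    otype θ = ((orbitReps θ gens).map fun x => cls (stab θ x) : List (ConjCl H)) := by
  rw [otype_eq_of_section θ fun j : Fin (orbitReps θ gens).length => (orbitReps θ gens).get j,
    Fin.univ_val_map]
  · congr 1
    conv_rhs => rw [← List.ofFn_get (orbitReps θ gens), List.map_ofFn]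
    rfl
  · have hex : ∀ x : Fin k, ∃ y ∈ orbitReps θ gens, ∃ g, θ g y = x := by
      intro x
      induction x using WellFoundedLT.induction with
      | ind x ih =>
        by_cases hx : isOrbitMin θ gens x = true
        · exact ⟨x, List.mem_filter.2 ⟨List.mem_finRange x, hx⟩, 1, by simp⟩
        · rw [isOrbitMin_iff hg] at hx
          push Not at hx
          obtain ⟨h, hlt⟩ := hx
          obtain ⟨y, hy, g, hgy⟩ := ih _ hlt
          refine ⟨y, hy, h⁻¹ * g, ?_⟩
          rw [map_mul, Equiv.Perm.mul_apply, hgy, map_inv, ← Equiv.Perm.mul_apply, inv_mul_cancel]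
          rfl
    intro x
    obtain ⟨y, hy, g, hgy⟩ := hex x
    obtain ⟨j, rfl⟩ := List.get_of_mem hy
    refine ⟨j, ⟨g, hgy⟩, ?_⟩
    rintro i ⟨g', hg'⟩
    have hnd : (orbitReps θ gens).Nodup := (List.nodup_finRange k).filter _
    apply List.nodup_iff_injective_get.1 hnd
    have hmin : ∀ i, ∀ h, (orbitReps θ gens).get i ≤ θ h ((orbitReps θ gens).get i) :=
      fun i => (isOrbitMin_iff hg).1 (List.mem_filter.1 (List.get_mem (orbitReps θ gens) i)).2
    have h1 := hmin i (g⁻¹ * g')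
    have h2 := hmin j (g'⁻¹ * g)
    rw [map_mul, Equiv.Perm.mul_apply, hg', ← hgy, ← Equiv.Perm.mul_apply, ← map_mul,
      inv_mul_cancel, map_one, Equiv.Perm.one_apply] at h1
    rw [map_mul, Equiv.Perm.mul_apply, hgy, ← hg', ← Equiv.Perm.mul_apply, ← map_mul,
      inv_mul_cancel, map_one, Equiv.Perm.one_apply] at h2
    exact le_antisymm h1 h2

theorem represents_orbitMultiset (hι : Function.Injective ι) {m : ℕ} (hk : k ≤ m)
    {S : Multiset (ConjLeq H m)} (hS : S.map ConjLeq.toCl = otype θ) :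
    Represents (HomExtSym.decWord m) (orbitMultiset θ gens ι) S := by
  classical
  refine ⟨?_, ?_, ?_⟩
  · exact nodup_collate _
  · exact collate_pos _
  · have hidx : ∀ x, (stab θ x).index ≤ m := fun x => (index_pointStab_le θ x).trans hk
    have h1 : S = ((orbitReps θ gens).map fun x => ConjLeq.mk (stab θ x) (hidx x) :
        List (ConjLeq H m)) := by
      apply Multiset.map_injective ConjLeq.toCl_injective
      rw [hS, otype_eq_orbitReps hg, Multiset.map_coe, List.map_map]
      rfl
    rw [orbitMultiset, sum_collate, Multiset.map_coe, h1, Multiset.map_coe, List.map_map,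
      List.map_map]
    congr 1
    refine List.map_congr_left fun x _ => ?_
    have h2 := closure_stabWord (θ := θ) hg hι x
    rw [Function.comp_apply, Function.comp_apply, HomExtSym.decWord]
    simp only [h2]
    rw [dif_pos (hidx x)]

/-! ### Conjugacy of subgroups -/

omit hg in
/-- Are the groups generated by `w` and `w'` conjugate in the group generated by `gens`? Here `m` is
a bound for the index of the first of them. -/
def conjTest (ι : H →* Equiv.Perm (Fin n)) (gens : List H) (m : ℕ) (w w' : List H) : Bool :=
  (transversal gens (groupMem ι w) m).any fun r =>
    (w'.all fun a => groupMem ι w (r⁻¹ * (a * r))) && (w.all fun a => groupMem ι w' (r * (a * r⁻¹)))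

/-- It suffices to test a transversal, because conjugation by an element of a subgroup preserves the
subgroup. The inclusions in both directions make the test independent of the orders of the groups. -/
theorem conjTest_iff (hι : Function.Injective ι) {m : ℕ} {w w' : List H}
    (hm : (Subgroup.closure {a | a ∈ w}).index ≤ m) : conjTest ι gens m w w' = true ↔
      cls (Subgroup.closure {a | a ∈ w}) = cls (Subgroup.closure {a | a ∈ w'}) := by
  have hall : ∀ (L : Subgroup H) (w : List H) (r : H), (∀ a ∈ w, r * (a * r⁻¹) ∈ L) ↔
      ∀ a ∈ Subgroup.closure {a | a ∈ w}, r * (a * r⁻¹) ∈ L := by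
    intro L w r
    refine ⟨fun h a ha => ?_, fun h a ha => h a (Subgroup.subset_closure ha)⟩
    have : Subgroup.closure {a | a ∈ w} ≤ L.comap (MulAut.conj r).toMonoidHom := by
      rw [Subgroup.closure_le]
      intro a ha
      have := h a ha
      simpa [mul_assoc] using this
    simpa [mul_assoc] using this ha
  have hall' : ∀ r, (∀ a ∈ w', r⁻¹ * (a * r) ∈ Subgroup.closure {a | a ∈ w}) ↔
      ∀ a ∈ Subgroup.closure {a | a ∈ w'}, r⁻¹ * (a * r) ∈ Subgroup.closure {a | a ∈ w} := by
    intro r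
    simpa using hall (Subgroup.closure {a | a ∈ w}) w' r⁻¹
  simp only [conjTest, List.any_eq_true, Bool.and_eq_true, List.all_eq_true, groupMem_iff hι, hall,
    hall']
  rw [cls_eq_iff]
  constructor
  · rintro ⟨r, -, h1, h2⟩
    refine ⟨r⁻¹, fun x => ⟨fun hx => ?_, fun hx => ?_⟩⟩
    · simpa [mul_assoc] using h2 x hx
    · simpa [mul_assoc] using h1 _ hx
  · rintro ⟨g, hgx⟩
    obtain ⟨r, hr, hrg⟩ := transversal_cover (fun h => groupMem_iff (w := w) hι) (N := m)
      (by rw [hg, Subgroup.relIndex_top_right]; exact hm) g⁻¹ (hg ▸ Subgroup.mem_top _)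
    have hconj : ∀ x l : H, l ∈ Subgroup.closure {a | a ∈ w} →
        (l * x * l⁻¹ ∈ Subgroup.closure {a | a ∈ w} ↔ x ∈ Subgroup.closure {a | a ∈ w}) := by
      intro x l hl
      rw [Subgroup.mul_mem_cancel_right _ (inv_mem hl), Subgroup.mul_mem_cancel_left _ hl]
    refine ⟨r, hr, fun a ha => ?_, fun a ha => ?_⟩
    · have h3 := (hgx (g * a * g⁻¹)).2 (by simpa [mul_assoc] using ha)
      have h4 := (hconj _ _ hrg).2 h3
      simpa [mul_assoc] using h4
    · have h3 := (hgx _).1 ((hconj a _ (inv_mem hrg)).2 ha)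
      simpa [mul_assoc] using h3

end PermGroup


/-! ### The action on a disjoint union of coset spaces -/

section Cosets

variable {n : ℕ} {H : Type} [Group H] (ι : H →* Equiv.Perm (Fin n)) (gens : List H) (m : ℕ)
  (ws : List (List H))

/-- The subgroup that is generated by the word `ws.get c`. -/
def block (c : Fin ws.length) : Subgroup H := Subgroup.closure {a | a ∈ ws.get c}

/-- The coset that is named by a pair. -/
def toCoset (p : Fin ws.length × H) : Σ c, H ⧸ block ws c := ⟨p.1, p.2⟩

/-- Names of the cosets of all the subgroups that are generated by the words. -/
def cosetPoints : List (Fin ws.length × H) :=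
  (List.finRange ws.length).flatMap fun c =>
    (transversal gens (groupMem ι (ws.get c)) m).map fun r => (c, r)

/-- Do two pairs name the same coset? -/
def sameCoset (q p : Fin ws.length × H) : Bool :=
  decide (q.1 = p.1) && groupMem ι (ws.get q.1) (q.2⁻¹ * p.2)

/-- The position of a coset in the list of names. -/
def cosetIdx (p : Fin ws.length × H) : ℕ :=
  (cosetPoints ι gens m ws).findIdx fun q => sameCoset ι ws q p

variable {ι gens m ws}

theorem sameCoset_iff (hι : Function.Injective ι) {q p : Fin ws.length × H} :
    sameCoset ι ws q p = true ↔ toCoset ws q = toCoset ws p := by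
  obtain ⟨c, a⟩ := q
  obtain ⟨d, b⟩ := p
  rw [sameCoset, Bool.and_eq_true, decide_eq_true_iff, groupMem_iff hι]
  constructor
  · rintro ⟨h1, h2⟩
    dsimp only at h1 h2
    subst h1
    exact congrArg (Sigma.mk c) (QuotientGroup.eq.2 h2)
  · intro h
    obtain rfl : c = d := congrArg Sigma.fst h
    exact ⟨rfl, QuotientGroup.eq.1 (eq_of_heq (Sigma.mk.inj h).2)⟩

variable [Finite H] (hg : Subgroup.closure {a | a ∈ gens} = ⊤) (hι : Function.Injective ι)
  (hm : ∀ c, (block ws c).index ≤ m)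

theorem toCoset_bijective (hg : Subgroup.closure {a | a ∈ gens} = ⊤) (hι : Function.Injective ι)
    (hm : ∀ c, (block ws c).index ≤ m) :
    Function.Bijective fun i => toCoset ws ((cosetPoints ι gens m ws).get i) := by
  constructor
  · have hnd : ((cosetPoints ι gens m ws).map (toCoset ws)).Nodup := by
      rw [List.nodup_iff_pairwise_ne, List.pairwise_map, cosetPoints, List.pairwise_flatMap]
      constructor
      · intro c _
        rw [List.pairwise_map]
        have := (transversal_invariant (gens := gens) (N := m)
          fun h => groupMem_iff (w := ws.get c) (h := h) hι).2
        refine this.imp fun {u v} h he => h ?_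
        exact QuotientGroup.eq.1 (eq_of_heq (Sigma.mk.inj he).2).symm
      · refine (List.nodup_finRange _).imp fun {c d} hcd p hp q hq he => hcd ?_
        obtain ⟨r, -, rfl⟩ := List.mem_map.1 hp
        obtain ⟨s, -, rfl⟩ := List.mem_map.1 hq
        exact congrArg Sigma.fst he
    intro i j hij
    rw [List.nodup_iff_injective_get] at hnd
    have := @hnd ⟨i, by simp⟩ ⟨j, by simp⟩ (by simpa using hij)
    exact Fin.ext (Fin.mk.inj_iff.1 this)
  · rintro ⟨c, x⟩
    induction x using QuotientGroup.induction_on with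
    | H a =>
      obtain ⟨v, hv, hK⟩ := transversal_cover (K := block ws c) (gens := gens) (N := m)
        (fun h => groupMem_iff (w := ws.get c) hι)
        (by rw [hg, Subgroup.relIndex_top_right]; exact hm c) a (hg ▸ Subgroup.mem_top _)
      obtain ⟨i, hi⟩ := List.get_of_mem (l := cosetPoints ι gens m ws) (a := (c, v))
        (List.mem_flatMap.2 ⟨c, List.mem_finRange c, List.mem_map.2 ⟨v, hv, rfl⟩⟩)
      refine ⟨i, ?_⟩
      dsimp only
      rw [hi]
      exact congrArg (Sigma.mk c) (QuotientGroup.eq.2 hK)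

/-- The numbering of the cosets by the list of their names. -/
noncomputable def cosetEquiv (hg : Subgroup.closure {a | a ∈ gens} = ⊤)
    (hι : Function.Injective ι) (hm : ∀ c, (block ws c).index ≤ m) :
    Fin (cosetPoints ι gens m ws).length ≃ Σ c, H ⧸ block ws c :=
  Equiv.ofBijective _ (toCoset_bijective hg hι hm)

/-- The action on the numbers of the cosets. -/
noncomputable def cosetAct (hg : Subgroup.closure {a | a ∈ gens} = ⊤)
    (hι : Function.Injective ι) (hm : ∀ c, (block ws c).index ≤ m) :
    H →* Equiv.Perm (Fin (cosetPoints ι gens m ws).length) :=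
  transport (cosetEquiv hg hι hm).symm (sigmaHom fun c => cosetHom (block ws c))

theorem cosetAct_apply (g : H) (i : Fin (cosetPoints ι gens m ws).length) :
    (cosetAct hg hι hm g i : ℕ) = cosetIdx ι gens m ws
      (((cosetPoints ι gens m ws).get i).1, g * ((cosetPoints ι gens m ws).get i).2) := by
  set p : Fin ws.length × H :=
    (((cosetPoints ι gens m ws).get i).1, g * ((cosetPoints ι gens m ws).get i).2)
  have h1 : cosetEquiv hg hι hm (cosetAct hg hι hm g i) = toCoset ws p := by
    rw [cosetAct, transport_apply, Equiv.apply_symm_apply]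
    rfl
  symm
  rw [cosetIdx, List.findIdx_eq (Fin.is_lt _)]
  refine ⟨(sameCoset_iff hι).2 h1, fun j hj => ?_⟩
  rw [← Bool.not_eq_true, sameCoset_iff hι, ← h1]
  intro h
  have h2 := (cosetEquiv hg hι hm).injective (a₁ := ⟨j, hj.trans (Fin.is_lt _)⟩) h
  have h3 := congrArg Fin.val h2
  dsimp only at h3
  omega

end Cosets

/-! ### Isomorphisms of actions -/

section Matching

variable {m k : ℕ} {H : Type} [Group H] (θ : H →* Equiv.Perm (Fin m)) (η : H →* Equiv.Perm (Fin k))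
  (gens : List H)

/-- Does `h` fix the points `x` and `y`? -/
def fixesPair (x : Fin m) (y : Fin k) (h : H) : Bool := decide (θ h x = x) && decide (η h y = y)

/-- The orbit of the pair `(x, y)`. -/
def pairOrbit (x : Fin m) (y : Fin k) : List (Fin m × Fin k) :=
  (transversal gens (fixesPair θ η x y) (m * k)).map fun u => (θ u x, η u y)

/-- Is the orbit of the pair `(x, y)` the graph of a bijection between the orbits of `x` and
of `y`? -/
def compatible (x : Fin m) (y : Fin k) : Bool :=
  (pairOrbit θ η gens x y).all fun p => (pairOrbit θ η gens x y).all fun q =>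
    decide (p.1 = q.1) == decide (p.2 = q.2)

/-- Add the orbit of a pair, if this is possible. -/
def matchStep (R : List (Fin m × Fin k)) (p : Fin m × Fin k) : List (Fin m × Fin k) :=
  if (R.any fun q => decide (q.1 = p.1) || decide (q.2 = p.2)) = true then R
  else if compatible θ η gens p.1 p.2 = true then pairOrbit θ η gens p.1 p.2 ++ R else R

/-- The graph of a partial isomorphism between two actions that is maximal: it is built greedily from
the orbits of pairs of points with the same stabilizer. -/
def matching : List (Fin m × Fin k) :=
  ((List.finRange m).flatMap fun x => (List.finRange k).map fun y => (x, y)).foldl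
    (matchStep θ η gens) []

variable {θ η gens}

theorem fixesPair_iff {x : Fin m} {y : Fin k} (h : H) :
    fixesPair θ η x y h = true ↔ h ∈ stab θ x ⊓ stab η y := by
  rw [fixesPair, Bool.and_eq_true, decide_eq_true_iff, decide_eq_true_iff, Subgroup.mem_inf,
    mem_stab, mem_stab]

theorem apply_eq_apply_iff {X : Type} (θ : H →* Equiv.Perm X) {g h : H} {x : X} :
    θ g x = θ h x ↔ θ (h⁻¹ * g) x = x := by
  rw [map_mul, Equiv.Perm.mul_apply, map_inv, Equiv.Perm.inv_eq_iff_eq]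

theorem subset_foldl_matchStep (l R : List (Fin m × Fin k)) :
    R ⊆ l.foldl (matchStep θ η gens) R := by
  refine foldl_invariant (Inv := fun s => R ⊆ s) (List.Subset.refl R) fun s p _ hs => ?_
  unfold matchStep
  split_ifs
  · exact hs
  · exact fun q hq => List.mem_append_right _ (hs hq)
  · exact hs

variable [Finite H]

theorem relIndex_stab_inf_le (x : Fin m) (y : Fin k) (L : Subgroup H) :
    (stab θ x ⊓ stab η y).relIndex L ≤ m * k :=
  Subgroup.relIndex_inf_le.trans (Nat.mul_le_mul (relIndex_stab_le x L) (relIndex_stab_le y L))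

theorem length_pairOrbit_le (x : Fin m) (y : Fin k) :
    (pairOrbit θ η gens x y).length ≤ m * k := by
  rw [pairOrbit, List.length_map]
  obtain ⟨h1, h2⟩ := transversal_invariant (gens := gens) (N := m * k)
    (fixesPair_iff (θ := θ) (η := η) (x := x) (y := y))
  exact (length_le_relIndex h1 h2).trans (relIndex_stab_inf_le x y _)

theorem mem_pairOrbit (hg : Subgroup.closure {a | a ∈ gens} = ⊤) {x : Fin m} {y : Fin k}
    {p : Fin m × Fin k} : p ∈ pairOrbit θ η gens x y ↔ ∃ h, θ h x = p.1 ∧ η h y = p.2 := by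
  rw [pairOrbit, List.mem_map]
  constructor
  · rintro ⟨u, _, rfl⟩
    exact ⟨u, rfl, rfl⟩
  · rintro ⟨h, h1, h2⟩
    obtain ⟨u, hu, hK⟩ := transversal_cover (fixesPair_iff (θ := θ) (η := η) (x := x) (y := y))
      (relIndex_stab_inf_le x y _) h (hg ▸ Subgroup.mem_top h)
    refine ⟨u, hu, ?_⟩
    rw [Subgroup.mem_inf, mem_stab, mem_stab, map_mul, Equiv.Perm.mul_apply, map_inv,
      Equiv.Perm.inv_eq_iff_eq, map_mul, Equiv.Perm.mul_apply, map_inv,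
      Equiv.Perm.inv_eq_iff_eq] at hK
    rw [← hK.1, ← hK.2, h1, h2]

/-- Compatible points are those with the same stabilizer. -/
theorem compatible_iff (hg : Subgroup.closure {a | a ∈ gens} = ⊤) {x : Fin m} {y : Fin k} :
    compatible θ η gens x y = true ↔ ∀ h, θ h x = x ↔ η h y = y := by
  simp only [compatible, List.all_eq_true, beq_iff_eq, decide_eq_decide]
  constructor
  · intro h g
    have h1 := h (θ g x, η g y) ((mem_pairOrbit hg).2 ⟨g, rfl, rfl⟩) (x, y)
      ((mem_pairOrbit hg).2 ⟨1, by simp, by simp⟩)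
    exact h1
  · intro h p hp q hq
    obtain ⟨g, hg1, hg2⟩ := (mem_pairOrbit hg).1 hp
    obtain ⟨g', hg1', hg2'⟩ := (mem_pairOrbit hg).1 hq
    rw [← hg1, ← hg2, ← hg1', ← hg2', apply_eq_apply_iff, apply_eq_apply_iff]
    exact h _

/-- The invariant of `matchStep`: the pairs form the graph of an isomorphism between unions of
orbits. -/
def IsPartialIso (θ : H →* Equiv.Perm (Fin m)) (η : H →* Equiv.Perm (Fin k))
    (R : List (Fin m × Fin k)) : Prop :=
  (∀ p ∈ R, ∀ q ∈ R, p.1 = q.1 ↔ p.2 = q.2) ∧ ∀ h, ∀ p ∈ R, (θ h p.1, η h p.2) ∈ R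

theorem IsPartialIso.matchStep (hg : Subgroup.closure {a | a ∈ gens} = ⊤)
    {R : List (Fin m × Fin k)} (hR : IsPartialIso θ η R) (p : Fin m × Fin k) :
    IsPartialIso θ η (matchStep θ η gens R p) := by
  unfold HomExt.matchStep
  split_ifs with h1 h2
  · exact hR
  · rw [compatible_iff hg] at h2
    simp only [List.any_eq_true, Bool.or_eq_true, decide_eq_true_eq, not_exists, not_and,
      not_or] at h1
    have hcross : ∀ q ∈ pairOrbit θ η gens p.1 p.2, ∀ r ∈ R, q.1 ≠ r.1 ∧ q.2 ≠ r.2 := by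
      intro q hq r hr
      obtain ⟨g, hg1, hg2⟩ := (mem_pairOrbit hg).1 hq
      have h3 := h1 _ (hR.2 g⁻¹ r hr)
      dsimp only at h3
      rw [map_inv, map_inv, Equiv.Perm.inv_eq_iff_eq, Equiv.Perm.inv_eq_iff_eq, hg1, hg2] at h3
      exact ⟨fun h => h3.1 h.symm, fun h => h3.2 h.symm⟩
    constructor
    · intro q hq r hr
      rcases List.mem_append.1 hq with hq | hq <;> rcases List.mem_append.1 hr with hr | hr
      · obtain ⟨g, hg1, hg2⟩ := (mem_pairOrbit hg).1 hq
        obtain ⟨g', hg1', hg2'⟩ := (mem_pairOrbit hg).1 hr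
        rw [← hg1, ← hg2, ← hg1', ← hg2', apply_eq_apply_iff, apply_eq_apply_iff]
        exact h2 _
      · have := hcross q hq r hr
        exact iff_of_false this.1 this.2
      · have := hcross r hr q hq
        exact iff_of_false (fun h => this.1 h.symm) (fun h => this.2 h.symm)
      · exact hR.1 q hq r hr
    · intro h q hq
      rcases List.mem_append.1 hq with hq | hq
      · obtain ⟨g, hg1, hg2⟩ := (mem_pairOrbit hg).1 hq
        exact List.mem_append_left _ ((mem_pairOrbit hg).2 ⟨h * g, by
          rw [map_mul, Equiv.Perm.mul_apply, hg1], by rw [map_mul, Equiv.Perm.mul_apply, hg2]⟩)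
      · exact List.mem_append_right _ (hR.2 h q hq)
  · exact hR

/-- If `x` and `y` have the same stabilizer then one of them is matched in the end. -/
theorem foldl_matchStep_maximal (hg : Subgroup.closure {a | a ∈ gens} = ⊤)
    (l R : List (Fin m × Fin k)) {p : Fin m × Fin k} (hp : p ∈ l)
    (hc : compatible θ η gens p.1 p.2 = true) :
    ∃ q ∈ l.foldl (matchStep θ η gens) R, q.1 = p.1 ∨ q.2 = p.2 := by
  induction l generalizing R with
  | nil => simp at hp
  | cons a l ih =>
    rw [List.foldl_cons]
    rcases List.mem_cons.1 hp with rfl | hp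
    · suffices H : ∃ q ∈ matchStep θ η gens R p, q.1 = p.1 ∨ q.2 = p.2 by
        obtain ⟨q, hq, h⟩ := H
        exact ⟨q, subset_foldl_matchStep _ _ hq, h⟩
      unfold matchStep
      split_ifs with h1
      · simpa using h1
      · exact ⟨p, List.mem_append_left _ ((mem_pairOrbit hg).2 ⟨1, by simp, by simp⟩), Or.inl rfl⟩
    · exact ih _ hp

/-- If the actions are isomorphic then the maximal partial isomorphism is defined everywhere. Were
`x` not in its domain, then all points with the same stabilizer as `x` would be in its image; but
composed with the given isomorphism its inverse maps these points injectively, hence surjectively, to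
themselves. -/
theorem matching_spec (hg : Subgroup.closure {a | a ∈ gens} = ⊤) (e₀ : Fin m ≃ Fin k)
    (he₀ : ∀ h x, e₀ (θ h x) = η h (e₀ x)) : ∃ e : Fin m ≃ Fin k,
      (∀ h x, e (θ h x) = η h (e x)) ∧ ∀ x y, (x, y) ∈ matching θ η gens ↔ e x = y := by
  have hR : IsPartialIso θ η (matching θ η gens) :=
    foldl_invariant (Inv := IsPartialIso θ η) ⟨by simp, by simp⟩ fun _ p _ hs => hs.matchStep hg p
  have hmax : ∀ x y, (∀ h, θ h x = x ↔ η h y = y) →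
      ∃ q ∈ matching θ η gens, q.1 = x ∨ q.2 = y := fun x y h =>
    foldl_matchStep_maximal hg _ _ (p := (x, y))
      (List.mem_flatMap.2 ⟨x, List.mem_finRange x, List.mem_map.2 ⟨y, List.mem_finRange y, rfl⟩⟩)
      ((compatible_iff hg).2 h)
  generalize matching θ η gens = R at hR hmax ⊢
  have hdom : ∀ x, ∃ y, (x, y) ∈ R := by
    intro x
    by_contra hx
    push Not at hx
    let B := {y : Fin k // ∀ h, θ h x = x ↔ η h y = y}
    have h1 : ∀ y : B, ∃ z, (z, y.1) ∈ R := by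
      intro y
      obtain ⟨⟨z, w⟩, hq, rfl | hw⟩ := hmax x y.1 y.2
      · exact absurd hq (hx w)
      · exact ⟨z, hw ▸ hq⟩
    choose f hf using h1
    have hstab : ∀ y : B, ∀ h, θ h (f y) = f y ↔ η h y.1 = y.1 :=
      fun y h => hR.1 _ (hR.2 h _ (hf y)) _ (hf y)
    have he : ∀ z h, θ h z = z ↔ η h (e₀ z) = e₀ z :=
      fun z h => by rw [← he₀, e₀.apply_eq_iff_eq]
    let F : B → B := fun y => ⟨e₀ (f y), fun h => by rw [← he, hstab, y.2]⟩
    have hF : Function.Injective F := by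
      intro y y' hyy
      have h2 : f y = f y' := e₀.injective (congrArg Subtype.val hyy)
      exact Subtype.ext ((hR.1 _ (hf y) _ (hf y')).1 h2)
    obtain ⟨y, hy⟩ := Finite.surjective_of_injective hF ⟨e₀ x, he x⟩
    have h2 : f y = x := e₀.injective (congrArg Subtype.val hy)
    have h3 := hf y
    rw [h2] at h3
    exact hx y.1 h3
  choose f hf using hdom
  have hinj : Function.Injective f := fun x x' h => (hR.1 _ (hf x) _ (hf x')).2 h
  have hbij : Function.Bijective f :=
    (Fintype.bijective_iff_injective_and_card f).2 ⟨hinj, Fintype.card_congr e₀⟩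
  refine ⟨Equiv.ofBijective f hbij, fun h x => ?_, fun x y => ⟨fun h => ?_, fun h => ?_⟩⟩
  · exact (hR.1 _ (hf _) _ (hR.2 h _ (hf x))).1 rfl
  · exact (hR.1 _ (hf x) _ h).1 rfl
  · exact h ▸ hf x

/-- Look up the value at `v` in a list of pairs. -/
def lookupFst {m k : ℕ} (R : List (Fin m × Fin k)) (v : ℕ) : ℕ :=
  ((R.filter fun q => decide ((q.1 : ℕ) = v)).map fun q => (q.2 : ℕ)).headD 0

/-- Look up the preimage of `v` in a list of pairs. -/
def lookupSnd {m k : ℕ} (R : List (Fin m × Fin k)) (v : ℕ) : ℕ :=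
  ((R.filter fun q => decide ((q.2 : ℕ) = v)).map fun q => (q.1 : ℕ)).headD 0

theorem headD_map_filter {α : Type} {R : List α} {p : α → Bool} {f : α → ℕ} {v : ℕ}
    (h1 : ∃ q ∈ R, p q = true) (h2 : ∀ q ∈ R, p q = true → f q = v) :
    ((R.filter p).map f).headD 0 = v := by
  rcases h : R.filter p with _ | ⟨q, l⟩
  · obtain ⟨q, hq, hp⟩ := h1
    have : q ∈ R.filter p := List.mem_filter.2 ⟨hq, hp⟩
    simp [h] at this
  · have : q ∈ R.filter p := by simp [h]
    rw [List.mem_filter] at this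
    exact h2 q this.1 this.2

theorem lookup_eq {m k : ℕ} {R : List (Fin m × Fin k)} {e : Fin m ≃ Fin k}
    (hR : ∀ x y, (x, y) ∈ R ↔ e x = y) :
    (∀ x : Fin m, lookupFst R x = e x) ∧ ∀ y : Fin k, lookupSnd R y = e.symm y := by
  constructor
  · intro x
    refine headD_map_filter ⟨(x, e x), (hR _ _).2 rfl, by simp⟩ fun q hq h => ?_
    rw [← (hR q.1 q.2).1 hq, Fin.ext (decide_eq_true_iff.1 h)]
  · intro y
    refine headD_map_filter ⟨(e.symm y, y), (hR _ _).2 (by simp), by simp⟩ fun q hq h => ?_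
    rw [← Fin.ext (decide_eq_true_iff.1 h), ← (hR q.1 q.2).1 hq, e.symm_apply_apply]

end Matching


/-! ### Running times: orbits, stabilizers and conjugacy -/

section Collate

variable {Γ : Ctx} {T : Γ.ι → Type} [∀ i, DecidableEq (T i)] {e : ∀ i, T i → Data}
  {l : ∀ i, List (T i)}

theorem Computes.distinct (he : ∀ i, Function.Injective (e i))
    (hl : Computes Γ fun i => .ofList (e i) (l i)) :
    Computes Γ fun i => .ofList (e i) (distinct (l i)) := by
  refine Computes.foldl_prefix (S := fun i => List (T i)) (eS := fun i => .ofList (e i)) hl hl.nil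
    ((hl.bdd.mul (hl.bdd.add (.const 1))).add (.const 1)) (fun i pre hpre => ?_) ?_
  · obtain ⟨h1, h2⟩ := distinct_spec pre
    have h3 : (HomExt.distinct pre).length ≤ pre.length :=
      (h1.subperm fun a ha => (h2 a).1 ha).length_le
    exact Data.size_ofList_le _ (fun a ha => Data.size_le_of_mem (e i) (hpre.subset ((h2 a).1 ha)))
      (h3.trans (hpre.length_le.trans (Data.length_lt_size (e i) _).le))
  · intro Δ h pre a _ hs ha
    refine Computes.ite (T := fun k => List (T (h.f k))) (e := fun k => .ofList (e _))
      (Computes.ofBool_true ?_) hs (ha.cons hs)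
    exact Computes.any (T := fun k => T (h.f k)) hs fun Θ h' b _ hb =>
      Computes.decEq (T := fun k => T (h.f (h'.f k))) (fun k => he _) hb (h'.wk ha)

theorem Computes.collate (he : ∀ i, Function.Injective (e i))
    (hl : Computes Γ fun i => .ofList (e i) (l i)) :
    Computes Γ fun i => .ofList (fun p => .cons (e i p.1) (.ofNat p.2)) (collate (l i)) :=
  Computes.map (U := fun i => T i × ℕ) (eU := fun i p => .cons (e i p.1) (.ofNat p.2))
    (Computes.distinct he hl) fun Δ h a _ ha =>
    ha.cons (Computes.length (T := fun k => T (h.f k)) (Computes.filter (T := fun k => T (h.f k))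
      (h.wk hl) fun Θ h' b _ hb =>
        Computes.decEq (T := fun k => T (h.f (h'.f k))) (fun k => he _) hb (h'.wk ha)))

end Collate

theorem Computes.finRange {Γ : Ctx} {n : Γ.ι → ℕ} (hn : Computes Γ fun i => .ofNat (n i)) :
    Computes Γ fun i => .ofList (fun x : Fin (n i) => .ofNat x) (List.finRange (n i)) :=
  hn.range.congr fun i => by rw [← List.map_coe_finRange_eq_range, Data.ofList_map]

theorem ComputableGroup.comap {Γ : Ctx} {α H : Γ.ι → Type} [∀ i, Group (α i)] [∀ i, Group (H i)]
    {e : ∀ i, α i → Data} (hα : ComputableGroup Γ α e) (f : ∀ i, H i →* α i) :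
    ComputableGroup Γ H fun i h => e i (f i h) where
  size := hα.size.imp fun B hB => ⟨hB.1, fun i a => hB.2 i _⟩
  mul Δ h a b ha hb := (hα.mul Δ h _ _ ha hb).congr fun k => by rw [map_mul]
  inv Δ h a ha := (hα.inv Δ h _ ha).congr fun k => by rw [map_inv]

section PermGroup

variable {Γ : Ctx} {n k : Γ.ι → ℕ} {H : Γ.ι → Type} [∀ i, Group (H i)]
  {ι : ∀ i, H i →* Equiv.Perm (Fin (n i))} {θ : ∀ i, H i →* Equiv.Perm (Fin (k i))}
  {gens w w' : ∀ i, List (H i)}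

theorem computableGroup_embedding (hn : PolyBdd Γ.s n) (ι : ∀ i, H i →* Equiv.Perm (Fin (n i))) :
    ComputableGroup Γ H fun i h => .ofPerm (ι i h) :=
  (computableGroup_perm hn).comap ι

theorem computableGroup_embedding_pair (hn : PolyBdd Γ.s n) (hk : PolyBdd Γ.s k)
    (ι : ∀ i, H i →* Equiv.Perm (Fin (n i))) (θ : ∀ i, H i →* Equiv.Perm (Fin (k i))) :
    ComputableGroup Γ H fun i h => codePair (ι i h, θ i h) :=
  (computableGroup_pair hn hk).comap fun i => (ι i).prod (θ i)

theorem Computes.groupMem {a : ∀ i, H i}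
    (hw : Computes Γ fun i => .ofList (fun h => .ofPerm (ι i h)) (w i))
    (ha : Computes Γ fun i => .ofPerm (ι i (a i))) :
    Computes Γ fun i => .ofBool (groupMem (ι i) (w i) (a i)) :=
  (ha.degree.strongGens (hw.congr fun i => (Data.ofList_map _ _ _).symm)).siftMem ha

theorem Computes.groupWord (hn : Computes Γ fun i => .ofNat (n i))
    (hg : Computes Γ fun i => .ofList (fun h => .ofPerm (ι i h)) (gens i)) :
    Computes Γ fun i => .ofList (fun h => .ofPerm (ι i h))
      (List.ofFn (groupWord (ι i) (gens i))) :=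
  (hn.reduceWord (hn.strongGens (hg.congr fun i => (Data.ofList_map _ _ _).symm))).congr
    fun i => by
      rw [← Data.ofList_map Data.ofPerm (ι i), List.map_ofFn]
      congr 2
      funext j
      exact (map_groupWord _ j).symm

theorem Computes.finEq {x y : ∀ i, Fin (k i)} (hx : Computes Γ fun i => .ofNat (x i))
    (hy : Computes Γ fun i => .ofNat (y i)) : Computes Γ fun i => .ofBool (decide (x i = y i)) :=
  Computes.decEq (T := fun i => Fin (k i)) (e := fun i x => .ofNat x)
    (fun i x y h => Fin.ext (Data.ofNat_injective h)) hx hy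

theorem Computes.fixes {h : ∀ i, H i} {x : ∀ i, Fin (k i)}
    (hh : Computes Γ fun i => .ofPerm (θ i (h i)))
    (hx : Computes Γ fun i => .ofNat (x i)) :
    Computes Γ fun i => .ofBool (fixes (θ i) (x i) (h i)) :=
  Computes.finEq (hh.apply hx) hx

theorem Computes.listGet {T : Γ.ι → Type} {e : ∀ i, T i → Data} {l : ∀ i, List (T i)}
    {c : ∀ i, Fin (l i).length} {d : ∀ i, T i} (hl : Computes Γ fun i => .ofList (e i) (l i))
    (hc : Computes Γ fun i => .ofNat (c i)) (hd : Computes Γ fun i => e i (d i)) :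
    Computes Γ fun i => e i ((l i).get (c i)) :=
  (Computes.getD hl hc hd).congr fun i => by
    rw [List.getD_eq_getElem _ _ (c i).2]; rfl

theorem Computes.wordGet {ws : ∀ i, List (List (H i))}
    {c : ∀ i, Fin (ws i).length}
    (hw : Computes Γ fun i => .ofList (Data.ofList fun h => .ofPerm (ι i h)) (ws i))
    (hc : Computes Γ fun i => .ofNat (c i)) :
    Computes Γ fun i => .ofList (fun h => .ofPerm (ι i h)) ((ws i).get (c i)) :=
  Computes.listGet (T := fun i => List (H i)) (d := fun i => [])
    (e := fun i => .ofList fun h => .ofPerm (ι i h)) hw hc hc.nil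

section Orbits

variable [∀ i, Finite (H i)] {x : ∀ i, Fin (k i)} (hn : Computes Γ fun i => .ofNat (n i))
  (hk : Computes Γ fun i => .ofNat (k i))
  (hg : Computes Γ fun i => .ofList (fun h => codePair (ι i h, θ i h)) (gens i))
  (hx : Computes Γ fun i => .ofNat (x i))

include hn hk hg

theorem Computes.stabTransversal (hx : Computes Γ fun i => .ofNat (x i)) :
    Computes Γ fun i => .ofList (fun h => codePair (ι i h, θ i h))
      (stabTransversal (θ i) (gens i) (x i)) :=
  Computes.transversal (computableGroup_embedding_pair hn.bdd_nat hk.bdd_nat ι θ)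
    (K := fun i => stab (θ i) (x i)) (fun i g => fixes_iff g)
    (fun i => relIndex_stab_le (x i) _) hk
    ((hn.permOne.cons hk.permOne).congr fun i => by rw [map_one, map_one]; rfl) hg
    fun Δ h a ha => Computes.fixes ha.snd (h.wk hx)

theorem Computes.orbitList (hx : Computes Γ fun i => .ofNat (x i)) :
    Computes Γ fun i => .ofList (fun y : Fin (k i) => .ofNat y)
      (orbitList (θ i) (gens i) (x i)) :=
  Computes.map (U := fun i => Fin (k i)) (eU := fun i y => .ofNat y)
    (Computes.stabTransversal hn hk hg hx)
    fun Δ h u _ hu => Computes.apply hu.snd (h.wk hx)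

theorem Computes.orbitReps : Computes Γ fun i => .ofList (fun y : Fin (k i) => .ofNat y)
    (orbitReps (θ i) (gens i)) :=
  Computes.filter (T := fun i => Fin (k i)) hk.finRange fun Δ h x _ hx =>
    Computes.all (T := fun _ => ℕ) hx.range fun Θ h' v _ hv =>
      Computes.all (T := fun j => Fin (k (h.f (h'.f j))))
        (h'.wk (Computes.orbitList (h.wk hn) (h.wk hk) (h.wk hg) hx))
        fun Ξ h'' y _ hy => (hy.natEq (h''.wk hv)).not

theorem Computes.stabWord (hx : Computes Γ fun i => .ofNat (x i)) :
    Computes Γ fun i => .ofList (fun h => .ofPerm (ι i h))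
      (List.ofFn (stabWord (θ i) (gens i) (ι i) (x i))) := by
  refine Computes.groupWord hn ?_
  refine (Computes.map (U := fun i => H i) (eU := fun i h => .ofPerm (ι i h)) (g := fun i h => h)
    (Computes.schreier (mem := fun i => HomExt.fixes (θ i) (x i))
      (computableGroup_embedding_pair hn.bdd_nat hk.bdd_nat ι θ) hg
      (Computes.stabTransversal hn hk hg hx)
      fun Δ h a ha => Computes.fixes ha.snd (h.wk hx)) fun Δ h a _ ha => ha.fst).congr fun i => ?_
  rw [List.map_id']

theorem Computes.orbitMultiset (hι : ∀ i, Function.Injective (ι i)) :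
    Computes Γ fun i => .ofList (fun p => .cons (.ofList (fun h => .ofPerm (ι i h)) (List.ofFn p.1))
      (.ofNat p.2)) (orbitMultiset (θ i) (gens i) (ι i)) := by
  classical
  unfold HomExt.orbitMultiset
  refine Computes.collate (T := fun i => Fin (2 * n i) → H i)
    (e := fun i p => .ofList (fun h => .ofPerm (ι i h)) (List.ofFn p)) (fun i p q h => ?_) ?_
  · have := Data.ofList_injective (e := fun h => Data.ofPerm (ι i h))
      (fun a b hab => hι i (Data.ofPerm_injective hab)) h
    exact List.ofFn_injective this
  · exact Computes.map (T := fun i => Fin (k i)) (U := fun i => Fin (2 * n i) → H i)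
      (eU := fun i p => .ofList (fun h => .ofPerm (ι i h)) (List.ofFn p))
      (Computes.orbitReps hn hk hg)
      fun Δ h x _ hx => Computes.stabWord (h.wk hn) (h.wk hk) (h.wk hg) hx

end Orbits

variable [∀ i, Finite (H i)] {m : Γ.ι → ℕ}

theorem Computes.groupTransversal (hι : ∀ i, Function.Injective (ι i))
    (hm : ∀ i, (Subgroup.closure {a | a ∈ w i}).relIndex (Subgroup.closure {a | a ∈ gens i}) ≤ m i)
    (hmc : Computes Γ fun i => .ofNat (m i)) (hn : Computes Γ fun i => .ofNat (n i))
    (hg : Computes Γ fun i => .ofList (fun h => .ofPerm (ι i h)) (gens i))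
    (hw : Computes Γ fun i => .ofList (fun h => .ofPerm (ι i h)) (w i)) :
    Computes Γ fun i => .ofList (fun h => .ofPerm (ι i h))
      (HomExt.transversal (gens i) (HomExt.groupMem (ι i) (w i)) (m i)) :=
  Computes.transversal (computableGroup_embedding hn.bdd_nat ι)
    (K := fun i => Subgroup.closure {a | a ∈ w i}) (fun i g => groupMem_iff (hι i)) hm hmc
    (hn.permOne.congr fun i => by rw [map_one]) hg fun Δ h a ha => Computes.groupMem (h.wk hw) ha

theorem Computes.conjTest (hι : ∀ i, Function.Injective (ι i))
    (hm : ∀ i, (Subgroup.closure {a | a ∈ w i}).relIndex (Subgroup.closure {a | a ∈ gens i}) ≤ m i)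
    (hmc : Computes Γ fun i => .ofNat (m i)) (hn : Computes Γ fun i => .ofNat (n i))
    (hg : Computes Γ fun i => .ofList (fun h => .ofPerm (ι i h)) (gens i))
    (hw : Computes Γ fun i => .ofList (fun h => .ofPerm (ι i h)) (w i))
    (hw' : Computes Γ fun i => .ofList (fun h => .ofPerm (ι i h)) (w' i)) :
    Computes Γ fun i => .ofBool (conjTest (ι i) (gens i) (m i) (w i) (w' i)) := by
  have hH := computableGroup_embedding hn.bdd_nat ι
  refine Computes.any (Computes.groupTransversal hι hm hmc hn hg hw) fun Δ h r _ hr => ?_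
  have hri := hH.inv Δ h _ hr
  refine Computes.band ?_ ?_
  · exact Computes.all (T := fun j => H (h.f j)) (h.wk hw') fun Θ h' a _ ha =>
      Computes.groupMem ((h'.trans h).wk hw) (hH.mul Θ (h'.trans h) _ _ (h'.wk hri)
        (hH.mul Θ (h'.trans h) _ _ ha (h'.wk hr)))
  · exact Computes.all (T := fun j => H (h.f j)) (h.wk hw) fun Θ h' a _ ha =>
      Computes.groupMem ((h'.trans h).wk hw') (hH.mul Θ (h'.trans h) _ _ (h'.wk hr)
        (hH.mul Θ (h'.trans h) _ _ ha (h'.wk hri)))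

/-! ### Running times: coset spaces and isomorphisms of actions -/

section Cosets

variable {ws : ∀ i, List (List (H i))}

/-- The code of the name of a coset. -/
def codeName {n : ℕ} {H : Type} [Group H] (ι : H →* Equiv.Perm (Fin n)) {ws : List (List H)}
    (p : Fin ws.length × H) : Data := .cons (.ofNat p.1) (.ofPerm (ι p.2))

variable (hι : ∀ i, Function.Injective (ι i)) (hm : ∀ i c, (block (ws i) c).index ≤ m i)
  (hmc : Computes Γ fun i => .ofNat (m i)) (hn : Computes Γ fun i => .ofNat (n i))
  (hg : Computes Γ fun i => .ofList (fun h => .ofPerm (ι i h)) (gens i))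
  (hw : Computes Γ fun i => .ofList (Data.ofList fun h => .ofPerm (ι i h)) (ws i))

include hι hm hmc hn hg hw

theorem Computes.cosetPoints : Computes Γ fun i => .ofList (codeName (ι i))
    (cosetPoints (ι i) (gens i) (m i) (ws i)) := by
  refine Computes.flatMap (T := fun i => Fin (ws i).length) (U := fun i => Fin (ws i).length × H i)
    (eU := fun i => codeName (ι i)) (Computes.length (T := fun i => List (H i)) hw).finRange
    fun Δ h c _ hc => ?_
  refine Computes.map (T := fun j => H (h.f j)) (U := fun j => Fin (ws (h.f j)).length × H (h.f j))
    (eU := fun j => codeName (ι _)) (Computes.groupTransversal (fun j => hι _) (fun j => ?_)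
      (h.wk hmc) (h.wk hn) (h.wk hg) (Computes.wordGet (h.wk hw) hc))
    fun Θ h' r _ hr => (h'.wk hc).cons hr
  refine (Subgroup.relIndex_le_of_le_right le_top ?_).trans ?_
  · rw [Subgroup.relIndex_top_right]; exact Subgroup.index_ne_zero_of_finite
  · rw [Subgroup.relIndex_top_right]; exact hm _ _

theorem Computes.cosetIdx {p : ∀ i, Fin (ws i).length × H i}
    (hp : Computes Γ fun i => codeName (ι i) (p i)) :
    Computes Γ fun i => .ofNat (cosetIdx (ι i) (gens i) (m i) (ws i) (p i)) := by
  have hH := computableGroup_embedding hn.bdd_nat ι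
  refine Computes.findIdx (T := fun i => Fin (ws i).length × H i)
    (Computes.cosetPoints hι hm hmc hn hg hw) fun Δ h q _ hq => ?_
  exact (Computes.finEq hq.fst (h.wk hp).fst).band (Computes.groupMem
    (Computes.wordGet (h.wk hw) hq.fst) (hH.mul Δ h _ _ (hH.inv Δ h _ hq.snd) (h.wk hp).snd))

theorem Computes.cosetAct (htop : ∀ i, Subgroup.closure {a | a ∈ gens i} = ⊤) {g : ∀ i, H i}
    (hgc : Computes Γ fun i => .ofPerm (ι i (g i))) :
    Computes Γ fun i => .ofPerm (cosetAct (htop i) (hι i) (hm i) (g i)) := by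
  have hH := computableGroup_embedding hn.bdd_nat ι
  refine (Computes.map (T := fun i => Fin (ws i).length × H i) (U := fun _ => ℕ)
    (eU := fun _ => Data.ofNat)
    (g := fun i p => HomExt.cosetIdx (ι i) (gens i) (m i) (ws i) (p.1, g i * p.2))
    (Computes.cosetPoints hι hm hmc hn hg hw) fun Δ h p _ hp => ?_).congr fun i => ?_
  · exact Computes.cosetIdx (p := fun j => ((p j).1, g (h.f j) * (p j).2)) (fun j => hι _)
      (fun j => hm _) (h.wk hmc) (h.wk hn) (h.wk hg) (h.wk hw)
      (hp.fst.cons (hH.mul Δ h _ _ (h.wk hgc) hp.snd))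
  · rw [Data.ofPerm_eq]
    congr 1
    conv_lhs => rw [← List.ofFn_get (HomExt.cosetPoints (ι i) (gens i) (m i) (ws i)), List.map_ofFn]
    congr 1
    funext j
    exact (cosetAct_apply (htop i) (hι i) (hm i) (g i) j).symm

end Cosets

end PermGroup

section Matching

variable {Γ : Ctx} {m k : Γ.ι → ℕ} {H : Γ.ι → Type} [∀ i, Group (H i)] [∀ i, Finite (H i)]
  {θ : ∀ i, H i →* Equiv.Perm (Fin (m i))} {η : ∀ i, H i →* Equiv.Perm (Fin (k i))}
  {gens : ∀ i, List (H i)}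

/-- The code of a pair of points. -/
def codePoints {m k : ℕ} (p : Fin m × Fin k) : Data := .cons (.ofNat p.1) (.ofNat p.2)

theorem Computes.pairOrbit {x : ∀ i, Fin (m i)} {y : ∀ i, Fin (k i)}
    (hm : Computes Γ fun i => .ofNat (m i)) (hk : Computes Γ fun i => .ofNat (k i))
    (hg : Computes Γ fun i => .ofList (fun h => codePair (θ i h, η i h)) (gens i))
    (hx : Computes Γ fun i => .ofNat (x i)) (hy : Computes Γ fun i => .ofNat (y i)) :
    Computes Γ fun i => .ofList codePoints (pairOrbit (θ i) (η i) (gens i) (x i) (y i)) := by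
  refine Computes.map (U := fun i => Fin (m i) × Fin (k i)) (eU := fun i => codePoints)
    (Computes.transversal (computableGroup_embedding_pair hm.bdd_nat hk.bdd_nat θ η)
      (K := fun i => stab (θ i) (x i) ⊓ stab (η i) (y i)) (fun i g => fixesPair_iff g)
      (fun i => relIndex_stab_inf_le _ _ _) (hm.mul hk)
      ((hm.permOne.cons hk.permOne).congr fun i => by rw [map_one, map_one]; rfl) hg
      fun Δ h a ha => (Computes.fixes ha.fst (h.wk hx)).band (Computes.fixes ha.snd (h.wk hy)))
    fun Δ h u _ hu => (Computes.apply hu.fst (h.wk hx)).cons (Computes.apply hu.snd (h.wk hy))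

theorem Computes.compatible {x : ∀ i, Fin (m i)} {y : ∀ i, Fin (k i)}
    (hm : Computes Γ fun i => .ofNat (m i)) (hk : Computes Γ fun i => .ofNat (k i))
    (hg : Computes Γ fun i => .ofList (fun h => codePair (θ i h, η i h)) (gens i))
    (hx : Computes Γ fun i => .ofNat (x i)) (hy : Computes Γ fun i => .ofNat (y i)) :
    Computes Γ fun i => .ofBool (compatible (θ i) (η i) (gens i) (x i) (y i)) := by
  have hO := Computes.pairOrbit hm hk hg hx hy
  exact Computes.all (T := fun i => Fin (m i) × Fin (k i)) hO fun Δ h p _ hp =>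
    Computes.all (T := fun j => Fin (m (h.f j)) × Fin (k (h.f j))) (h.wk hO) fun Θ h' q _ hq =>
      (Computes.decEq (T := fun _ => Bool) (e := fun _ => Data.ofBool)
        (fun _ a b hab => by cases a <;> cases b <;> simp_all [Data.ofBool])
        (Computes.finEq (h'.wk hp).fst hq.fst) (Computes.finEq (h'.wk hp).snd hq.snd)).congr
        fun j => by congr 1

theorem length_foldl_matchStep_le {m k : ℕ} {H : Type} [Group H] [Finite H]
    {θ : H →* Equiv.Perm (Fin m)} {η : H →* Equiv.Perm (Fin k)} {gens : List H}
    (pre : List (Fin m × Fin k)) :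
    (pre.foldl (matchStep θ η gens) []).length ≤ pre.length * (m * k) := by
  induction pre using List.reverseRecOn with
  | nil => simp
  | append_singleton pre p ih =>
    rw [List.foldl_append, List.foldl_cons, List.foldl_nil, List.length_append,
      List.length_singleton, Nat.succ_mul]
    have := length_pairOrbit_le (θ := θ) (η := η) (gens := gens) p.1 p.2
    unfold matchStep at *
    split_ifs
    · omega
    · rw [List.length_append]; omega
    · omega

theorem Computes.matching (hm : Computes Γ fun i => .ofNat (m i))
    (hk : Computes Γ fun i => .ofNat (k i))
    (hg : Computes Γ fun i => .ofList (fun h => codePair (θ i h, η i h)) (gens i)) :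
    Computes Γ fun i => .ofList codePoints (matching (θ i) (η i) (gens i)) := by
  have hl : Computes Γ fun i => .ofList codePoints
      ((List.finRange (m i)).flatMap fun x => (List.finRange (k i)).map fun y => (x, y)) :=
    Computes.flatMap (T := fun i => Fin (m i)) (U := fun i => Fin (m i) × Fin (k i))
      (eU := fun i => codePoints) hm.finRange fun Δ h x _ hx =>
      Computes.map (T := fun j => Fin (k (h.f j))) (U := fun j => Fin (m (h.f j)) × Fin (k (h.f j)))
        (eU := fun i => codePoints) (h.wk hk).finRange fun Θ h' y _ hy => (h'.wk hx).cons hy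
  have hmk := hm.bdd_nat.mul hk.bdd_nat
  refine Computes.foldl_prefix (S := fun i => List (Fin (m i) × Fin (k i)))
    (eS := fun i => .ofList codePoints) hl hl.nil
    (((hl.bdd.mul hmk).mul ((((((PolyBdd.const 2).mul hm.bdd_nat).add ((PolyBdd.const 2).mul
      hk.bdd_nat)).add (.const 3))).add (.const 1))).add (.const 1)) (fun i pre hpre => ?_) ?_
  · refine Data.size_ofList_le _ (fun p _ => ?_) ((length_foldl_matchStep_le pre).trans
      (Nat.mul_le_mul (hpre.length_le.trans (Data.length_lt_size codePoints _).le) le_rfl))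
    simp only [codePoints, Data.size, Data.size_ofNat]
    omega
  · intro Δ h pre p _ hs hp
    refine Computes.ite (T := fun j => List (Fin (m (h.f j)) × Fin (k (h.f j))))
      (e := fun i => .ofList codePoints) (Computes.ofBool_true ?_) hs
      (Computes.ite (T := fun j => List (Fin (m (h.f j)) × Fin (k (h.f j))))
        (e := fun i => .ofList codePoints) (Computes.ofBool_true ?_) ?_ hs)
    · exact Computes.any (T := fun j => Fin (m (h.f j)) × Fin (k (h.f j))) hs fun Θ h' q _ hq =>
        (Computes.finEq hq.fst (h'.wk hp).fst).bor (Computes.finEq hq.snd (h'.wk hp).snd)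
    · exact Computes.compatible (h.wk hm) (h.wk hk) (h.wk hg) hp.fst hp.snd
    · exact Computes.append (T := fun j => Fin (m (h.f j)) × Fin (k (h.f j)))
        (Computes.pairOrbit (h.wk hm) (h.wk hk) (h.wk hg) hp.fst hp.snd) hs

theorem Computes.lookupFst {R : ∀ i, List (Fin (m i) × Fin (k i))} {v : Γ.ι → ℕ}
    (hR : Computes Γ fun i => .ofList codePoints (R i)) (hv : Computes Γ fun i => .ofNat (v i)) :
    Computes Γ fun i => .ofNat (lookupFst (R i) (v i)) :=
  Computes.headD (T := fun _ => ℕ) (e := fun _ => Data.ofNat) (Computes.map (U := fun _ => ℕ)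
    (T := fun i => Fin (m i) × Fin (k i)) (eU := fun _ => Data.ofNat)
    (Computes.filter (T := fun i => Fin (m i) × Fin (k i)) hR
      fun Δ h q _ hq => hq.fst.natEq (h.wk hv)) fun Δ h q _ hq => hq.snd) hv.zero

theorem Computes.lookupSnd {R : ∀ i, List (Fin (m i) × Fin (k i))} {v : Γ.ι → ℕ}
    (hR : Computes Γ fun i => .ofList codePoints (R i)) (hv : Computes Γ fun i => .ofNat (v i)) :
    Computes Γ fun i => .ofNat (lookupSnd (R i) (v i)) :=
  Computes.headD (T := fun _ => ℕ) (e := fun _ => Data.ofNat) (Computes.map (U := fun _ => ℕ)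
    (T := fun i => Fin (m i) × Fin (k i)) (eU := fun _ => Data.ofNat)
    (Computes.filter (T := fun i => Fin (m i) × Fin (k i)) hR
      fun Δ h q _ hq => hq.snd.natEq (h.wk hv)) fun Δ h q _ hq => hq.fst) hv.zero

end Matching


/-! ### The data of an instance -/

theorem Computes.exists_prog {Γ : Ctx} {y : Γ.ι → Data} (hy : Computes Γ y) :
    ∃ (p : Prog) (q : Polynomial ℕ), ∀ i (Post : Data → Prop), Post (y i) →
      p.HaltsWithin (Γ.env i) (q.eval (Γ.s i)) Post := by
  obtain ⟨p, T, ⟨q, hq⟩, h⟩ := hy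
  refine ⟨p, q, fun i Post hp => ?_⟩
  obtain ⟨t, ht, he⟩ := h i
  exact ⟨_, t, he, ht.trans (hq i), hp⟩

theorem closure_eq_top_of_generators {H : Type} [Group H] {s : Set H}
    {l : List (Subgroup.closure s)} (h : ∀ x (hx : x ∈ s), ⟨x, Subgroup.subset_closure hx⟩ ∈ l) :
    Subgroup.closure {a | a ∈ l} = ⊤ := by
  rw [eq_top_iff, ← Subgroup.closure_closure_coe_preimage (k := s)]
  exact Subgroup.closure_mono fun x hx => h x.1 hx

theorem ofList_attach {α : Type} (e : α → Data) (l : List α) :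
    Data.ofList (fun a : {a // a ∈ l} => e a.1) l.attach = Data.ofList e l := by
  rw [← Data.ofList_map e Subtype.val, List.attach_map_subtype_val]

namespace HomExtSym

section Generators

variable (I : HomExtSym)

/-- The given generators, as elements of `G`. -/
def gensG : List I.G := I.gens.attach.map fun a => ⟨a.1, Subgroup.subset_closure a.2⟩

/-- The given generators of `M`, as elements of `M`. -/
def gensM : List I.M :=
  I.γ.attach.map fun p => ⟨p.1.1, Subgroup.subset_closure (List.mem_map_of_mem p.2)⟩

/-- The inclusion of `M` into the symmetric group. -/
def embM : I.M →* Equiv.Perm (Fin I.n) := I.G.subtype.comp I.M.subtype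

theorem embM_injective : Function.Injective I.embM :=
  I.G.subtype_injective.comp I.M.subtype_injective

theorem closure_gensG : Subgroup.closure {a | a ∈ I.gensG} = ⊤ :=
  closure_eq_top_of_generators fun x hx => List.mem_map.2 ⟨⟨x, hx⟩, List.mem_attach _ _, rfl⟩

theorem closure_gensM : Subgroup.closure {a | a ∈ I.gensM} = ⊤ := by
  refine closure_eq_top_of_generators fun x hx => List.mem_map.2 ?_
  obtain ⟨p, hp, rfl⟩ := List.mem_map.1 hx
  exact ⟨⟨p, hp⟩, List.mem_attach _ _, rfl⟩

theorem code_gensG : Data.ofList (fun h => .ofPerm (I.G.subtype h)) I.gensG = I.codeGensG := by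
  rw [gensG, Data.ofList_map]
  exact ofList_attach Data.ofPerm I.gens

theorem code_gensM : Data.ofList (fun h => codePair (I.embM h, I.ψ h)) I.gensM =
    .ofList (fun p => .cons (I.codeG p.1) (Data.ofPerm p.2)) I.γ := by
  rw [gensM, Data.ofList_map, ← ofList_attach _ I.γ]
  congr 1
  funext p
  rw [I.ψ_eq p.1 p.2]
  rfl

theorem codeExt_eq (φ : I.Ext) : I.codeExt φ =
    .ofList (fun g => .cons (.ofPerm (I.G.subtype g)) (.ofPerm (φ.1 g))) I.gensG := by
  rw [gensG, Data.ofList_map]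
  rfl

end Generators

/-! ### Words and representations of multisets -/

section Words

variable {H : Type} [Group H] {m k : ℕ}

theorem closure_ofFn (w : Fin k → H) :
    Subgroup.closure {a | a ∈ List.ofFn w} = Subgroup.closure (Set.range w) := by
  congr 1
  ext a
  exact List.mem_ofFn

theorem decWord_eq_some {w : Fin k → H} {u : ConjLeq H m} (h : decWord m w = some u) :
    (Subgroup.closure {a | a ∈ List.ofFn w}).index ≤ m ∧
      u.toCl = cls (Subgroup.closure {a | a ∈ List.ofFn w}) := by
  rw [closure_ofFn]
  unfold decWord at h
  split_ifs at h with hm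
  exact ⟨hm, by rw [← Option.some.inj h, ConjLeq.toCl_mk]⟩

/-- A subgroup of a permutation group of degree `n` is generated by a word of length `2 * n`. -/
theorem exists_decWord [Finite H] {n : ℕ} {ι : H →* Equiv.Perm (Fin n)}
    (hι : Function.Injective ι) (u : ConjLeq H m) :
    ∃ w : Fin (2 * n) → H, decWord m w = some u := by
  induction u using Quotient.inductionOn with
  | h L =>
    obtain ⟨L, hL⟩ := L
    let l : List H := (Set.toFinite (L : Set H)).toFinset.toList
    have hl : Subgroup.closure (Set.range (groupWord ι l)) = L := by
      rw [closure_groupWord hι]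
      conv_rhs => rw [← Subgroup.closure_eq L]
      congr 1
      ext a
      simp [l]
    refine ⟨groupWord ι l, ?_⟩
    unfold decWord
    simp only [hl]
    rw [dif_pos hL]
    rfl

/-- The words that represent a multiset, repeated according to their multiplicities. -/
def expand (l : List ((Fin k → H) × ℕ)) : List (List H) :=
  l.flatMap fun p => List.replicate p.2 (List.ofFn p.1)

variable {l : List ((Fin k → H) × ℕ)} {S : Multiset (ConjLeq H m)}

theorem exists_of_represents (h : Represents (decWord m) l S) {p : (Fin k → H) × ℕ} (hp : p ∈ l) :
    ∃ u, decWord m p.1 = some u := by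
  have h1 : decWord m p.1 ∈ S.map some := by
    rw [h.2.2, ← Multiset.sum_coe]
    exact Multiset.mem_join.2 ⟨_, Multiset.mem_coe.2 (List.mem_map_of_mem hp),
      Multiset.mem_replicate.2 ⟨(h.2.1 p hp).ne', rfl⟩⟩
  obtain ⟨u, -, hu⟩ := Multiset.mem_map.1 h1
  exact ⟨u, hu.symm⟩

theorem index_block_expand_le (h : Represents (decWord m) l S) (c : Fin (expand l).length) :
    (block (expand l) c).index ≤ m := by
  obtain ⟨p, hp, hc⟩ := List.mem_flatMap.1 (List.get_mem (expand l) c)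
  obtain ⟨u, hu⟩ := exists_of_represents h hp
  rw [block, List.eq_of_mem_replicate hc]
  exact (decWord_eq_some hu).1

theorem map_toCl_of_represents (h : Represents (decWord m) l S) :
    S.map ConjLeq.toCl = Finset.univ.val.map fun c => cls (block (expand l) c) := by
  have key : ∀ l : List ((Fin k → H) × ℕ), (∀ p ∈ l, ∃ u : ConjLeq H m, decWord m p.1 = some u) →
      (l.map fun p => Multiset.replicate p.2 (decWord m p.1)).sum.map (Option.map ConjLeq.toCl) =
        (((expand l).map fun w => cls (Subgroup.closure {a | a ∈ w}) : List _) :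
          Multiset (ConjCl H)).map some := by
    intro l hl
    induction l with
    | nil => rfl
    | cons p l ih =>
      obtain ⟨u, hu⟩ := hl p List.mem_cons_self
      have he : expand (p :: l) = List.replicate p.2 (List.ofFn p.1) ++ expand l := rfl
      rw [List.map_cons, List.sum_cons, Multiset.map_add,
        ih fun q hq => hl q (List.mem_cons_of_mem _ hq), Multiset.map_replicate, hu,
        Option.map_some, (decWord_eq_some hu).2, he,
        List.map_append, List.map_replicate, ← Multiset.coe_add, Multiset.map_add,
        Multiset.coe_replicate, Multiset.map_replicate]
  apply Multiset.map_injective (Option.some_injective _)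
  rw [Multiset.map_map, Fin.univ_val_map]
  have h1 := key l fun p hp => exists_of_represents h hp
  rw [← h.2.2, Multiset.map_map] at h1
  refine h1.trans ?_
  congr 2
  conv_lhs => rw [← List.ofFn_get (expand l), List.map_ofFn]
  rfl

theorem sum_multiplicities (h : Represents (decWord m) l S) : (l.map Prod.snd).sum = S.card := by
  have h1 := congrArg Multiset.card h.2.2
  rw [Multiset.card_map] at h1
  rw [h1]
  clear h h1
  induction l with
  | nil => rfl
  | cons p l ih => rw [List.map_cons, List.sum_cons, ih, List.map_cons, List.sum_cons,
      Multiset.card_add, Multiset.card_replicate]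

theorem length_le_of_represents (h : Represents (decWord m) l S) : l.length ≤ S.card := by
  rw [← sum_multiplicities h, ← List.length_map (f := Prod.snd) (as := l)]
  refine List.length_le_sum_of_one_le _ fun i hi => ?_
  obtain ⟨p, hp, rfl⟩ := List.mem_map.1 hi
  exact h.2.1 p hp

theorem multiplicity_le_of_represents (h : Represents (decWord m) l S) {p : (Fin k → H) × ℕ}
    (hp : p ∈ l) : p.2 ≤ S.card := by
  rw [← sum_multiplicities h]
  exact List.single_le_sum (by simp) _ (List.mem_map_of_mem hp)

theorem card_orbitType_le [Finite H] (ψ : H →* Equiv.Perm (Fin m)) :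
    (orbitType ψ).card ≤ m := by
  classical
  unfold orbitType
  rw [Multiset.card_map]
  refine (Finset.card_le_card_of_surjOn (s := (Finset.univ : Finset (Fin m))) (Quotient.mk _)
    fun o _ => ?_).trans (by simp)
  exact ⟨Quotient.out o, by simp, Quotient.out_eq o⟩

end Words

theorem card_le_of_mem_SubSum (I : HomExtSym) {S : Multiset (ConjLeq I.G I.m)}
    (hS : S ∈ I.oms.SubSum) : S.card ≤ I.m := by
  obtain ⟨φ, rfl⟩ := I.exists_ext hS
  exact card_orbitType_le _

end HomExtSym


namespace HomExtSym

/-! ### Sizes of inputs -/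

section Sizes

variable {Γ : Ctx} {I : Γ.ι → HomExtSym} (hs : ∀ i, Γ.s i = (I i).n + (I i).m)

include hs

theorem bdd_degree : PolyBdd Γ.s fun i => (I i).n :=
  PolyBdd.self.mono fun i => (Nat.le_add_right _ _).trans (hs i).ge

theorem bdd_codegree : PolyBdd Γ.s fun i => (I i).m :=
  PolyBdd.self.mono fun i => (Nat.le_add_left _ _).trans (hs i).ge

theorem bdd_word {H : Γ.ι → Type} (f : ∀ i, H i → Equiv.Perm (Fin (I i).n))
    (w : ∀ i, Fin (2 * (I i).n) → H i) :
    PolyBdd Γ.s fun i => (Data.ofList (fun h => .ofPerm (f i h)) (List.ofFn (w i))).size :=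
  ((((PolyBdd.const 2).mul (bdd_degree hs)).mul ((bdd_degree hs).permSize.add (.const 1))).add
    (.const 1)).mono fun i => Data.size_ofList_le _ (fun a _ => Data.size_ofPerm_le _) (by simp)

theorem bdd_code : PolyBdd Γ.s fun i => (I i).code.size := by
  have hn := bdd_degree hs
  have hm := bdd_codegree hs
  have h2 := (PolyBdd.const (s := Γ.s) 2).mul hn
  have hG : PolyBdd Γ.s fun i => (I i).codeGensG.size :=
    ((h2.mul (hn.permSize.add (.const 1))).add (.const 1)).mono fun i =>
      Data.size_ofList_le _ (fun a _ => Data.size_ofPerm_le _) (I i).gens_length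
  have hγ : PolyBdd Γ.s fun i =>
      (Data.ofList (fun p => .cons ((I i).codeG p.1) (Data.ofPerm p.2)) (I i).γ).size :=
    ((h2.mul (((hn.permSize.add hm.permSize).add (.const 1)).add (.const 1))).add (.const 1)).mono
      fun i => Data.size_ofList_le _ (fun a _ => by
        have h1 := Data.size_ofPerm_le a.1.1
        have h2 := Data.size_ofPerm_le a.2
        simp only [Data.size, codeG]
        omega) (I i).γ_length
  refine ((((h2.add (.const 1)).add (((PolyBdd.const 2).mul hm).add (.const 1))).add
    (hG.add hγ)).add (.const 3)).mono fun i => ?_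
  simp only [code, Data.size, Data.size_ofNat]
  omega

theorem bdd_multiset (l : ∀ i, List ((Fin (2 * (I i).n) → (I i).G) × ℕ))
    (hl : ∀ i, (l i).length ≤ (I i).m) (hl' : ∀ i, ∀ p ∈ l i, p.2 ≤ (I i).m) :
    PolyBdd Γ.s fun i => ((I i).codeMultisetV (l i)).size := by
  have hn := bdd_degree hs
  have hm := bdd_codegree hs
  refine ((hm.mul (((((((PolyBdd.const 2).mul hn).mul (hn.permSize.add (.const 1))).add
    (.const 1)).add (((PolyBdd.const 2).mul hm).add (.const 1))).add (.const 1)).add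
    (.const 1))).add (.const 1)).mono fun i => Data.size_ofList_le _ (fun p hp => ?_) (hl i)
  have h1 : ((I i).codeWordV p.1).size ≤ 2 * (I i).n * (permSize (I i).n + 1) + 1 :=
    Data.size_ofList_le _ (fun a _ => Data.size_ofPerm_le _) (by simp)
  have h2 := hl' i p hp
  simp only [Data.size, Data.size_ofNat]
  omega

end Sizes

/-! ### The algorithms -/

/-- The action of `G` on the cosets modulo the subgroups that are generated by words. -/
noncomputable def wordAct (I : HomExtSym) {ws : List (List I.G)}
    (hm : ∀ c, (block ws c).index ≤ I.m) :
    I.G →* Equiv.Perm (Fin (cosetPoints I.G.subtype I.gensG I.m ws).length) :=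
  cosetAct I.closure_gensG I.G.subtype_injective hm

/-- The matching between `ψ` and the action of `M` on the cosets. -/
noncomputable def wordMatching (I : HomExtSym) {ws : List (List I.G)}
    (hm : ∀ c, (block ws c).index ≤ I.m) :
    List (Fin I.m × Fin (cosetPoints I.G.subtype I.gensG I.m ws).length) :=
  matching I.ψ ((wordAct I hm).comp I.M.subtype) I.gensM

/-- If the words generate subgroups in the classes of a solution, then the matching is the graph of
an isomorphism `e` of actions of `M`, and the action of `G` on the cosets, carried along `e`, is an
extension of `ψ` that belongs to the solution. -/
theorem exists_ext_of_words (I : HomExtSym) (S : I.oms.SubSum) {ws : List (List I.G)}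
    (hm : ∀ c, (block ws c).index ≤ I.m)
    (hS : Multiset.map (ConjLeq.toCl (H := I.G) (m := I.m)) S.1 =
      Finset.univ.val.map fun c => cls (block ws c)) :
    ∃ (e : Fin I.m ≃ Fin (cosetPoints I.G.subtype I.gensG I.m ws).length) (φ : I.Ext),
      (∀ x y, (x, y) ∈ wordMatching I hm ↔ e x = y) ∧
      (∀ g x, φ.1 g x = e.symm (wordAct I hm g (e x))) ∧
      I.extEquiv (Quotient.mk _ φ) = S := by
  let e₀ := cosetEquiv I.closure_gensG I.G.subtype_injective hm
  obtain ⟨e₁, he₁⟩ := exists_equiv_of_otype_eq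
    ((I.otype_restrict_sigma S.2 (block ws) hS).symm.trans (otype_transport e₀.symm _).symm)
  obtain ⟨e, he, hR⟩ := matching_spec I.closure_gensM
    (η := (wordAct I hm).comp I.M.subtype) e₁ he₁
  have hM : ∀ (g : I.M) x, (e₀.symm.trans e.symm) (sigmaHom (fun c => cosetHom (block ws c)) g x) =
      I.ψ g ((e₀.symm.trans e.symm) x) := by
    intro g x
    rw [Equiv.trans_apply, Equiv.trans_apply, Equiv.symm_apply_eq, he, Equiv.apply_symm_apply]
    exact (congrArg (fun z => e₀.symm (sigmaHom _ (g : I.G) z)) (e₀.apply_symm_apply x)).symm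
  refine ⟨e, I.extOfEquiv (block ws) (e₀.symm.trans e.symm) hM, hR, fun g x => rfl,
    Subtype.ext ?_⟩
  rw [extEquiv_mk]
  exact I.orbitType_extOfEquiv _ hS _ _

section Inputs

variable {Γ : Ctx} {I : Γ.ι → HomExtSym} (hc : Computes Γ fun i => (I i).code)

include hc

theorem computes_degree : Computes Γ fun i => .ofNat (I i).n := hc.fst

theorem computes_codegree : Computes Γ fun i => .ofNat (I i).m := hc.snd.fst

theorem computes_gensG :
    Computes Γ fun i => .ofList (fun h => .ofPerm ((I i).G.subtype h)) (I i).gensG :=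
  hc.snd.snd.fst.congr fun i => (code_gensG (I i)).symm

theorem computes_gensM_pair :
    Computes Γ fun i => .ofList (fun h => codePair ((I i).embM h, (I i).ψ h)) (I i).gensM :=
  hc.snd.snd.snd.congr fun i => (code_gensM (I i)).symm

/-- The given generators of `M`, in any code that is computable from a generator and its value
under `ψ`. -/
theorem computes_gensM_map {A : ∀ i, (I i).M → Data} (hA : ∀ (Δ : Ctx) (h : Δ.Hom Γ)
    (a : ∀ k, (I (h.f k)).M), Computes Δ (fun k => codePair ((I (h.f k)).embM (a k),
      (I (h.f k)).ψ (a k))) → Computes Δ fun k => A (h.f k) (a k)) :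
    Computes Γ fun i => .ofList (A i) (I i).gensM := by
  refine (Computes.map (U := fun i => (I i).M) (eU := A) (g := fun i a => a)
    (computes_gensM_pair hc) fun Δ h a _ ha => hA Δ h a ha).congr fun i => ?_
  rw [List.map_id']

theorem computes_gensM :
    Computes Γ fun i => .ofList (fun h => .ofPerm ((I i).embM h)) (I i).gensM :=
  computes_gensM_map hc fun Δ h a ha => ha.fst

theorem computes_codeGensM : Computes Γ fun i => (I i).codeGensM := by
  refine (Computes.map (T := fun i => (I i).G × Equiv.Perm (Fin (I i).m)) (U := fun i => (I i).G)
    (eU := fun i => (I i).codeG) (g := fun i p => p.1)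
    (e := fun i p => .cons ((I i).codeG p.1) (Data.ofPerm p.2)) (l := fun i => (I i).γ)
    hc.snd.snd.snd fun Δ h a _ ha => ha.fst).congr fun i => rfl

variable {ws : ∀ i, List (List (I i).G)} (hm : ∀ i c, (block (ws i) c).index ≤ (I i).m)
  (hw : Computes Γ fun i => .ofList (Data.ofList fun h => .ofPerm ((I i).G.subtype h)) (ws i))

include hm hw

theorem computes_wordAct {g : ∀ i, (I i).G}
    (hg : Computes Γ fun i => .ofPerm ((I i).G.subtype (g i))) :
    Computes Γ fun i => .ofPerm (wordAct (I i) (hm i) (g i)) :=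
  Computes.cosetAct (H := fun i => (I i).G) (fun i => (I i).G.subtype_injective) hm
    (computes_codegree hc) (computes_degree hc) (computes_gensG hc) hw
    (fun i => closure_gensG (I i)) hg

theorem computes_points : Computes Γ fun i =>
    .ofNat (cosetPoints (I i).G.subtype (I i).gensG (I i).m (ws i)).length :=
  Computes.length (T := fun i => Fin (ws i).length × (I i).G)
    (e := fun i => codeName (I i).G.subtype)
    (Computes.cosetPoints (H := fun i => (I i).G) (fun i => (I i).G.subtype_injective) hm
    (computes_codegree hc) (computes_degree hc) (computes_gensG hc) hw)

/-- The points are translated back and forth by looking them up in the matching. -/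
theorem computes_codeExt (S : ∀ i, (I i).oms.SubSum)
    (hS : ∀ i, Multiset.map (ConjLeq.toCl (H := (I i).G) (m := (I i).m)) (S i).1 =
      Finset.univ.val.map fun c => cls (block (ws i) c)) :
    ∃ φ : ∀ i, (I i).Ext, (∀ i, (I i).extEquiv (Quotient.mk _ (φ i)) = S i) ∧
      Computes Γ fun i => (I i).codeExt (φ i) := by
  have hR : Computes Γ fun i => .ofList codePoints (wordMatching (I i) (hm i)) :=
    Computes.matching (H := fun i => (I i).M) (θ := fun i => (I i).ψ)
      (η := fun i => (wordAct (I i) (hm i)).comp (I i).M.subtype) (gens := fun i => (I i).gensM)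
      (computes_codegree hc) (computes_points hc hm hw)
      (computes_gensM_map hc fun Δ h a ha => ha.snd.cons
        (computes_wordAct (I := fun k => I (h.f k)) (h.wk hc) (fun k => hm (h.f k)) (h.wk hw)
          (g := fun k => (a k).1) ha.fst))
  choose e φ hRe hφ hφS using fun i => exists_ext_of_words (I i) (S i) (hm i) (hS i)
  refine ⟨φ, hφS, (Computes.map (T := fun i => (I i).G) (U := fun _ => Data) (eU := fun _ y => y)
    (g := fun i g => .cons (.ofPerm ((I i).G.subtype g)) (.ofPerm ((φ i).1 g)))
    (computes_gensG hc) fun Δ h g _ hg => hg.cons ?_).congr fun i => ?_⟩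
  · refine (Computes.map (T := fun k => Fin (I (h.f k)).m) (U := fun k => Fin (I (h.f k)).m)
      (eU := fun _ x => .ofNat x) (g := fun k x => (φ (h.f k)).1 (g k) x)
      (h.wk (computes_codegree hc)).finRange fun Θ h' x _ hx => ?_).congr fun k => ?_
    · have h1 : Computes Θ fun k => .ofNat (e (h.f (h'.f k)) (x k)) :=
        (Computes.lookupFst ((h'.trans h).wk hR) hx).congr fun k =>
          congrArg Data.ofNat ((lookup_eq (hRe _)).1 (x k))
      have h2 := computes_wordAct (I := fun k => I (h.f k)) (h.wk hc) (fun k => hm (h.f k))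
        (h.wk hw) hg
      refine (Computes.lookupSnd ((h'.trans h).wk hR) (Computes.apply (h'.wk h2) h1)).congr
        fun k => congrArg Data.ofNat (((lookup_eq (hRe _)).2 _).trans ?_)
      exact congrArg Fin.val (hφ _ _ _).symm
    · rw [← List.ofFn_eq_map]
      rfl
  · rw [codeExt_eq, Data.ofList_map]

end Inputs

theorem exists_inputProg : ∃ (p : Prog) (q : Polynomial ℕ), ∀ I : HomExtSym,
    p.HaltsWithin I.code (q.eval (I.n + I.m)) (fun y =>
      ∃ l, Represents I.oms.dec₁ l I.oms.K ∧ y = I.codeExplicit l) := by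
  let Γ : Ctx := ⟨HomExtSym, fun I => I.n + I.m, fun I => I.code⟩
  have hc : Computes Γ fun I => HomExtSym.code I :=
    Computes.env (Γ := Γ) (bdd_code (Γ := Γ) (I := fun I => I) fun _ => rfl)
  have hn := computes_degree hc
  have h1 := Computes.orbitMultiset (H := fun I : Γ.ι => HomExtSym.M I) hn (computes_codegree hc)
    (computes_gensM_pair hc) fun I => embM_injective I
  obtain ⟨p, q, h⟩ := ((computes_codeGensM hc).cons (hc.snd.snd.fst.cons
    (hn.two_mul.cons (hn.two_mul.cons h1)))).exists_prog
  refine ⟨p, q, fun I => h I _ ⟨_, ?_, rfl⟩⟩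
  exact represents_orbitMultiset I.closure_gensM I.embM_injective le_rfl I.K_toCl

/-- Equality of the classes encoded by two words is decided, for a family of subgroups of symmetric
groups whose generators are computable from the instance; this serves for both `M` and `G`. -/
theorem exists_conjProg (H : HomExtSym → Type) [∀ I, Group (H I)] [∀ I, Finite (H I)]
    (ι : ∀ I, H I →* Equiv.Perm (Fin I.n)) (hι : ∀ I, Function.Injective (ι I))
    (gens : ∀ I, List (H I)) (hg : ∀ I, Subgroup.closure {a | a ∈ gens I} = ⊤)
    (hgc : ∀ (Γ : Ctx) (I : Γ.ι → HomExtSym), (Computes Γ fun i => (I i).code) →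
      Computes Γ fun i => .ofList (fun h => .ofPerm (ι (I i) h)) (gens (I i))) :
    ∃ (p : Prog) (q : Polynomial ℕ), ∀ (I : HomExtSym) (w w' : Fin (2 * I.n) → H I)
      (u u' : ConjLeq (H I) I.m), decWord I.m w = some u → decWord I.m w' = some u' →
        p.HaltsWithin (.cons I.code (.cons (.ofList (fun h => .ofPerm (ι I h)) (List.ofFn w))
          (.ofList (fun h => .ofPerm (ι I h)) (List.ofFn w')))) (q.eval (I.n + I.m))
          (fun y => ∃ b : Bool, (b = true ↔ u = u') ∧ y = .ofBool b) := by
  let J := {j : Σ I, (Fin (2 * HomExtSym.n I) → H I) × (Fin (2 * I.n) → H I) //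
    (Subgroup.closure {a | a ∈ List.ofFn j.2.1}).index ≤ j.1.m}
  let I : J → HomExtSym := fun j => j.1.1
  let Γ : Ctx := ⟨J, fun j => (I j).n + (I j).m, fun j => .cons (I j).code
    (.cons (.ofList (fun h => .ofPerm (ι (I j) h)) (List.ofFn j.1.2.1))
      (.ofList (fun h => .ofPerm (ι (I j) h)) (List.ofFn j.1.2.2)))⟩
  have hs : ∀ j : Γ.ι, Γ.s j = (I j).n + (I j).m := fun _ => rfl
  have henv : Computes Γ Γ.env := by
    refine Computes.env (((bdd_code hs).add (((bdd_word hs (fun j => ι (I j))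
      fun j => j.1.2.1).add (bdd_word hs (fun j => ι (I j)) fun j => j.1.2.2)).add
      (.const 1))).add (.const 1))
  have hc : Computes Γ fun j => (I j).code := henv.fst
  obtain ⟨p, q, h⟩ := (Computes.conjTest (Γ := Γ) (H := fun j => H (I j)) (fun j => hι (I j))
    (fun j => by rw [hg, Subgroup.relIndex_top_right]; exact j.2) (computes_codegree hc)
    (computes_degree hc) (hgc Γ I hc) henv.snd.fst henv.snd.snd).exists_prog
  refine ⟨p, q, fun I w w' u u' hu hu' => ?_⟩
  obtain ⟨hi, hcl⟩ := decWord_eq_some hu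
  refine h ⟨⟨I, w, w'⟩, hi⟩ _ ⟨_, ?_, rfl⟩
  refine Iff.trans (conjTest_iff (w' := List.ofFn w') (hg I) (hι I) hi) ?_
  rw [← ConjLeq.toCl_injective.eq_iff, hcl, (decWord_eq_some hu').2]

theorem index_block_singleton_le {H : Type} [Group H] {m : ℕ} {w : List H}
    (h : (Subgroup.closure {a | a ∈ w}).index ≤ m) (c : Fin [w].length) :
    (block [w] c).index ≤ m := by
  obtain rfl : c = 0 := Subsingleton.elim (α := Fin 1) _ _
  exact h

theorem exists_oracleProg : ∃ (p : Prog) (q : Polynomial ℕ), ∀ (I : HomExtSym)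
    (w : Fin (2 * I.n) → I.G) (v : ConjLeq I.G I.m), decWord I.m w = some v →
      p.HaltsWithin (.cons I.code (I.codeWordV w)) (q.eval (I.n + I.m)) (fun y =>
        ∃ l, Represents I.oms.dec₁ l (I.family v) ∧ y = I.codeMultisetU l) := by
  let J := {j : Σ I : HomExtSym, Fin (2 * I.n) → I.G //
    (Subgroup.closure {a | a ∈ List.ofFn j.2}).index ≤ j.1.m}
  let I : J → HomExtSym := fun j => j.1.1
  let Γ : Ctx := ⟨J, fun j => (I j).n + (I j).m, fun j => .cons (I j).code ((I j).codeWordV j.1.2)⟩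
  have hs : ∀ j : Γ.ι, Γ.s j = (I j).n + (I j).m := fun _ => rfl
  have henv : Computes Γ Γ.env := Computes.env (((bdd_code hs).add
    (bdd_word hs (fun j => (I j).G.subtype) fun j => j.1.2)).add (.const 1))
  have hc : Computes Γ fun j => (I j).code := henv.fst
  have hw : Computes Γ fun j => .ofList (Data.ofList fun h => .ofPerm ((I j).G.subtype h))
      [List.ofFn j.1.2] :=
    henv.snd.cons hc.nil
  have hm : ∀ (j : Γ.ι) c, (block [List.ofFn j.1.2] c).index ≤ (I j).m :=
    fun j => index_block_singleton_le j.2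
  have hk := computes_points hc hm hw
  obtain ⟨p, q, h⟩ := (Computes.orbitMultiset (H := fun j : Γ.ι => (I j).M)
    (ι := fun j => (I j).embM) (gens := fun j => (I j).gensM)
    (θ := fun j => (wordAct (I j) (hm j)).comp (I j).M.subtype) (computes_degree hc) hk
    (computes_gensM_map hc fun Δ h a ha => ha.fst.cons
      (computes_wordAct (I := fun k => I (h.f k)) (h.wk hc) (fun k => hm (h.f k)) (h.wk hw)
        (g := fun k => (a k).1) ha.fst)) fun j => embM_injective _).exists_prog
  refine ⟨p, q, fun I w v hv => ?_⟩
  obtain ⟨hi, hcl⟩ := decWord_eq_some hv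
  refine h ⟨⟨I, w⟩, hi⟩ _ ⟨_, ?_, rfl⟩
  refine represents_orbitMultiset I.closure_gensM I.embM_injective ?_ ?_
  · let e := cosetEquiv I.closure_gensG I.G.subtype_injective (index_block_singleton_le hi)
    have h1 := Nat.card_congr e
    rw [Nat.card_fin, Nat.card_sigma] at h1
    rw [h1]
    refine (Fin.sum_univ_one _).le.trans hi
  · rw [F_toCl, hcl]
    refine Eq.trans ?_ ((otype_transport _ _).trans (otype_sigma_restrict I.M
      (block [List.ofFn w]))).symm
    exact (Fin.sum_univ_one fun c : Fin 1 =>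
      restrictCl I.M (cls (block [List.ofFn w] c))).symm

theorem exists_extProg : ∃ (p : Prog) (q : Polynomial ℕ), ∀ (I : HomExtSym) (S : I.oms.SubSum)
    (l : List ((Fin (2 * I.n) → I.G) × ℕ)), Represents (decWord I.m) l S.1 →
      p.HaltsWithin (.cons I.code (I.codeMultisetV l)) (q.eval (I.n + I.m)) (fun y =>
        ∃ φ : I.Ext, I.extEquiv (Quotient.mk _ φ) = S ∧ y = I.codeExt φ) := by
  let J := {j : Σ I : HomExtSym, I.oms.SubSum × List ((Fin (2 * I.n) → I.G) × ℕ) //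
    Represents (decWord j.1.m) j.2.2 j.2.1.1}
  let I : J → HomExtSym := fun j => j.1.1
  let l : ∀ j : J, List ((Fin (2 * (I j).n) → (I j).G) × ℕ) := fun j => j.1.2.2
  let Γ : Ctx := ⟨J, fun j => (I j).n + (I j).m, fun j => .cons (I j).code ((I j).codeMultisetV (l j))⟩
  have hs : ∀ j : Γ.ι, Γ.s j = (I j).n + (I j).m := fun _ => rfl
  have hS : ∀ j : J, Multiset.card (α := ConjLeq (I j).G (I j).m) j.1.2.1.1 ≤ (I j).m :=
    fun j => (I j).card_le_of_mem_SubSum j.1.2.1.2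
  have henv : Computes Γ Γ.env := Computes.env (((bdd_code hs).add (bdd_multiset hs l
    (fun j => (length_le_of_represents j.2).trans (hS j))
    fun j p hp => (multiplicity_le_of_represents j.2 hp).trans (hS j))).add (.const 1))
  have hc : Computes Γ fun j => (I j).code := henv.fst
  have hm : ∀ (j : Γ.ι) c, (block (expand (l j)) c).index ≤ (I j).m :=
    fun j => index_block_expand_le j.2
  have hw : Computes Γ fun j => .ofList (Data.ofList fun h => .ofPerm ((I j).G.subtype h))
      (expand (l j)) :=
    Computes.flatMap (Γ := Γ) (T := fun j => (Fin (2 * (I j).n) → (I j).G) × ℕ)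
      (U := fun j => List (I j).G)
      (eU := fun j => Data.ofList fun h => .ofPerm ((I j).G.subtype h))
      (e := fun j p => .cons ((I j).codeWordV p.1) (.ofNat p.2)) (l := l)
      (g := fun j p => List.replicate p.2 (List.ofFn p.1)) henv.snd fun Δ h p _ hp =>
      Computes.replicate (T := fun k => List (I (h.f k)).G)
        (e := fun k => Data.ofList fun g => .ofPerm ((I (h.f k)).G.subtype g))
        (a := fun k => List.ofFn (p k).1) hp.snd hp.fst
  obtain ⟨φ, hφ, hy⟩ := computes_codeExt hc hm hw (fun j => j.1.2.1)
    fun j => map_toCl_of_represents j.2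
  obtain ⟨p, q, h⟩ := hy.exists_prog
  exact ⟨p, q, fun I S l hl => h ⟨⟨I, S, l⟩, hl⟩ _ ⟨φ ⟨⟨I, S, l⟩, hl⟩, hφ _, rfl⟩⟩

end HomExtSym

end HomExt

theorem mainTheorem4 :
    ∃ (inputProg equProg eqvProg oracleProg extProg : Prog) (q : Polynomial ℕ),
      ∀ I : HomExtSym,
        -- (a) the instance is well defined: all elements are encoded, and the member of the family
        -- at the class of `L` does not depend on the choice of `L` and of the double coset
        -- representatives
        ((∀ u : I.oms.U, ∃ w, I.oms.dec₁ w = some u) ∧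
          (∀ v : I.oms.V, ∃ w, I.oms.dec₂ w = some v) ∧
          (∀ (L : Subgroup I.G) (hL : L.index ≤ I.m)
            (σ : DoubleCoset.Quotient (L : Set I.G) (I.M : Set I.G) → I.G),
            (∀ d, DoubleCoset.mk L I.M (σ d) = d) →
              I.oms.F (ConjLeq.mk L hL) = fMultiset I.M L hL σ) ∧
          -- the explicit input is computed
          inputProg.HaltsWithin I.code (q.eval (I.n + I.m)) (fun y =>
            ∃ l, Represents I.oms.dec₁ l I.oms.K ∧ y = I.codeExplicit l) ∧
          -- the two equality oracles are answered
          (∀ w w' u u', I.oms.dec₁ w = some u → I.oms.dec₁ w' = some u' →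
            equProg.HaltsWithin (.cons I.code (.cons (I.codeWordU w) (I.codeWordU w')))
              (q.eval (I.n + I.m)) (fun y => ∃ b : Bool, (b = true ↔ u = u') ∧ y = .ofBool b)) ∧
          (∀ w w' v v', I.oms.dec₂ w = some v → I.oms.dec₂ w' = some v' →
            eqvProg.HaltsWithin (.cons I.code (.cons (I.codeWordV w) (I.codeWordV w')))
              (q.eval (I.n + I.m)) (fun y => ∃ b : Bool, (b = true ↔ v = v') ∧ y = .ofBool b)) ∧
          -- the oracle for the family is answered
          (∀ w v, I.oms.dec₂ w = some v →
            oracleProg.HaltsWithin (.cons I.code (I.codeWordV w)) (q.eval (I.n + I.m)) (fun y =>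
              ∃ l, Represents I.oms.dec₁ l (I.oms.F v) ∧ y = I.codeMultisetU l))) ∧
        -- (b) classes of equivalent extensions correspond to solutions, through the multiset of
        -- the classes of point stabilizers
        ∃ Φ : Quotient I.extSetoid ≃ I.oms.SubSum,
          (∀ φ : I.Ext, (Φ (Quotient.mk _ φ)).1 = orbitType φ.1) ∧
          -- (c) a representative is computed from a solution
          (∀ (S : I.oms.SubSum) (l : List ((Fin I.oms.n₂ → I.oms.Alph₂) × ℕ)),
            Represents I.oms.dec₂ l S.1 →
              extProg.HaltsWithin (.cons I.code (I.codeMultisetV l)) (q.eval (I.n + I.m)) (fun y =>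
                ∃ φ : I.Ext, Φ (Quotient.mk _ φ) = S ∧ y = I.codeExt φ)) := by
  obtain ⟨p₁, q₁, h₁⟩ := HomExtSym.exists_inputProg
  obtain ⟨p₂, q₂, h₂⟩ := HomExtSym.exists_conjProg (fun I => I.M) HomExtSym.embM
    HomExtSym.embM_injective HomExtSym.gensM HomExtSym.closure_gensM
    fun Γ I hc => HomExtSym.computes_gensM hc
  obtain ⟨p₃, q₃, h₃⟩ := HomExtSym.exists_conjProg (fun I => I.G) (fun I => I.G.subtype)
    (fun I => I.G.subtype_injective) HomExtSym.gensG HomExtSym.closure_gensG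
    fun Γ I hc => HomExtSym.computes_gensG hc
  obtain ⟨p₄, q₄, h₄⟩ := HomExtSym.exists_oracleProg
  obtain ⟨p₅, q₅, h₅⟩ := HomExtSym.exists_extProg
  have hmono : ∀ {p : Prog} {x : Data} {T T' : ℕ} {Post : Data → Prop}, T ≤ T' →
      p.HaltsWithin x T Post → p.HaltsWithin x T' Post :=
    fun hT ⟨y, t, he, ht, hP⟩ => ⟨y, t, he, ht.trans hT, hP⟩
  -- the polynomials take values in `ℕ`, so their sum bounds each of them
  refine ⟨p₁, p₂, p₃, p₄, p₅, q₁ + q₂ + q₃ + q₄ + q₅, fun I => ?_⟩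
  simp only [Polynomial.eval_add]
  refine ⟨⟨HomExtSym.exists_decWord I.embM_injective,
    HomExtSym.exists_decWord I.G.subtype_injective, I.F_mk, hmono (by omega) (h₁ I),
    fun w w' u u' hu hu' => hmono (by omega) (h₂ I w w' u u' hu hu'),
    fun w w' v v' hv hv' => hmono (by omega) (h₃ I w w' v v' hv hv'),
    fun w v hv => hmono (by omega) (h₄ I w v hv)⟩, I.extEquiv, I.extEquiv_mk,
    fun S l hl => hmono (by omega) (h₅ I S l hl)⟩
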